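/- **Setting.** Let $K$ be a field, $N\ge 1$, and let $q\in K$ be nonzero. Put $[n]:=\sum_{i=0}^{n-1}q^{n-1-2i}$; for types BI, BII and BIII assume $[n]\neq 0$ for all $n\ge 1$. Let $V_1$ have basis $(v_1,v_{-1})$, and write $v_\epsilon=v_{\epsilon_1}\otimes\cdots\otimes v_{\epsilon_N}$ for the standard basis of $V_1^{\otimes N}$, $\epsilon\in\{+,-\}^N$ ($+$ is $v_1$, $-$ is $v_{-1}$). For $Q,Q_0\in K^\times$, let $e_i$ ($1\le i\le N-1$) act on the factors $i,i+1$, $e_N$ on the factor $N$ and $e_0$ on the factor $1$ by, respectively, $$\begin{pmatrix}0&0&0&0\\0&-q^{-1}&1&0\\0&1&-q&0\\0&0&0&0\end{pmatrix},\qquad\begin{pmatrix}-Q^{-1}&1\\1&-Q\end{pmatrix},\qquad\begin{pmatrix}-Q_0&1\\1&-Q_0^{-1}\end{pmatrix}$$ in the bases $(v_1\otimes v_1,v_1\otimes v_{-1},v_{-1}\otimes v_1,v_{-1}\otimes v_{-1})$ and $(v_1,v_{-1})$. **Diagrams.** A string $b\in\{+,-\}^N$ is a row of up ($+$) and down ($-$)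 arrows. Repeatedly connect an adjacent pair (down arrow, up arrow), in this order, by a (simple) arc, ignoring arrows already connected. Let $S$ be the set of arcs, $S_\uparrow$ the set of remaining up arrows, and number the remaining down arrows $1,2,\dots$ from right to left. The diagram $D$ of $b$ stands for the vector $|D\rangle\in V_1^{\otimes N}$ which is the tensor product of: $v_1$ for each remaining up arrow; $v_{-1}\otimes v_1-q^{-1}v_1\otimes v_{-1}$ for each arc; and for the remaining down arrows: * BII: $v_{-1}-Q^{-1}v_1$ for those with odd number (set $S_{\rm o}$), $v_{-1}+q^{-1}Qv_1$ for those with even number (set $S_{\rm e}$). * BIII: $v_{-1}-q^{p-1}Q^{-1}v_1$ for the one with number $p$. The set of all of them is $S_\downarrow$. * BI ($Q=q^M$, $M\ge1$): the one with number $M+1-p$ carries the integer $p$ for $2\le p\le M$, and the one with number $M$ carries a star (regarded as the integer $1$); the one carrying $p\in\{1,\dots,M\}$ gives $v_{-1}-q^{-p}v_1$. Those with number $>M$ are paired in adjacent pairs from right to left; each pair is a dashed arc, giving $v_{-1}\otimes v_{-1}-q^{-1}v_1\otimes v_1$. If one arrow is left over, it is called the unpaired down arrow, and gives $v_{-1}$.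 The size of an arc $A$ connecting the positions $i<j$ is $m_A=(j-i+1)/2$. In all enumerations below, of arrows and (dashed) arcs, nested arcs are enumerated from outside to inside when going from left to right and from inside to outside when going from right to left, i.e. an arc counts at its left end. **The vectors.** $\Psi=\sum_D\Psi_D|D\rangle$, the sum being over the diagrams of all $b\in\{+,-\}^N$, with the following components. *Standard basis:* $\Psi=\sum_\epsilon\Psi_\epsilon v_\epsilon$, $\Psi_\epsilon=\prod_{k:\epsilon_k=+}q^{N-k}Q$. *BII:* $\Psi_D=\prod_{A\in S\cup S_{\rm e}}[N_A]\prod_{B\in S}[m_B]^{-1}\prod_{C\in S_{\rm e}}[N_C]^{-1}\prod_{E\in S\cup S_\uparrow}(q^{N_E-1}Q+q^{-(N_E-1)}Q^{-1})$, where $N_A$ is the number of $A$ in the enumeration of $S\cup S_\uparrow\cup S_{\rm e}$ from the left, $N_C$ that of $C$ in the enumeration of $S\cup S_{\rm e}$ from the right, $N_E$ that of $E$ in the enumeration of $S\cup S_\uparrow\cup S_{\rm o}$ from the right. *BIII:* $\Psi_D=\prod_{A\in S\cup S_\downarrow}[N_A]\prod_{B\in S}[m_B]^{-1}\prod_{C\in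 S_\downarrow}[N_C]^{-1}\prod_{i=1}^{|S_\uparrow|+|S|}(Qq^{i-1}+Q^{-1}q^{-(i-1)})$, where $N_A$ is the number of $A$ in the enumeration of $S\cup S_\uparrow\cup S_\downarrow$ from the left and $N_C$ that of $C$ in the enumeration of $S\cup S_\downarrow$ from the right. *BI:* Let $N_\uparrow=|S_\uparrow|$ and let $N_1\in\{0,1\}$ be the number of unpaired down arrows. Let $s_p$ be the position (from the left) of the down arrow carrying $p$. Let $T$ be the set of dashed arcs, and $T'$ the set of dashed arcs except the leftmost. Let $U$ (resp. $U'$) be the set of down arrows carrying $p$ with $2\le p\le M$ (resp. $2\le p\le M-1$), and let $V$ (resp. $V'$) be $U$ (resp. $U'$) together with the starred arrow if it exists. Let $S_R$ be the set of arcs right of the arrow carrying $M$; $S_{W'}$ the arcs right of the star and left of the arrow carrying $M$; $S_W$ the arcs left of the star and right of the unpaired down arrow (if $N_1=1$), resp. right of the left end of the leftmost dashed arc (if $N_1=0$); $S_L$, if the star exists, the arcs left of the leftmost down arrow not in a simple arc and right of all remaining up arrows. Each of these sets is empty if an arrow or dashed arc used in its definition does not exist (the condition involving up arrows in $S_L$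 is void if there are none). A superscript $+$ means the subset of those arcs that lie inside no other arc and no dashed arc. Put $N_2=N_\uparrow+N_1+|S|+|T|$, $N_3=|S_W|+|T|$, $N_4=|S_{W'}|+|S_W|+|T|+M$, $N_5=N-|S|+|S_L|+|S_W|+|S_{W'}|+|S_R|+M$. For an arc $A$ at positions $i<j$, a down arrow $C$ carrying $p$, and a dashed arc $E$ with left end at position $k$, put $d_{1,A,C}=(i-s_p+M-p+1)/2$, $d_{2,A}=(i-s_1+M)/2$, $d_{3,A}=N-j$, $d_{4,C}=(s_M-s_p+M-p)/2+1$, $d_{5,E}=(s_M-k+M+1)/2$. For $A'\in S_W$, let $h_{A'}$ be the number of arcs in $S_W$ that are right of $A'$ or outside of $A'$ (including $A'$) plus the number of dashed arcs right of $A'$. Put * $N_6=[N_5]/[N_4]$ if $|V|=M$ and $N_1=0$, else $N_6=1$; * $N_7=\prod_{C\in U}\prod_{A\in S_R^+}\frac{[d_{1,A,C}]}{[d_{1,A,C}+m_A]}$; * $N_8=\prod_{A\in S_R^+}\Big(\prod_{i=0}^{N_3}\frac{[d_{2,A}+i]}{[d_{2,A}+m_A+i]}\prod_{A'\in S_W}\frac{[d_{2,A}+m_A+h_{A'}]}{[d_{2,A}+h_{A'}]}\Big)$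 if $|V|=M$, else $N_8=1$; * $N_9=\prod_A\frac{[d_{3,A}+m_A+M]}{[d_{3,A}+2m_A+M]}$, over $A\in S_W^+$ if $N_1=1$ and over $A\in S_W^+\cup S_L^+$ if $N_1=0$; * $N_{10}=\prod_{C\in U'}[d_{4,C}]^{-1}$ if $N_1=0$ and $T=\emptyset$; $N_{10}=\prod_{C\in V'}[d_{4,C}]^{-1}\prod_{E\in T'}[d_{5,E}]^{-1}$ if $N_1=0$ and $T\ne\emptyset$; $N_{10}=\prod_{C\in V'}[d_{4,C}]^{-1}\prod_{E\in T}[d_{5,E}]^{-1}$ if $N_1=1$; * $N_{11}=\prod_A[N_A]$ over the arcs, the dashed arcs, the elements of $U$ and the unpaired down arrow, where $N_A$ is the number of $A$ in the enumeration from the left of these objects together with the remaining up arrows; * $N_{12}=\prod_{i=1}^{N_2}(q^{i+M-1}+q^{-(i+M-1)})\Big/\prod_B(q^{N_B}+q^{-N_B})$, where $B$ runs over the dashed arcs and the starred arrow and $N_B$ is the number of $B$ in the enumeration of $S\cup T\cup V$ from the right. Then $\Psi_D=\prod_{A\in S}[m_A]^{-1}\cdot N_6N_7N_8N_9N_{10}N_{11}N_{12}$.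 **Theorem.** For type BI (with $Q=q^M$, any $M\ge1$), for types BII and BIII (any $Q\in K^\times$), and for the standard basis (any $Q\in K^\times$; here the assumption $[n]\ne0$ is not needed), the vector $\Psi$ satisfies $$e_i\Psi=0\quad(1\le i\le N),$$ and $$e_0\Psi=0\quad\text{whenever } q^{N-1}QQ_0=1 .$$ -/

import Mathlib

open Finset

namespace TwoBoundaryTL

/-! ## The representation on `V₁ ^ ⊗ N`

`true` stands for `+` (the vector `v₁`) and `false` for `-` (the vector `v₋₁`). The space
`V₁ ^ ⊗ N` is given by its coordinates in the standard basis `v_ε`, `ε : Fin N → Bool`; the tensor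
factor number `k` (counted from the left, starting with one) has index `k - 1 : Fin N`. -/

section Operators

variable {K : Type*} [Field K] {N : ℕ}

/-- The `4 × 4` matrix of a bulk generator on `V₁ ⊗ V₁`. -/
def bulk (q : K) : Matrix (Bool × Bool) (Bool × Bool) K
  | (true, false), (true, false) => -q⁻¹
  | (true, false), (false, true) => 1
  | (false, true), (true, false) => 1
  | (false, true), (false, true) => -q
  | _, _ => 0

/-- The `2 × 2` matrix of the right boundary generator on `V₁`. -/
def rightBoundary (Q : K) : Matrix Bool Bool K
  | true, true => -Q⁻¹
  | false, false => -Q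
  | _, _ => 1

/-- The `2 × 2` matrix of the left boundary generator on `V₁`. -/
def leftBoundary (Q₀ : K) : Matrix Bool Bool K
  | true, true => -Q₀
  | false, false => -Q₀⁻¹
  | _, _ => 1

/-- The operator acting as `A` on the tensor factor `i` and as the identity elsewhere. -/
def act₁ (A : Matrix Bool Bool K) (i : Fin N) : Matrix (Fin N → Bool) (Fin N → Bool) K :=
  fun ε ε' => if ∀ k, k ≠ i → ε k = ε' k then A (ε i) (ε' i) else 0

/-- The operator acting as `A` on the tensor factors `i`, `j` and as the identity elsewhere. -/
def act₂ (A : Matrix (Bool × Bool) (Bool × Bool) K) (i j : Fin N) :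
    Matrix (Fin N → Bool) (Fin N → Bool) K :=
  fun ε ε' => if ∀ k, k ≠ i → k ≠ j → ε k = ε' k then A (ε i, ε j) (ε' i, ε' j) else 0

/-- `e q Q i` is the generator `e_{i+1}` of the one-boundary Temperley-Lieb algebra, so that
`i : Fin N` runs through `e_1, …, e_N`. -/
def e (q Q : K) (i : Fin N) : Matrix (Fin N → Bool) (Fin N → Bool) K :=
  if h : (i : ℕ) + 1 < N then act₂ (bulk q) i ⟨i + 1, h⟩ else act₁ (rightBoundary Q) i

/-- The generator `e_0` at the left boundary. -/
def e₀ (hN : 0 < N) (Q₀ : K) : Matrix (Fin N → Bool) (Fin N → Bool) K :=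
  act₁ (leftBoundary Q₀) ⟨0, hN⟩

/-- The quantum integer `[n] = q^(n-1) + q^(n-3) + ⋯ + q^(1-n)`. -/
def qint (q : K) (n : ℕ) : K := ∑ i ∈ range n, q ^ ((n : ℤ) - 1 - 2 * (i : ℤ))

/-- `x + x⁻¹`. -/
def sym (x : K) : K := x + x⁻¹

end Operators

/-! ## Diagrams of a binary string -/

section Diagrams

variable {N : ℕ}

/-- `Paired b n i j`: the down arrow `i` and the up arrow `j` on its right are connected by a simple
arc after at most `n` rounds of pairing adjacent (down, up) arrows; arrows are adjacent if all the
arrows between them have already been paired among themselves. -/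
def Paired (b : Fin N → Bool) : ℕ → Fin N → Fin N → Prop
  | 0, _, _ => False
  | n + 1, i, j => i < j ∧ b i = false ∧ b j = true ∧
      ∀ k, i < k → k < j → ∃ l, i < l ∧ l < j ∧ (Paired b n k l ∨ Paired b n l k)

instance decidablePaired (b : Fin N → Bool) :
    ∀ (n : ℕ) (i j : Fin N), Decidable (Paired b n i j)
  | 0, _, _ => inferInstanceAs (Decidable False)
  | n + 1, i, j =>
    haveI := decidablePaired b n
    inferInstanceAs (Decidable (i < j ∧ b i = false ∧ b j = true ∧
      ∀ k, i < k → k < j → ∃ l, i < l ∧ l < j ∧ (Paired b n k l ∨ Paired b n l k)))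

/-- The set of simple arcs, as pairs (left end, right end). There are no new pairs after `N`
rounds. -/
def arcs (b : Fin N → Bool) : Finset (Fin N × Fin N) :=
  univ.filter fun A => Paired b N A.1 A.2

/-- The unpaired up arrows. -/
def ups (b : Fin N → Bool) : Finset (Fin N) :=
  univ.filter fun k => b k = true ∧ ∀ A ∈ arcs b, A.2 ≠ k

/-- The down arrows that are not part of a simple arc. -/
def downs (b : Fin N → Bool) : Finset (Fin N) :=
  univ.filter fun k => b k = false ∧ ∀ A ∈ arcs b, A.1 ≠ k

/-- The position (from one to `N`, from the left) of an arrow. -/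
def pos (k : Fin N) : ℕ := k + 1

/-- The size of an arc. -/
def size (A : Fin N × Fin N) : ℕ := (pos A.2 - pos A.1 + 1) / 2

/-- The left ends of a set of arcs. -/
def lefts (S : Finset (Fin N × Fin N)) : Finset (Fin N) := S.image Prod.fst

/-- The number of `k` when `X` is enumerated from left to right by `1, 2, …`. An arc is represented
by its left end, so nested arcs are enumerated from outside to inside. -/
def numL (X : Finset (Fin N)) (k : Fin N) : ℕ := (X.filter fun l => l ≤ k).card

/-- The number of `k` when `X` is enumerated from right to left by `1, 2, …`. An arc is represented
by its left end, so nested arcs are enumerated from inside to outside. -/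
def numR (X : Finset (Fin N)) (k : Fin N) : ℕ := (X.filter fun l => k ≤ l).card

/-- The number of an element of `downs b`, counted from the right. -/
def downNum (b : Fin N → Bool) (k : Fin N) : ℕ := numR (downs b) k

variable {K : Type*} [Field K]

/-- Coordinates of `v₁`. -/
def upVec : Bool → K
  | true => 1
  | false => 0

/-- Coordinates of `v₋₁ + c v₁`. -/
def downVec (c : K) : Bool → K
  | true => c
  | false => 1

/-- Coordinates of the simple arc `v₋₁ ⊗ v₁ - q⁻¹ v₁ ⊗ v₋₁`. -/
def arcVec (q : K) : Bool → Bool → K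
  | false, true => 1
  | true, false => -q⁻¹
  | _, _ => 0

/-- Coordinates of the dashed arc `v₋₁ ⊗ v₋₁ - q⁻¹ v₁ ⊗ v₁`. -/
def dashedVec (q : K) : Bool → Bool → K
  | false, false => 1
  | true, true => -q⁻¹
  | _, _ => 0

end Diagrams

/-! ## The standard basis -/

section Standard

variable {K : Type*} [Field K] {N : ℕ}

/-- The component of `Ψ` at `ε` in the standard basis; the position of `k` from the right, minus
one, is `N - 1 - k`. -/
def psiStd (q Q : K) (ε : Fin N → Bool) : K :=
  q ^ (∑ k ∈ univ.filter (fun k => ε k = true), (N - 1 - (k : ℕ))) *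
    Q ^ (univ.filter fun k => ε k = true).card

/-- The vector `Ψ` of the standard basis. -/
def PsiStd (N : ℕ) (q Q : K) : (Fin N → Bool) → K :=
  ∑ ε, psiStd q Q ε • Pi.single ε 1

end Standard

/-! ## Type BII -/

section BII

variable {K : Type*} [Field K] {N : ℕ}

/-- The e-unpaired down arrows. -/
def eDowns (b : Fin N → Bool) : Finset (Fin N) := (downs b).filter fun k => Even (downNum b k)

/-- The o-unpaired down arrows. -/
def oDowns (b : Fin N → Bool) : Finset (Fin N) := (downs b).filter fun k => Odd (downNum b k)

/-- The basis vector of type BII of a binary string. -/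
def ketBII (q Q : K) (b : Fin N → Bool) : (Fin N → Bool) → K := fun ε =>
  (∏ k ∈ ups b, upVec (ε k)) * (∏ A ∈ arcs b, arcVec q (ε A.1) (ε A.2)) *
  (∏ k ∈ oDowns b, downVec (-Q⁻¹) (ε k)) * (∏ k ∈ eDowns b, downVec (q⁻¹ * Q) (ε k))

/-- The component of `Ψ` for type BII. -/
def psiBII (q Q : K) (b : Fin N → Bool) : K :=
  (∏ k ∈ lefts (arcs b) ∪ eDowns b, qint q (numL (lefts (arcs b) ∪ ups b ∪ eDowns b) k)) *
  (∏ B ∈ arcs b, (qint q (size B))⁻¹) *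
  (∏ k ∈ eDowns b, (qint q (numR (lefts (arcs b) ∪ eDowns b) k))⁻¹) *
  (∏ k ∈ lefts (arcs b) ∪ ups b,
    sym (q ^ (numR (lefts (arcs b) ∪ ups b ∪ oDowns b) k - 1) * Q))

/-- The vector `Ψ` for type BII. -/
def PsiBII (N : ℕ) (q Q : K) : (Fin N → Bool) → K :=
  ∑ b, psiBII q Q b • ketBII q Q b

end BII

/-! ## Type BIII -/

section BIII

variable {K : Type*} [Field K] {N : ℕ}

/-- The basis vector of type BIII of a binary string. -/
def ketBIII (q Q : K) (b : Fin N → Bool) : (Fin N → Bool) → K := fun ε =>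
  (∏ k ∈ ups b, upVec (ε k)) * (∏ A ∈ arcs b, arcVec q (ε A.1) (ε A.2)) *
  (∏ k ∈ downs b, downVec (-(q ^ (downNum b k - 1) * Q⁻¹)) (ε k))

/-- The component of `Ψ` for type BIII. -/
def psiBIII (q Q : K) (b : Fin N → Bool) : K :=
  (∏ k ∈ lefts (arcs b) ∪ downs b, qint q (numL (lefts (arcs b) ∪ ups b ∪ downs b) k)) *
  (∏ B ∈ arcs b, (qint q (size B))⁻¹) *
  (∏ k ∈ downs b, (qint q (numR (lefts (arcs b) ∪ downs b) k))⁻¹) *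
  (∏ i ∈ Icc 1 ((ups b).card + (arcs b).card), sym (Q * q ^ (i - 1)))

/-- The vector `Ψ` for type BIII. -/
def PsiBIII (N : ℕ) (q Q : K) : (Fin N → Bool) → K :=
  ∑ b, psiBIII q Q b • ketBIII q Q b

end BIII

/-! ## Type BI

Here `M` is the positive integer with `Q = q ^ M`. -/

namespace BI

section

variable {N : ℕ} (M : ℕ) (b : Fin N → Bool)

/-- The integer `p` (`1 ≤ p ≤ M`) on a down arrow: the `(M + 1 - p)`-th element of `downs b` from
the right carries `p`, where `p = 1` is the star. The value is zero for the remaining down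
arrows. -/
def label (k : Fin N) : ℕ := M + 1 - downNum b k

/-- The down arrow with the integer `p` (with the star for `p = 1`), as a set with at most one
element. -/
def labelled (p : ℕ) : Finset (Fin N) := (downs b).filter fun k => label M b k = p

/-- The position `s_p` of the down arrow with the integer `p` (with the star for `p = 1`). -/
def s (p : ℕ) : ℕ := ∑ k ∈ labelled M b p, pos k

/-- The set `T` of dashed arcs: the elements of `downs b` to the left of the star are paired from
right to left. -/
def T : Finset (Fin N × Fin N) :=
  univ.filter fun E => E.1 ∈ downs b ∧ E.2 ∈ downs b ∧ M < downNum b E.2 ∧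
    Odd (downNum b E.2 - M) ∧ downNum b E.1 = downNum b E.2 + 1

/-- The unpaired down arrow that is left over, as a set with at most one element. -/
def unpaired : Finset (Fin N) :=
  (downs b).filter fun k => M < downNum b k ∧ ∀ E ∈ T M b, E.1 ≠ k ∧ E.2 ≠ k

/-- `N_1`. -/
def N₁ : ℕ := (unpaired M b).card

/-- `S_R`. -/
def SR : Finset (Fin N × Fin N) :=
  (arcs b).filter fun A => ∃ k ∈ labelled M b M, k < A.1

/-- `S_{W'}`. -/
def SW' : Finset (Fin N × Fin N) :=
  (arcs b).filter fun A => (∃ k ∈ labelled M b 1, k < A.1) ∧ ∃ k ∈ labelled M b M, A.2 < k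

/-- `S_W`. -/
def SW : Finset (Fin N × Fin N) :=
  (arcs b).filter fun A => (∃ k ∈ labelled M b 1, A.2 < k) ∧
    if N₁ M b = 1 then ∃ k ∈ unpaired M b, k < A.1 else ∃ E ∈ T M b, E.1 < A.1

/-- `S_L`. -/
def SL : Finset (Fin N × Fin N) :=
  (arcs b).filter fun A => (labelled M b 1).Nonempty ∧ (∀ k ∈ ups b, k < A.1) ∧
    ∀ k ∈ downs b, A.2 < k

/-- The arcs in `R` without any arc or dashed arc outside of them. -/
def outer (R : Finset (Fin N × Fin N)) : Finset (Fin N × Fin N) :=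
  R.filter fun A => ∀ B ∈ arcs b ∪ T M b, ¬(B.1 < A.1 ∧ A.2 < B.2)

/-- `T'`: the dashed arcs except the leftmost one. -/
def T' : Finset (Fin N × Fin N) := (T M b).filter fun E => ∃ E' ∈ T M b, E'.1 < E.1

/-- `U`: the down arrows with an integer `p`, `2 ≤ p ≤ M`. -/
def U : Finset (Fin N) := (downs b).filter fun k => 2 ≤ label M b k ∧ label M b k ≤ M

/-- `U'`: the down arrows with an integer `p`, `2 ≤ p ≤ M - 1`. -/
def U' : Finset (Fin N) := (downs b).filter fun k => 2 ≤ label M b k ∧ label M b k ≤ M - 1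

/-- `V`: the union of `U` and the down arrow with the star. -/
def V : Finset (Fin N) := U M b ∪ labelled M b 1

/-- `V'`: the union of `U'` and the down arrow with the star. -/
def V' : Finset (Fin N) := U' M b ∪ labelled M b 1

/-- `N_2`. -/
def N₂ : ℕ := (ups b).card + N₁ M b + (arcs b).card + (T M b).card

/-- `N_3`. -/
def N₃ : ℕ := (SW M b).card + (T M b).card

/-- `N_4`. -/
def N₄ : ℕ := (SW' M b).card + (SW M b).card + (T M b).card + M

/-- `N_5`. -/
def N₅ : ℕ := N - (arcs b).card + (SL M b).card + (SW M b).card + (SW' M b).card +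
  (SR M b).card + M

/-- `d_{1,A,C}`; here `C` carries `p = label M b C` and `s_p = pos C`. -/
def d₁ (A : Fin N × Fin N) (C : Fin N) : ℕ := (pos A.1 - pos C + M - label M b C + 1) / 2

/-- `d_{2,A}`. -/
def d₂ (A : Fin N × Fin N) : ℕ := (pos A.1 - s M b 1 + M) / 2

/-- `d_{3,A}`. -/
def d₃ (A : Fin N × Fin N) : ℕ := N - pos A.2

/-- `d_{4,C}`; here `C` carries `p = label M b C` and `s_p = pos C`. -/
def d₄ (C : Fin N) : ℕ := (s M b M - pos C + M - label M b C) / 2 + 1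

/-- `d_{5,E}`. -/
def d₅ (E : Fin N × Fin N) : ℕ := (s M b M - pos E.1 + M + 1) / 2

/-- `h_{A}` for `A ∈ S_W`: the number of arcs in `S_W` to the right of `A` or outside of `A`
(including `A`), plus the number of dashed arcs to the right of `A`. -/
def h (A : Fin N × Fin N) : ℕ :=
  ((SW M b).filter fun B => A.2 < B.1 ∨ (B.1 ≤ A.1 ∧ A.2 ≤ B.2)).card +
    ((T M b).filter fun E => A.2 < E.1).card

end

section

variable {K : Type*} [Field K] {N : ℕ} (q : K) (M : ℕ) (b : Fin N → Bool)

/-- The basis vector of type BI of a binary string. -/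
def ket : (Fin N → Bool) → K := fun ε =>
  (∏ k ∈ ups b, upVec (ε k)) * (∏ A ∈ arcs b, arcVec q (ε A.1) (ε A.2)) *
  (∏ k ∈ V M b, downVec (-(q ^ label M b k)⁻¹) (ε k)) *
  (∏ E ∈ T M b, dashedVec q (ε E.1) (ε E.2)) *
  (∏ k ∈ unpaired M b, downVec 0 (ε k))

/-- `N_6`. -/
def N₆ : K :=
  if (V M b).card = M ∧ N₁ M b = 0 then qint q (N₅ M b) / qint q (N₄ M b) else 1

/-- `N_7`. -/
def N₇ : K :=
  ∏ C ∈ U M b, ∏ A ∈ outer M b (SR M b), qint q (d₁ M b A C) / qint q (d₁ M b A C + size A)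

/-- `N_8`. -/
def N₈ : K :=
  if (V M b).card = M then
    ∏ A ∈ outer M b (SR M b),
      ((∏ i ∈ range (N₃ M b + 1), qint q (d₂ M b A + i) / qint q (d₂ M b A + size A + i)) *
        ∏ A' ∈ SW M b, qint q (d₂ M b A + size A + h M b A') / qint q (d₂ M b A + h M b A'))
  else 1

/-- `N_9`. -/
def N₉ : K :=
  if N₁ M b = 1 then
    ∏ A ∈ outer M b (SW M b), qint q (d₃ A + size A + M) / qint q (d₃ A + 2 * size A + M)
  else
    ∏ A ∈ outer M b (SW M b) ∪ outer M b (SL M b),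
      qint q (d₃ A + size A + M) / qint q (d₃ A + 2 * size A + M)

/-- `N_10`. -/
def N₁₀ : K :=
  if N₁ M b = 1 then
    (∏ C ∈ V' M b, (qint q (d₄ M b C))⁻¹) * ∏ E ∈ T M b, (qint q (d₅ M b E))⁻¹
  else if T M b = ∅ then
    ∏ C ∈ U' M b, (qint q (d₄ M b C))⁻¹
  else
    (∏ C ∈ V' M b, (qint q (d₄ M b C))⁻¹) * ∏ E ∈ T' M b, (qint q (d₅ M b E))⁻¹

/-- `N_11`. -/
def N₁₁ : K :=
  ∏ k ∈ lefts (arcs b) ∪ lefts (T M b) ∪ U M b ∪ unpaired M b,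
    qint q (numL (ups b ∪ unpaired M b ∪ lefts (arcs b) ∪ lefts (T M b) ∪ U M b) k)

/-- `N_12`. -/
def N₁₂ : K :=
  (∏ i ∈ Icc 1 (N₂ M b), sym (q ^ (i + M - 1))) /
    ∏ k ∈ lefts (T M b) ∪ labelled M b 1,
      sym (q ^ numR (lefts (arcs b) ∪ lefts (T M b) ∪ V M b) k)

/-- The component of `Ψ` for type BI. -/
def psi : K :=
  (∏ A ∈ arcs b, (qint q (size A))⁻¹) * N₆ q M b * N₇ q M b * N₈ q M b * N₉ q M b *
    N₁₀ q M b * N₁₁ q M b * N₁₂ q M b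

end

end BI

/-- The vector `Ψ` for type BI with `Q = q ^ M`. -/
def PsiBI {K : Type*} [Field K] (N : ℕ) (q : K) (M : ℕ) : (Fin N → Bool) → K :=
  ∑ b, BI.psi q M b • BI.ket q M b

end TwoBoundaryTL

namespace TwoBoundaryTL

section Matching

variable {N : ℕ}

/-- `S`, `U`, `D` are the arcs, the remaining up arrows and the remaining down arrows of a
noncrossing matching of the string `b` in which no remaining down arrow is left of a remaining
up arrow. -/
structure IsMatching (b : Fin N → Bool) (S : Finset (Fin N × Fin N)) (U D : Finset (Fin N)) :
    Prop where
  lt : ∀ i j, (i, j) ∈ S → i < j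
  fst_false : ∀ i j, (i, j) ∈ S → b i = false
  snd_true : ∀ i j, (i, j) ∈ S → b j = true
  up : ∀ k ∈ U, b k = true
  down : ∀ k ∈ D, b k = false
  cover : ∀ k, k ∈ U ∨ k ∈ D ∨ (∃ l, (k, l) ∈ S) ∨ ∃ l, (l, k) ∈ S
  fst_inj : ∀ i j j', (i, j) ∈ S → (i, j') ∈ S → j = j'
  snd_inj : ∀ i i' j, (i, j) ∈ S → (i', j) ∈ S → i = i'
  noncross : ∀ i j i' j', (i, j) ∈ S → (i', j') ∈ S → i < i' → i' < j → j' < j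
  up_out : ∀ k ∈ U, ∀ i j, (i, j) ∈ S → k < i ∨ j < k
  down_out : ∀ k ∈ D, ∀ i j, (i, j) ∈ S → k < i ∨ j < k
  up_lt_down : ∀ k ∈ U, ∀ l ∈ D, k < l

/-- The recursive description of the relation `connected by an arc`. -/
def IsPairing (b : Fin N → Bool) (P : Fin N → Fin N → Prop) : Prop :=
  ∀ i j, P i j ↔ i < j ∧ b i = false ∧ b j = true ∧
    ∀ k, i < k → k < j → ∃ l, i < l ∧ l < j ∧ (P k l ∨ P l k)

theorem IsPairing.unique {b : Fin N → Bool} {P P' : Fin N → Fin N → Prop} (h : IsPairing b P)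
    (h' : IsPairing b P') : ∀ (n : ℕ) (i j : Fin N), (j : ℕ) - i ≤ n → (P i j ↔ P' i j) := by
  intro n
  induction n with
  | zero =>
    intro i j hij
    rw [h i j, h' i j]
    constructor <;> rintro ⟨h1, -⟩ <;> rw [Fin.lt_def] at h1 <;> omega
  | succ n ih =>
    intro i j hij
    rw [h i j, h' i j]
    have key : ∀ k l : Fin N, i < k → k < j → i < l → l < j → (P k l ↔ P' k l) := by
      intro k l hk hk' hl hl'
      apply ih
      rw [Fin.lt_def] at hk hk' hl hl'
      omega
    constructor <;> rintro ⟨h1, h2, h3, h4⟩ <;> refine ⟨h1, h2, h3, fun k hk hk' => ?_⟩ <;>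
      obtain ⟨l, hl, hl', hP⟩ := h4 k hk hk' <;> refine ⟨l, hl, hl', ?_⟩
    · rwa [← key k l hk hk' hl hl', ← key l k hl hl' hk hk']
    · rwa [key k l hk hk' hl hl', key l k hl hl' hk hk']

theorem paired_succ_iff (b : Fin N → Bool) : ∀ (n : ℕ) (i j : Fin N), (j : ℕ) - i ≤ n →
    (Paired b n i j ↔ Paired b (n + 1) i j) := by
  intro n
  induction n with
  | zero =>
    intro i j hij
    constructor
    · intro h; exact absurd h (by simp [Paired])
    · rintro ⟨h1, -⟩
      rw [Fin.lt_def] at h1; omega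
  | succ n ih =>
    intro i j hij
    rw [Paired, Paired]
    have key : ∀ k l : Fin N, i < k → k < j → i < l → l < j →
        (Paired b n k l ↔ Paired b (n + 1) k l) := by
      intro k l hk hk' hl hl'
      apply ih
      rw [Fin.lt_def] at hk hk' hl hl'
      omega
    constructor <;> rintro ⟨h1, h2, h3, h4⟩ <;> refine ⟨h1, h2, h3, fun k hk hk' => ?_⟩ <;>
      obtain ⟨l, hl, hl', hP⟩ := h4 k hk hk' <;> refine ⟨l, hl, hl', ?_⟩
    · rwa [← key k l hk hk' hl hl', ← key l k hl hl' hk hk']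
    · rwa [key k l hk hk' hl hl', key l k hl hl' hk hk']

theorem isPairing_paired (b : Fin N → Bool) : IsPairing b (Paired b N) := by
  intro i j
  rw [paired_succ_iff b N i j (by omega), Paired]

theorem IsMatching.isPairing {b : Fin N → Bool} {S : Finset (Fin N × Fin N)}
    {U D : Finset (Fin N)} (h : IsMatching b S U D) : IsPairing b fun i j => (i, j) ∈ S := by
  intro i j
  obtain ⟨hlt, hf, hs, hu, hd, hc, hfi, hsi, hn, huo, hdo, hud⟩ := h
  constructor
  · intro hij
    refine ⟨hlt _ _ hij, hf _ _ hij, hs _ _ hij, fun k hk hk' => ?_⟩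
    rcases hc k with h1 | h1 | ⟨l, h1⟩ | ⟨l, h1⟩
    · have := huo k h1 i j hij; omega
    · have := hdo k h1 i j hij; omega
    · have := hn _ _ _ _ hij h1 hk hk'
      have := hlt _ _ h1
      exact ⟨l, by omega, by omega, Or.inl h1⟩
    · have := hlt _ _ h1
      refine ⟨l, ?_, by omega, Or.inr h1⟩
      rcases lt_trichotomy i l with h2 | h2 | h2
      · exact h2
      · subst h2; have := hfi _ _ _ hij h1; omega
      · have := hn _ _ _ _ h1 hij h2 (by omega); omega
  · rintro ⟨h1, h2, h3, h4⟩
    have h4' : ∀ k l, (i < k ∧ k < j) → ((k, l) ∈ S ∨ (l, k) ∈ S) → i < l ∧ l < j := by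
      rintro k l ⟨hk, hk'⟩ hkl
      obtain ⟨l', hl, hl', hP⟩ := h4 k hk hk'
      grind
    rcases hc i with h5 | h5 | ⟨y, h5⟩ | ⟨y, h5⟩
    · grind
    · rcases hc j with h6 | h6 | ⟨x, h6⟩ | ⟨x, h6⟩
      · grind
      · grind
      · grind
      · have := hdo i h5 x j h6
        have := hlt _ _ h6
        grind
    · rcases lt_trichotomy y j with h6 | h6 | h6
      · have := hlt _ _ h5
        have := h4' y i ⟨this, h6⟩ (Or.inr h5)
        omega
      · grind
      · rcases hc j with h7 | h7 | ⟨x, h7⟩ | ⟨x, h7⟩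
        · grind
        · grind
        · grind
        · have := hlt _ _ h7
          rcases lt_trichotomy x i with h8 | h8 | h8
          · have := hn _ _ _ _ h7 h5 h8 h1; omega
          · grind
          · have := h4' x j ⟨h8, this⟩ (Or.inl h7)
            omega
    · grind

theorem IsMatching.arcs_eq {b : Fin N → Bool} {S : Finset (Fin N × Fin N)}
    {U D : Finset (Fin N)} (h : IsMatching b S U D) : arcs b = S := by
  ext ⟨i, j⟩
  rw [arcs, mem_filter]
  simp only [mem_univ, true_and]
  exact (isPairing_paired b).unique h.isPairing N i j (by omega)

theorem IsMatching.ups_eq {b : Fin N → Bool} {S : Finset (Fin N × Fin N)}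
    {U D : Finset (Fin N)} (h : IsMatching b S U D) : ups b = U := by
  ext k
  rw [ups, h.arcs_eq, mem_filter]
  simp only [mem_univ, true_and]
  obtain ⟨hlt, hf, hs, hu, hd, hc, hfi, hsi, hn, huo, hdo, hud⟩ := h
  constructor
  · rintro ⟨h1, h2⟩
    rcases hc k with h5 | h5 | ⟨y, h5⟩ | ⟨y, h5⟩
    · exact h5
    · grind
    · grind
    · exact absurd rfl (h2 _ h5)
  · intro h1
    refine ⟨hu k h1, ?_⟩
    rintro ⟨i, j⟩ hA rfl
    have := huo j h1 i j hA
    have := hlt _ _ hA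
    grind

theorem IsMatching.downs_eq {b : Fin N → Bool} {S : Finset (Fin N × Fin N)}
    {U D : Finset (Fin N)} (h : IsMatching b S U D) : downs b = D := by
  ext k
  rw [downs, h.arcs_eq, mem_filter]
  simp only [mem_univ, true_and]
  obtain ⟨hlt, hf, hs, hu, hd, hc, hfi, hsi, hn, huo, hdo, hud⟩ := h
  constructor
  · rintro ⟨h1, h2⟩
    rcases hc k with h5 | h5 | ⟨y, h5⟩ | ⟨y, h5⟩
    · grind
    · exact h5
    · exact absurd rfl (h2 _ h5)
    · grind
  · intro h1
    refine ⟨hd k h1, ?_⟩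
    rintro ⟨i, j⟩ hA rfl
    have := hdo i h1 i j hA
    have := hlt _ _ hA
    grind

theorem IsMatching.close {b : Fin N → Bool} {S : Finset (Fin N × Fin N)}
    {U D : Finset (Fin N)} (h : IsMatching b S U D) {k l : Fin N} (hk : k ∈ U) (hl : l ∈ U)
    (hkl : k < l) (hb : ∀ m ∈ U, m ≤ k ∨ l ≤ m) :
    IsMatching (Function.update b k false) (insert (k, l) S) ((U.erase k).erase l) D := by
  obtain ⟨hlt, hf, hs, hu, hd, hc, hfi, hsi, hn, huo, hdo, hud⟩ := h
  constructor <;> grind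

theorem IsMatching.demote {b : Fin N → Bool} {S : Finset (Fin N × Fin N)}
    {U D : Finset (Fin N)} (h : IsMatching b S U D) {k : Fin N} (hk : k ∈ U)
    (hb : ∀ m ∈ U, m ≤ k) :
    IsMatching (Function.update b k false) S (U.erase k) (insert k D) := by
  obtain ⟨hlt, hf, hs, hu, hd, hc, hfi, hsi, hn, huo, hdo, hud⟩ := h
  constructor <;> grind

theorem IsMatching.promote {b : Fin N → Bool} {S : Finset (Fin N × Fin N)}
    {U D : Finset (Fin N)} (h : IsMatching b S U D) {k : Fin N} (hk : k ∈ D)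
    (hb : ∀ m ∈ D, k ≤ m) :
    IsMatching (Function.update b k true) S (insert k U) (D.erase k) := by
  obtain ⟨hlt, hf, hs, hu, hd, hc, hfi, hsi, hn, huo, hdo, hud⟩ := h
  constructor <;> grind

theorem IsMatching.split {b : Fin N → Bool} {S : Finset (Fin N × Fin N)}
    {U D : Finset (Fin N)} (h : IsMatching b S U D) {k l : Fin N} (hkl : (k, l) ∈ S)
    (ho : ∀ i j, (i, j) ∈ S → ¬(i < k ∧ l < j)) (hb : ∀ m ∈ D, l < m) :
    IsMatching (Function.update b k true) (S.erase (k, l)) (insert k (insert l U)) D := by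
  obtain ⟨hlt, hf, hs, hu, hd, hc, hfi, hsi, hn, huo, hdo, hud⟩ := h
  constructor <;> grind

theorem IsMatching.shift {b : Fin N → Bool} {S : Finset (Fin N × Fin N)}
    {U D : Finset (Fin N)} (h : IsMatching b S U D) :
    IsMatching (Fin.cons true b : Fin (N + 1) → Bool)
      (S.image fun A => (A.1.succ, A.2.succ)) (insert 0 (U.image Fin.succ)) (D.image Fin.succ) := by
  obtain ⟨hlt, hf, hs, hu, hd, hc, hfi, hsi, hn, huo, hdo, hud⟩ := h
  constructor
  · rintro i j hij
    simp only [mem_image, Prod.exists, Prod.mk.injEq] at hij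
    obtain ⟨i, j, h, rfl, rfl⟩ := hij
    simpa using hlt _ _ h
  · rintro i j hij
    simp only [mem_image, Prod.exists, Prod.mk.injEq] at hij
    obtain ⟨i, j, h, rfl, rfl⟩ := hij
    simpa using hf _ _ h
  · rintro i j hij
    simp only [mem_image, Prod.exists, Prod.mk.injEq] at hij
    obtain ⟨i, j, h, rfl, rfl⟩ := hij
    simpa using hs _ _ h
  · intro k hk
    simp only [mem_insert, mem_image] at hk
    obtain rfl | ⟨k, hk, rfl⟩ := hk
    · simp
    · simpa using hu k hk
  · intro k hk
    simp only [mem_image] at hk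
    obtain ⟨k, hk, rfl⟩ := hk
    simpa using hd k hk
  · intro k
    refine Fin.cases (by simp) (fun k => ?_) k
    rcases hc k with h | h | ⟨l, h⟩ | ⟨l, h⟩
    · left; simp [h]
    · right; left; simp [h]
    · right; right; left; exact ⟨l.succ, by simp [h]⟩
    · right; right; right; exact ⟨l.succ, by simp [h]⟩
  · intro i j j' h1 h2
    simp only [mem_image, Prod.exists, Prod.mk.injEq] at h1 h2
    obtain ⟨i, j, h, rfl, rfl⟩ := h1
    obtain ⟨i', j', h', h'', rfl⟩ := h2
    rw [Fin.succ_inj] at h'' ⊢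
    subst h''
    exact hfi _ _ _ h h'
  · intro i j j' h1 h2
    simp only [mem_image, Prod.exists, Prod.mk.injEq] at h1 h2
    obtain ⟨i, j, h, rfl, rfl⟩ := h1
    obtain ⟨i', j', h', rfl, h''⟩ := h2
    rw [Fin.succ_inj] at h'' ⊢
    subst h''
    exact hsi _ _ _ h h'
  · intro i j i' j' h1 h2
    simp only [mem_image, Prod.exists, Prod.mk.injEq] at h1 h2
    obtain ⟨i, j, h, rfl, rfl⟩ := h1
    obtain ⟨i', j', h', rfl, rfl⟩ := h2
    simpa using hn _ _ _ _ h h'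
  · intro k hk i j hij
    simp only [mem_image, Prod.exists, Prod.mk.injEq] at hij
    obtain ⟨i, j, h, rfl, rfl⟩ := hij
    simp only [mem_insert, mem_image] at hk
    obtain rfl | ⟨k, hk, rfl⟩ := hk
    · left; simp
    · simpa using huo k hk _ _ h
  · intro k hk i j hij
    simp only [mem_image, Prod.exists, Prod.mk.injEq] at hij
    obtain ⟨i, j, h, rfl, rfl⟩ := hij
    simp only [mem_image] at hk
    obtain ⟨k, hk, rfl⟩ := hk
    simpa using hdo k hk _ _ h
  · intro k hk l hl
    simp only [mem_insert, mem_image] at hk hl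
    obtain ⟨l, hl, rfl⟩ := hl
    obtain rfl | ⟨k, hk, rfl⟩ := hk
    · simp
    · simpa using hud k hk l hl

theorem cons_false_eq_update (b : Fin N → Bool) :
    (Fin.cons false b : Fin (N + 1) → Bool) =
      Function.update (Fin.cons true b : Fin (N + 1) → Bool) 0 false := by
  simp

theorem exists_isMatching : ∀ {N : ℕ} (b : Fin N → Bool), ∃ S U D, IsMatching b S U D := by
  intro N
  induction N with
  | zero =>
    intro b
    exact ⟨∅, ∅, ∅, by constructor <;> simp⟩
  | succ N ih =>
    intro b
    obtain ⟨S, U, D, h⟩ := ih (Fin.tail b)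
    have h' := h.shift
    rw [← Fin.cons_self_tail b]
    rcases b 0 with _ | _
    · rw [cons_false_eq_update]
      rcases U.eq_empty_or_nonempty with rfl | hU
      · exact ⟨_, _, _, h'.demote (k := 0) (by simp) (by simp)⟩
      · refine ⟨_, _, _, h'.close (k := 0) (l := (U.min' hU).succ) (by simp)
          (by simp [U.min'_mem hU]) (by simp) ?_⟩
        intro m hm
        simp only [mem_insert, mem_image] at hm
        obtain rfl | ⟨m, hm, rfl⟩ := hm
        · simp
        · right; simpa using U.min'_le m hm
    · exact ⟨_, _, _, h'⟩

/-- The arcs, remaining up arrows and remaining down arrows of a string form a matching. -/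
theorem isMatching (b : Fin N → Bool) : IsMatching b (arcs b) (ups b) (downs b) := by
  obtain ⟨S, U, D, h⟩ := exists_isMatching b
  rwa [h.arcs_eq, h.ups_eq, h.downs_eq]

end Matching

section Standard

variable {K : Type*} [Field K] {N : ℕ}

theorem PsiStd_apply (q Q : K) (ε : Fin N → Bool) :
    PsiStd N q Q ε = ∏ k : Fin N, downVec (q ^ (N - 1 - (k : ℕ)) * Q) (ε k) := by
  have h1 : PsiStd N q Q ε = psiStd q Q ε := by
    simp [PsiStd, Finset.sum_apply, Pi.single_apply]
  rw [h1, psiStd, ← prod_pow_eq_pow_sum, ← prod_const, ← prod_mul_distrib, prod_filter]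
  refine prod_congr rfl fun k _ => ?_
  cases ε k <;> simp [downVec]

theorem act₁_mulVec (A : Matrix Bool Bool K) (i : Fin N) (v : (Fin N → Bool) → K)
    (ε : Fin N → Bool) :
    (act₁ A i).mulVec v ε = ∑ x, A (ε i) x * v (Function.update ε i x) := by
  rw [Matrix.mulVec, dotProduct]
  symm
  refine sum_of_injOn (fun x => Function.update ε i x) ?_ (by simp) ?_ ?_
  · intro x _ y _ hxy
    simpa using congrFun hxy i
  · intro ε' _ h
    rw [act₁, if_neg, zero_mul]
    intro h'
    apply h
    refine ⟨ε' i, by simp, ?_⟩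
    ext k
    by_cases hk : k = i
    · subst hk; simp
    · simp [hk, h' k hk]
  · intro x _
    rw [act₁, if_pos]
    · simp
    · intro k hk; simp [hk]

theorem act₂_mulVec (A : Matrix (Bool × Bool) (Bool × Bool) K) {i j : Fin N} (hij : i ≠ j)
    (v : (Fin N → Bool) → K) (ε : Fin N → Bool) :
    (act₂ A i j).mulVec v ε = ∑ x : Bool × Bool, A (ε i, ε j) x *
      v (Function.update (Function.update ε i x.1) j x.2) := by
  rw [Matrix.mulVec, dotProduct]
  symm
  refine sum_of_injOn (fun x => Function.update (Function.update ε i x.1) j x.2) ?_ (by simp) ?_ ?_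
  · intro x _ y _ hxy
    have h1 := congrFun hxy i
    have h2 := congrFun hxy j
    simp [hij] at h1 h2
    exact Prod.ext h1 h2
  · intro ε' _ h
    rw [act₂, if_neg, zero_mul]
    intro h'
    apply h
    refine ⟨(ε' i, ε' j), by simp, ?_⟩
    ext k
    by_cases hk : k = j
    · subst hk; simp
    · by_cases hk' : k = i
      · subst hk'; simp [hk]
      · simp [hk, hk', h' k hk' hk]
  · intro x _
    rw [act₂, if_pos]
    · simp [hij]
    · intro k hk hk'; simp [hk, hk']

theorem prod_update {f : Fin N → Bool → K} (ε : Fin N → Bool) (i : Fin N) (x : Bool) :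
    ∏ k, f k (Function.update ε i x k) = f i x * ∏ k ∈ univ.erase i, f k (ε k) := by
  rw [← mul_prod_erase _ _ (mem_univ i)]
  congr 1
  · simp
  · refine prod_congr rfl fun k hk => ?_
    simp [(mem_erase.1 hk).1]

theorem prod_update₂ {f : Fin N → Bool → K} (ε : Fin N → Bool) {i j : Fin N} (hij : i ≠ j)
    (x y : Bool) :
    ∏ k, f k (Function.update (Function.update ε i x) j y k) =
      f i x * f j y * ∏ k ∈ (univ.erase j).erase i, f k (ε k) := by
  rw [prod_update, ← mul_prod_erase _ _ (mem_erase.2 ⟨hij, mem_univ i⟩)]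
  rw [Function.update_self, ← mul_assoc, mul_comm (f j y)]
  congr 1
  refine prod_congr rfl fun k hk => ?_
  simp [(mem_erase.1 hk).1]

theorem e_mulVec_PsiStd {q Q : K} (hq : q ≠ 0) (hQ : Q ≠ 0) (i : Fin N) :
    (e q Q i).mulVec (PsiStd N q Q) = 0 := by
  ext ε
  by_cases h : (i : ℕ) + 1 < N
  · rw [e, dif_pos h, act₂_mulVec _ (by simp [Fin.ext_iff])]
    simp only [PsiStd_apply]
    simp only [prod_update₂ (f := fun k x => downVec (q ^ (N - 1 - (k : ℕ)) * Q) x) ε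
      (i := i) (j := ⟨i + 1, h⟩) (by simp [Fin.ext_iff])]
    have hp : q ^ (N - 1 - (i : ℕ)) = q * q ^ (N - 1 - ((i : ℕ) + 1)) := by
      rw [← pow_succ']; congr 1; omega
    simp only [← mul_assoc, ← sum_mul]
    simp only [Fintype.sum_prod_type, Fintype.sum_bool, hp]
    cases ε i <;> cases ε ⟨i + 1, h⟩ <;> simp [bulk, downVec] <;> left <;> field_simp <;> ring
  · have hi : N - 1 - (i : ℕ) = 0 := by omega
    rw [e, dif_neg h, act₁_mulVec]
    simp only [PsiStd_apply]
    simp only [prod_update (f := fun k x => downVec (q ^ (N - 1 - (k : ℕ)) * Q) x) ε i]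
    simp only [← mul_assoc, ← sum_mul]
    simp only [Fintype.sum_bool, hi]
    cases ε i <;> simp [rightBoundary, downVec, hQ]

theorem e₀_mulVec_PsiStd {q Q : K} (hN : 0 < N) {Q₀ : K} (h : q ^ (N - 1) * Q * Q₀ = 1) :
    (e₀ hN Q₀).mulVec (PsiStd N q Q) = 0 := by
  ext ε
  have h0 : Q₀ ≠ 0 := by rintro rfl; simp at h
  rw [e₀, act₁_mulVec]
  simp only [PsiStd_apply]
  simp only [prod_update (f := fun k x => downVec (q ^ (N - 1 - (k : ℕ)) * Q) x) ε]
  simp only [← mul_assoc, ← sum_mul]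
  simp only [Fintype.sum_bool]
  have h' : q ^ (N - 1) * Q = Q₀⁻¹ := by field_simp; exact h
  cases ε ⟨0, hN⟩ <;> simp [leftBoundary, downVec, h', h0]

theorem PsiStd_cons (q Q : K) (x : Bool) (ε : Fin N → Bool) :
    PsiStd (N + 1) q Q (Fin.cons x ε : Fin (N + 1) → Bool) =
      downVec (q ^ N * Q) x * PsiStd N q Q ε := by
  rw [PsiStd_apply, PsiStd_apply, Fin.prod_univ_succ]
  simp only [Fin.cons_zero, Fin.cons_succ, Fin.val_zero, Fin.val_succ]
  congr 1
  refine prod_congr rfl fun k _ => ?_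
  congr 3
  omega

end Standard

section Reduction

variable {K : Type*} [Field K]

/-- The least element of a set, as a set with at most one element. -/
def firstOf {N : ℕ} (D : Finset (Fin N)) : Finset (Fin N) := D.filter fun k => ∀ l ∈ D, k ≤ l

/-- The greatest element of a set, as a set with at most one element. -/
def lastOf {N : ℕ} (D : Finset (Fin N)) : Finset (Fin N) := D.filter fun k => ∀ l ∈ D, l ≤ k

/-- The arcs of `S` that are inside no other arc and left of `D`. -/
def outerLeft {N : ℕ} (S : Finset (Fin N × Fin N)) (D : Finset (Fin N)) :
    Finset (Fin N × Fin N) :=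
  S.filter fun A => (∀ B ∈ S, ¬(B.1 < A.1 ∧ A.2 < B.2)) ∧ ∀ k ∈ D, A.2 < k

/-- The basis vector of a string, for the vectors `κ D` on the remaining down arrows. -/
def genKet {N : ℕ} (q : K) (κ : Finset (Fin N) → (Fin N → Bool) → K) (b : Fin N → Bool) :
    (Fin N → Bool) → K := fun ε =>
  (∏ k ∈ ups b, upVec (ε k)) * (∏ A ∈ arcs b, arcVec q (ε A.1) (ε A.2)) * κ (downs b) ε

/-- `κ` describes the vectors of remaining down arrows; `γ` and `θ` are the coefficients in the
expansion of `v₋₁ ⊗ κ D`. -/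
structure IsDownSystem (q : K) (κ : ∀ N : ℕ, Finset (Fin N) → (Fin N → Bool) → K)
    (γ θ : ℕ → K) : Prop where
  nil : ∀ ε, κ 0 ∅ ε = 1
  shift : ∀ N (D : Finset (Fin N)) x ε,
    κ (N + 1) (D.image Fin.succ) (Fin.cons x ε : Fin (N + 1) → Bool) = κ N D ε
  step : ∀ N (D : Finset (Fin N)) k ε, (∀ l ∈ D, k < l) →
    downVec 0 (ε k) * κ N D ε = κ N (insert k D) ε + γ D.card * upVec (ε k) * κ N D ε +
      θ D.card * upVec (ε k) * ∑ y ∈ firstOf D, upVec (ε y) * κ N (D.erase y) ε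

theorem mem_firstOf {N : ℕ} {D : Finset (Fin N)} {k : Fin N} :
    k ∈ firstOf D ↔ k ∈ D ∧ ∀ l ∈ D, k ≤ l := by simp [firstOf]

theorem mem_lastOf {N : ℕ} {D : Finset (Fin N)} {k : Fin N} :
    k ∈ lastOf D ↔ k ∈ D ∧ ∀ l ∈ D, l ≤ k := by simp [lastOf]

theorem travel {q : K} {κ : ∀ N : ℕ, Finset (Fin N) → (Fin N → Bool) → K} {γ θ : ℕ → K}
    (hκ : IsDownSystem q κ γ θ) {N : ℕ} (b : Fin N → Bool) (ε : Fin N → Bool) :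
    ∀ (n : ℕ) (k : Fin N), k ∈ ups b → ((ups b).filter fun m => k < m).card = n →
    downVec 0 (ε k) * (∏ l ∈ (ups b).erase k, upVec (ε l)) *
      (∏ A ∈ arcs b, arcVec q (ε A.1) (ε A.2)) * κ N (downs b) ε =
    ∑ l ∈ (ups b).filter (fun l => k ≤ l),
      q⁻¹ ^ ((ups b).filter fun m => k ≤ m ∧ m < l).card *
        genKet q (κ N) (Function.update b l false) ε +
    q⁻¹ ^ n * (γ (downs b).card * genKet q (κ N) b ε + θ (downs b).card *
      ∑ y ∈ firstOf (downs b), genKet q (κ N) (Function.update b y true) ε) := by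
  have hb := isMatching b
  intro n
  induction n with
  | zero =>
    intro k hk hn
    rw [card_eq_zero, filter_eq_empty_iff] at hn
    have hlast : ∀ m ∈ ups b, m ≤ k := fun m hm => not_lt.1 (hn hm)
    have h1 : (ups b).filter (fun l => k ≤ l) = {k} := by
      ext l; simp only [mem_filter, mem_singleton]
      constructor
      · rintro ⟨h, h'⟩; exact le_antisymm (hlast l h) h'
      · rintro rfl; exact ⟨hk, le_rfl⟩
    have h2 : ((ups b).filter fun m => k ≤ m ∧ m < k) = ∅ := by
      ext m; simp
    rw [h1, sum_singleton, h2, card_empty, pow_zero, one_mul, one_mul]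
    have hm := hb.demote hk hlast
    have hs := hκ.step N (downs b) k ε (fun l hl => hb.up_lt_down k hk l hl)
    have h3 : ∑ y ∈ firstOf (downs b), genKet q (κ N) (Function.update b y true) ε =
        (∏ l ∈ ups b, upVec (ε l)) * (∏ A ∈ arcs b, arcVec q (ε A.1) (ε A.2)) *
          ∑ y ∈ firstOf (downs b), upVec (ε y) * κ N ((downs b).erase y) ε := by
      rw [mul_sum]
      refine sum_congr rfl fun y hy => ?_
      rw [mem_firstOf] at hy
      have hy' := hb.promote hy.1 hy.2
      rw [genKet, hy'.ups_eq, hy'.arcs_eq, hy'.downs_eq, prod_insert]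
      · ring
      · intro h
        exact absurd (hb.up_lt_down y h y hy.1) (lt_irrefl _)
    rw [h3, genKet, hm.ups_eq, hm.arcs_eq, hm.downs_eq, genKet, ← mul_prod_erase _ _ hk]
    linear_combination (∏ l ∈ (ups b).erase k, upVec (ε l)) *
      (∏ A ∈ arcs b, arcVec q (ε A.1) (ε A.2)) * hs
  | succ n ih =>
    intro k hk hn
    have hne : ((ups b).filter fun m => k < m).Nonempty := by
      rw [← card_pos]; omega
    obtain ⟨l, hl, hlk, hmin⟩ : ∃ l ∈ ups b, k < l ∧ ∀ m ∈ ups b, m ≤ k ∨ l ≤ m := by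
      have := min'_mem _ hne
      refine ⟨_, (mem_filter.1 this).1, (mem_filter.1 this).2, fun m hm => ?_⟩
      by_contra! h
      exact absurd (min'_le ((ups b).filter fun m => k < m) m (by simp [hm, h.1]))
        (not_le.2 h.2)
    have e1 : ((ups b).filter fun m => k < m) =
        insert l ((ups b).filter fun m => l < m) := by
      ext m; simp only [mem_filter, mem_insert]
      grind
    have e2 : ((ups b).filter fun m => k ≤ m) =
        insert k ((ups b).filter fun m => l ≤ m) := by
      ext m; simp only [mem_filter, mem_insert]
      grind
    have hn' : ((ups b).filter fun m => l < m).card = n := by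
      rw [e1, card_insert_of_notMem (by simp)] at hn; omega
    have ihl := ih l hl hn'
    have e3 : ∀ m ∈ (ups b).filter (fun m => l ≤ m),
        ((ups b).filter fun i => k ≤ i ∧ i < m).card =
          ((ups b).filter fun i => l ≤ i ∧ i < m).card + 1 := by
      intro m hm
      rw [← card_insert_of_notMem (a := k) (by simp [hlk])]
      congr 1
      ext i; simp only [mem_filter, mem_insert] at hm ⊢
      grind
    have hm := hb.close hk hl hlk hmin
    rw [e2, sum_insert (by simp [hlk])]
    have h2 : ((ups b).filter fun m => k ≤ m ∧ m < k) = ∅ := by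
      ext m; simp
    have e4 : ∑ m ∈ (ups b).filter (fun m => l ≤ m),
        q⁻¹ ^ ((ups b).filter fun i => k ≤ i ∧ i < m).card *
          genKet q (κ N) (Function.update b m false) ε =
        q⁻¹ * ∑ m ∈ (ups b).filter (fun m => l ≤ m),
        q⁻¹ ^ ((ups b).filter fun i => l ≤ i ∧ i < m).card *
          genKet q (κ N) (Function.update b m false) ε := by
      rw [mul_sum]
      refine sum_congr rfl fun m hm => ?_
      rw [e3 m hm, pow_succ]; ring
    rw [e4, h2, card_empty, pow_zero, one_mul, pow_succ]
    have e5 : genKet q (κ N) (Function.update b k false) ε =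
        arcVec q (ε k) (ε l) * (∏ m ∈ ((ups b).erase k).erase l, upVec (ε m)) *
        (∏ A ∈ arcs b, arcVec q (ε A.1) (ε A.2)) * κ N (downs b) ε := by
      rw [genKet, hm.ups_eq, hm.arcs_eq, hm.downs_eq, prod_insert]
      · ring
      · intro h
        have := hb.up_out k hk k l h
        have := hb.lt _ _ h
        grind
    have hle : l ∈ (ups b).erase k := mem_erase.2 ⟨hlk.ne', hl⟩
    have hke : k ∈ (ups b).erase l := mem_erase.2 ⟨hlk.ne, hk⟩
    rw [e5, ← mul_prod_erase _ _ hle]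
    rw [← mul_prod_erase _ _ hke, erase_right_comm] at ihl
    have e6 : downVec (0 : K) (ε k) * upVec (ε l) =
        arcVec q (ε k) (ε l) + q⁻¹ * (downVec (0 : K) (ε l) * upVec (ε k)) := by
      cases ε k <;> cases ε l <;> simp [downVec, upVec, arcVec]
    linear_combination (∏ m ∈ ((ups b).erase k).erase l, upVec (ε m)) *
      (∏ A ∈ arcs b, arcVec q (ε A.1) (ε A.2)) * κ N (downs b) ε * e6 + q⁻¹ * ihl

theorem genKet_cons_true {q : K} {κ : ∀ N : ℕ, Finset (Fin N) → (Fin N → Bool) → K}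
    {γ θ : ℕ → K} (hκ : IsDownSystem q κ γ θ) {N : ℕ} (b : Fin N → Bool) (x : Bool)
    (ε : Fin N → Bool) :
    genKet q (κ (N + 1)) (Fin.cons true b : Fin (N + 1) → Bool)
      (Fin.cons x ε : Fin (N + 1) → Bool) = upVec x * genKet q (κ N) b ε := by
  have h := (isMatching b).shift
  rw [genKet, h.ups_eq, h.arcs_eq, h.downs_eq, hκ.shift, prod_insert (by simp), prod_image,
    prod_image, genKet]
  · simp only [Fin.cons_zero, Fin.cons_succ]; ring
  · rintro ⟨a, b⟩ _ ⟨c, d⟩ _ h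
    simpa using h
  · intro a _ c _ h
    simpa using h

theorem genKet_cons_false {q : K} {κ : ∀ N : ℕ, Finset (Fin N) → (Fin N → Bool) → K}
    {γ θ : ℕ → K} (hκ : IsDownSystem q κ γ θ) {N : ℕ} (b : Fin N → Bool) (x : Bool)
    (ε : Fin N → Bool) :
    downVec 0 x * genKet q (κ N) b ε =
      genKet q (κ (N + 1)) (Fin.cons false b : Fin (N + 1) → Bool)
        (Fin.cons x ε : Fin (N + 1) → Bool) + upVec x *
      (∑ l ∈ ups b, q⁻¹ ^ (((ups b).filter fun m => m < l).card + 1) *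
        genKet q (κ N) (Function.update b l false) ε +
      q⁻¹ ^ (ups b).card * (γ (downs b).card * genKet q (κ N) b ε + θ (downs b).card *
        ∑ y ∈ firstOf (downs b), genKet q (κ N) (Function.update b y true) ε)) := by
  have h := (isMatching b).shift
  have ht := travel hκ (Fin.cons true b : Fin (N + 1) → Bool) (Fin.cons x ε : Fin (N + 1) → Bool)
    (ups b).card 0 (by rw [h.ups_eq]; simp) ?_
  · rw [h.ups_eq, h.arcs_eq, h.downs_eq, hκ.shift] at ht
    have h0 : (0 : Fin (N + 1)) ∉ (ups b).image Fin.succ := by simp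
    have i1 : Set.InjOn (fun A : Fin N × Fin N => (A.1.succ, A.2.succ)) (arcs b) := by
      rintro ⟨a, b⟩ _ ⟨c, d⟩ _ h
      simpa using h
    have i2 : ∀ s : Set (Fin N), Set.InjOn Fin.succ s := fun s => (Fin.succ_injective N).injOn
    rw [erase_insert h0, prod_image (i2 _), prod_image i1] at ht
    simp only [Fin.zero_le, filter_true, true_and] at ht
    rw [sum_insert h0, sum_image (i2 _), card_image_of_injective _ (Fin.succ_injective N)] at ht
    have hf : firstOf ((downs b).image Fin.succ) = (firstOf (downs b)).image Fin.succ := by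
      ext k
      simp only [mem_firstOf, mem_image]
      constructor
      · rintro ⟨⟨k, hk, rfl⟩, h'⟩
        refine ⟨k, ⟨hk, fun l hl => ?_⟩, rfl⟩
        simpa using h' l.succ ⟨l, hl, rfl⟩
      · rintro ⟨k, ⟨hk, h'⟩, rfl⟩
        refine ⟨⟨k, hk, rfl⟩, ?_⟩
        rintro _ ⟨l, hl, rfl⟩
        simpa using h' l hl
    rw [hf, sum_image (i2 _)] at ht
    simp only [← cons_false_eq_update, ← Fin.cons_update, genKet_cons_true hκ, Fin.cons_zero,
      Fin.cons_succ] at ht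
    have hc : ∀ l, ((insert 0 ((ups b).image Fin.succ)).filter fun m => m < Fin.succ l).card =
        ((ups b).filter fun m => m < l).card + 1 := by
      intro l
      rw [filter_insert, if_pos (Fin.succ_pos l), card_insert_of_notMem (by simp), filter_image,
        card_image_of_injective _ (Fin.succ_injective N)]
      simp
    simp only [hc, Fin.not_lt_zero, filter_false, card_empty, pow_zero, one_mul] at ht
    have hg : genKet q (κ N) b ε = (∏ k ∈ ups b, upVec (ε k)) *
      (∏ A ∈ arcs b, arcVec q (ε A.1) (ε A.2)) * κ N (downs b) ε := rfl
    calc _ = _ := by rw [hg, ← mul_assoc, ← mul_assoc]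
      _ = _ := ht
      _ = _ := by
        simp only [mul_left_comm _ (upVec x), ← mul_sum]
        ring
  · rw [h.ups_eq, filter_insert, if_neg (lt_irrefl _), filter_true_of_mem,
      card_image_of_injective _ (Fin.succ_injective N)]
    intro k hk
    rw [mem_image] at hk
    obtain ⟨k, -, rfl⟩ := hk
    exact Fin.succ_pos k

theorem sum_sum_flip_up {N : ℕ} (g : (Fin N → Bool) → Fin N → K) (v : (Fin N → Bool) → K) :
    ∑ b, ∑ l ∈ ups b, g b l * v (Function.update b l false) =
      ∑ f, (∑ A ∈ outerLeft (arcs f) (downs f), g (Function.update f A.1 true) A.1 +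
        ∑ k ∈ firstOf (downs f), g (Function.update f k true) k) * v f := by
  have key : ∀ f : Fin N → Bool, ∑ A ∈ outerLeft (arcs f) (downs f),
      g (Function.update f A.1 true) A.1 +
        ∑ k ∈ firstOf (downs f), g (Function.update f k true) k =
      ∑ k ∈ univ.filter (fun k => f k = false ∧ k ∈ ups (Function.update f k true)),
        g (Function.update f k true) k := by
    intro f
    have hf := isMatching f
    have hinj : Set.InjOn Prod.fst (outerLeft (arcs f) (downs f) : Set (Fin N × Fin N)) := by
      rintro ⟨a, b⟩ hA ⟨c, d⟩ hB h
      simp only [outerLeft, coe_filter, Set.mem_ofPred_eq] at hA hB h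
      subst h
      rw [hf.fst_inj _ _ _ hA.1 hB.1]
    rw [← sum_image (f := fun k => g (Function.update f k true) k) hinj, ← sum_union]
    · refine sum_congr ?_ fun _ _ => rfl
      ext k
      simp only [mem_union, mem_image, mem_filter, mem_univ, true_and]
      constructor
      · rintro (⟨⟨k, l⟩, hA, rfl⟩ | hk)
        · simp only [outerLeft, mem_filter] at hA
          have := hf.split hA.1 (fun i j h => hA.2.1 _ h) hA.2.2
          refine ⟨hf.fst_false _ _ hA.1, ?_⟩
          rw [this.ups_eq]; simp
        · rw [mem_firstOf] at hk
          have := hf.promote hk.1 hk.2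
          refine ⟨hf.down _ hk.1, ?_⟩
          rw [this.ups_eq]; simp
      · rintro ⟨h1, h2⟩
        have hb := isMatching (Function.update f k true)
        have hback : Function.update (Function.update f k true) k false = f := by
          rw [Function.update_idem, ← h1, Function.update_eq_self]
        by_cases hlast : ∀ m ∈ ups (Function.update f k true), m ≤ k
        · right
          have := hb.demote h2 hlast
          rw [hback] at this
          rw [this.downs_eq, mem_firstOf]
          refine ⟨by simp, fun l hl => ?_⟩
          rcases mem_insert.1 hl with rfl | hl
          · exact le_rfl
          · exact (hb.up_lt_down k h2 l hl).le
        · left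
          push Not at hlast
          obtain ⟨m, hm, hkm⟩ := hlast
          have hne : ((ups (Function.update f k true)).filter fun m => k < m).Nonempty :=
            ⟨m, by simp [hm, hkm]⟩
          obtain ⟨l, hmem, hmin⟩ : ∃ l ∈ (ups (Function.update f k true)).filter fun m => k < m,
              ∀ i ∈ (ups (Function.update f k true)).filter fun m => k < m, l ≤ i :=
            ⟨_, min'_mem _ hne, fun i hi => min'_le _ i hi⟩
          rw [mem_filter] at hmem
          have := hb.close h2 hmem.1 hmem.2 (fun i hi => by
            by_contra! h
            have := hmin i (by simp [hi, h.1])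
            exact absurd h.2 (not_lt.2 this))
          rw [hback] at this
          refine ⟨(k, l), ?_, rfl⟩
          rw [this.downs_eq, this.arcs_eq, outerLeft, mem_filter]
          refine ⟨by simp, ?_, fun i hi => hb.up_lt_down l hmem.1 i hi⟩
          rintro ⟨i, j⟩ hB ⟨h3, h4⟩
          simp only at h3 h4
          rcases mem_insert.1 hB with hB | hB
          · simp only [Prod.mk.injEq] at hB
            exact absurd h3 (by simp [hB.1])
          · have := hb.up_out k h2 i j hB
            have := hmem.2
            grind
    · rw [disjoint_left]
      intro k hk hk'
      simp only [mem_image, outerLeft, mem_filter] at hk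
      obtain ⟨⟨k, l⟩, hA, rfl⟩ := hk
      rw [mem_firstOf] at hk'
      have := hA.2.2 k hk'.1
      have := hf.lt _ _ hA.1
      grind
  simp only [key, sum_mul]
  rw [sum_sigma', sum_sigma']
  refine sum_bij' (fun x _ => ⟨Function.update x.1 x.2 false, x.2⟩)
    (fun x _ => ⟨Function.update x.1 x.2 true, x.2⟩) ?_ ?_ ?_ ?_ ?_
  · rintro ⟨b, l⟩ h
    simp only [mem_sigma, mem_univ, true_and, mem_filter] at h ⊢
    have h1 := (isMatching b).up l h
    refine ⟨by simp, ?_⟩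
    rwa [Function.update_idem, ← h1, Function.update_eq_self]
  · rintro ⟨f, l⟩ h
    simp only [mem_sigma, mem_univ, true_and, mem_filter] at h ⊢
    exact h.2
  · rintro ⟨b, l⟩ h
    simp only [mem_sigma, mem_univ, true_and] at h ⊢
    have h1 := (isMatching b).up l h
    rw [Function.update_idem, ← h1, Function.update_eq_self]
  · rintro ⟨b, l⟩ h
    simp only [mem_sigma, mem_univ, true_and, mem_filter] at h ⊢
    rw [Function.update_idem, ← h.1, Function.update_eq_self]
  · rintro ⟨b, l⟩ h
    simp only [mem_sigma, mem_univ, true_and] at h ⊢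
    have h1 := (isMatching b).up l h
    rw [Function.update_idem, ← h1, Function.update_eq_self]

theorem sum_sum_flip_down {N : ℕ} (g : (Fin N → Bool) → Fin N → K) (v : (Fin N → Bool) → K) :
    ∑ b, ∑ l ∈ firstOf (downs b), g b l * v (Function.update b l true) =
      ∑ f, (∑ k ∈ lastOf (ups f), g (Function.update f k false) k) * v f := by
  simp only [sum_mul]
  rw [sum_sigma', sum_sigma']
  refine sum_bij' (fun x _ => ⟨Function.update x.1 x.2 true, x.2⟩)
    (fun x _ => ⟨Function.update x.1 x.2 false, x.2⟩) ?_ ?_ ?_ ?_ ?_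
  · rintro ⟨b, l⟩ h
    simp only [mem_sigma, mem_univ, true_and, mem_firstOf, mem_lastOf] at h ⊢
    have hb := isMatching b
    rw [(hb.promote h.1 h.2).ups_eq]
    refine ⟨by simp, fun m hm => ?_⟩
    rcases mem_insert.1 hm with rfl | hm
    · exact le_rfl
    · exact (hb.up_lt_down m hm l h.1).le
  · rintro ⟨b, l⟩ h
    simp only [mem_sigma, mem_univ, true_and, mem_firstOf, mem_lastOf] at h ⊢
    have hb := isMatching b
    rw [(hb.demote h.1 h.2).downs_eq]
    refine ⟨by simp, fun m hm => ?_⟩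
    rcases mem_insert.1 hm with rfl | hm
    · exact le_rfl
    · exact (hb.up_lt_down l h.1 m hm).le
  · rintro ⟨b, l⟩ h
    simp only [mem_sigma, mem_univ, true_and, mem_firstOf] at h ⊢
    have h1 := (isMatching b).down l h.1
    rw [Function.update_idem, ← h1, Function.update_eq_self]
  · rintro ⟨b, l⟩ h
    simp only [mem_sigma, mem_univ, true_and, mem_lastOf] at h ⊢
    have h1 := (isMatching b).up l h.1
    rw [Function.update_idem, ← h1, Function.update_eq_self]
  · rintro ⟨b, l⟩ h
    simp only [mem_sigma, mem_univ, true_and, mem_firstOf] at h ⊢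
    have h1 := (isMatching b).down l h.1
    rw [Function.update_idem, ← h1, Function.update_eq_self]

/-- A vector with the components `F b` in the basis of diagrams is `Ψ` if its components satisfy
two recursions. -/
theorem sum_genKet_eq_PsiStd {q Q : K} {κ : ∀ N : ℕ, Finset (Fin N) → (Fin N → Bool) → K}
    {γ θ : ℕ → K} (hκ : IsDownSystem q κ γ θ) (F : ∀ N : ℕ, (Fin N → Bool) → K)
    (hnil : ∀ b, F 0 b = 1)
    (hfalse : ∀ N (b : Fin N → Bool), F (N + 1) (Fin.cons false b : Fin (N + 1) → Bool) = F N b)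
    (htrue : ∀ N (f : Fin N → Bool), F (N + 1) (Fin.cons true f : Fin (N + 1) → Bool) =
      q ^ N * Q * F N f +
      ∑ A ∈ outerLeft (arcs f) (downs f), q⁻¹ ^ (((ups f).filter fun m => m < A.1).card + 1) *
        F N (Function.update f A.1 true) +
      ∑ k ∈ firstOf (downs f), q⁻¹ ^ ((ups f).card + 1) * F N (Function.update f k true) +
      q⁻¹ ^ (ups f).card * γ (downs f).card * F N f +
      ∑ k ∈ lastOf (ups f), q⁻¹ ^ ((ups f).card - 1) * θ ((downs f).card + 1) *
        F N (Function.update f k false)) (N : ℕ) :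
    ∑ b, F N b • genKet q (κ N) b = PsiStd N q Q := by
  induction N with
  | zero =>
    ext ε
    rw [Finset.sum_apply, PsiStd_apply]
    have h : ∀ b : Fin 0 → Bool, genKet q (κ 0) b ε = 1 := by
      intro b
      have h1 : downs b = ∅ := by ext k; exact k.elim0
      have h2 : ups b = ∅ := by ext k; exact k.elim0
      have h3 : arcs b = ∅ := by ext k; exact k.1.elim0
      rw [genKet, h1, h2, h3, hκ.nil]; simp
    simp [h, hnil]
  | succ N ih =>
    ext ε
    obtain ⟨x, ε, rfl⟩ : ∃ x ε', ε = (Fin.cons x ε' : Fin (N + 1) → Bool) :=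
      ⟨ε 0, Fin.tail ε, (Fin.cons_self_tail ε).symm⟩
    rw [PsiStd_cons, ← ih, Finset.sum_apply, Finset.sum_apply]
    simp only [Pi.smul_apply, smul_eq_mul]
    rw [← (Fin.consEquiv (fun _ : Fin (N + 1) => Bool)).sum_comp, Fintype.sum_prod_type,
      Fintype.sum_bool]
    simp only [Fin.consEquiv, Equiv.coe_fn_mk, hfalse, genKet_cons_true hκ]
    have h1 : ∑ b, F N b * genKet q (κ (N + 1)) (Fin.cons false b : Fin (N + 1) → Bool)
        (Fin.cons x ε : Fin (N + 1) → Bool) =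
        downVec 0 x * ∑ b, F N b * genKet q (κ N) b ε - upVec x *
          (∑ b, ∑ l ∈ ups b, F N b * q⁻¹ ^ (((ups b).filter fun m => m < l).card + 1) *
            genKet q (κ N) (Function.update b l false) ε +
          ∑ b, F N b * q⁻¹ ^ (ups b).card * γ (downs b).card * genKet q (κ N) b ε +
          ∑ b, ∑ y ∈ firstOf (downs b), F N b * q⁻¹ ^ (ups b).card * θ (downs b).card *
            genKet q (κ N) (Function.update b y true) ε) := by
      rw [mul_sum, ← sum_add_distrib, ← sum_add_distrib, mul_sum, ← sum_sub_distrib]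
      refine sum_congr rfl fun b _ => ?_
      have := genKet_cons_false hκ b x ε
      simp only [mul_assoc, ← mul_sum] at this ⊢
      linear_combination (-F N b) * this
    rw [h1, sum_sum_flip_up (g := fun b l => F N b * q⁻¹ ^ (((ups b).filter fun m => m < l).card + 1))
      (v := fun b => genKet q (κ N) b ε),
      sum_sum_flip_down (g := fun b l => F N b * q⁻¹ ^ (ups b).card * θ (downs b).card)
      (v := fun b => genKet q (κ N) b ε)]
    have h2 : downVec (q ^ N * Q) x = downVec 0 x + upVec x * (q ^ N * Q) := by
      cases x <;> simp [downVec, upVec]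
    rw [h2, add_mul, add_comm, sub_add_eq_add_sub, add_sub_assoc]
    congr 1
    rw [mul_assoc, mul_sum, ← sum_add_distrib, ← sum_add_distrib, mul_sum, mul_sum,
      ← sum_sub_distrib]
    refine sum_congr rfl fun f _ => ?_
    have hf := isMatching f
    have e1 : ∀ A ∈ outerLeft (arcs f) (downs f), F N (Function.update f A.1 true) *
        q⁻¹ ^ (((ups (Function.update f A.1 true)).filter fun m => m < A.1).card + 1) =
        q⁻¹ ^ (((ups f).filter fun m => m < A.1).card + 1) *
          F N (Function.update f A.1 true) := by
      rintro ⟨k, l⟩ hA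
      simp only [outerLeft, mem_filter] at hA
      have := hf.split hA.1 (fun i j h => hA.2.1 _ h) hA.2.2
      rw [this.ups_eq, filter_insert, if_neg (lt_irrefl _), filter_insert,
        if_neg (not_lt.2 (hf.lt _ _ hA.1).le), mul_comm]
    have e2 : ∀ k ∈ firstOf (downs f), F N (Function.update f k true) *
        q⁻¹ ^ (((ups (Function.update f k true)).filter fun m => m < k).card + 1) =
        q⁻¹ ^ ((ups f).card + 1) * F N (Function.update f k true) := by
      intro k hk
      rw [mem_firstOf] at hk
      rw [(hf.promote hk.1 hk.2).ups_eq, filter_insert, if_neg (lt_irrefl _),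
        filter_true_of_mem (fun m hm => hf.up_lt_down m hm k hk.1), mul_comm]
    have e3 : ∀ k ∈ lastOf (ups f), F N (Function.update f k false) *
        q⁻¹ ^ (ups (Function.update f k false)).card *
          θ (downs (Function.update f k false)).card =
        q⁻¹ ^ ((ups f).card - 1) * θ ((downs f).card + 1) * F N (Function.update f k false) := by
      intro k hk
      rw [mem_lastOf] at hk
      have := hf.demote hk.1 hk.2
      rw [this.ups_eq, this.downs_eq, card_erase_of_mem hk.1, card_insert_of_notMem]
      · ring
      · intro h
        exact absurd (hf.up_lt_down k hk.1 k h) (lt_irrefl _)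
    rw [sum_congr rfl e1, sum_congr rfl e2, sum_congr rfl e3, htrue]
    ring

end Reduction

section QuantumIntegers

variable {K : Type*} [Field K] {q : K}

theorem qint_zero : qint q 0 = 0 := by simp [qint]

theorem qint_succ (hq : q ≠ 0) (n : ℕ) : qint q (n + 1) = q * qint q n + q⁻¹ ^ n := by
  rw [qint, sum_range_succ, qint, mul_sum]
  congr 1
  · refine sum_congr rfl fun i _ => ?_
    rw [← zpow_one_add₀ hq]; congr 1; push_cast; ring
  · rw [inv_pow, ← zpow_natCast, ← zpow_neg]; congr 1; push_cast; ring

theorem qint_one (hq : q ≠ 0) : qint q 1 = 1 := by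
  rw [qint_succ hq, qint_zero]; simp

theorem qint_add (hq : q ≠ 0) (x y : ℕ) :
    qint q (x + y) = q ^ y * qint q x + q⁻¹ ^ x * qint q y := by
  induction y with
  | zero => simp [qint_zero]
  | succ y ih =>
    rw [← add_assoc, qint_succ hq, ih, qint_succ hq]; ring

theorem qint_add' (hq : q ≠ 0) (x y : ℕ) :
    qint q (x + y) = q⁻¹ ^ y * qint q x + q ^ x * qint q y := by
  rw [add_comm, qint_add hq]; ring

theorem qint_two_mul (hq : q ≠ 0) (n : ℕ) : qint q (2 * n) = qint q n * sym (q ^ n) := by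
  rw [two_mul, qint_add hq, sym, inv_pow]; ring

theorem sub_inv_mul_qint (hq : q ≠ 0) (n : ℕ) : (q - q⁻¹) * qint q n = q ^ n - q⁻¹ ^ n := by
  induction n with
  | zero => simp [qint_zero]
  | succ n ih =>
    rw [qint_succ hq, mul_add, mul_left_comm, ih, pow_succ, pow_succ]
    field_simp; ring

end QuantumIntegers

section Counting

variable {N : ℕ}

/-- The number of elements of `U` in the first `t` positions. -/
def countLT (U : Finset (Fin N)) (t : ℕ) : ℕ := (U.filter fun k : Fin N => (k : ℕ) < t).card

/-- The number of arcs of `S` whose left end is one of the first `t` positions. -/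
def arcsLT (S : Finset (Fin N × Fin N)) (t : ℕ) : ℕ := (S.filter fun A : Fin N × Fin N => (A.1 : ℕ) < t).card

/-- No arc of `S` connects one of the first `t` positions with one of the others. -/
def IsCut (S : Finset (Fin N × Fin N)) (t : ℕ) : Prop :=
  ∀ i j, (i, j) ∈ S → (i : ℕ) < t → (j : ℕ) < t

theorem countLT_zero (U : Finset (Fin N)) : countLT U 0 = 0 := by simp [countLT]

theorem arcsLT_zero (S : Finset (Fin N × Fin N)) : arcsLT S 0 = 0 := by simp [arcsLT]

theorem countLT_of_le (U : Finset (Fin N)) {t : ℕ} (h : ∀ k ∈ U, (k : ℕ) < t) :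
    countLT U t = U.card := by
  rw [countLT, filter_true_of_mem h]

theorem countLT_of_ge (U : Finset (Fin N)) {t : ℕ} (h : ∀ k ∈ U, t ≤ (k : ℕ)) :
    countLT U t = 0 := by
  rw [countLT, filter_false_of_mem, card_empty]
  intro k hk; have := h k hk; omega

theorem arcsLT_mono (S : Finset (Fin N × Fin N)) {s t : ℕ} (h : s ≤ t) : arcsLT S s ≤ arcsLT S t :=
  card_le_card fun k hk => by simp only [mem_filter] at hk ⊢; exact ⟨hk.1, by omega⟩

theorem countLT_succ_of_mem {U : Finset (Fin N)} {k : Fin N} (h : k ∈ U) :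
    countLT U (k + 1) = countLT U k + 1 := by
  rw [countLT, countLT, ← card_insert_of_notMem (a := k) (by simp)]
  congr 1
  ext l; simp only [mem_filter, mem_insert, Fin.ext_iff]
  constructor
  · rintro ⟨h1, h2⟩
    rcases Nat.lt_succ_iff_lt_or_eq.1 h2 with h3 | h3
    · exact Or.inr ⟨h1, h3⟩
    · exact Or.inl h3
  · rintro (h1 | h1)
    · rw [← Fin.ext_iff] at h1; subst h1; exact ⟨h, by omega⟩
    · exact ⟨h1.1, by omega⟩

theorem countLT_eq_of_notMem {U : Finset (Fin N)} {s t : ℕ} (hst : s ≤ t)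
    (h : ∀ k ∈ U, (k : ℕ) < s ∨ t ≤ k) : countLT U t = countLT U s := by
  rw [countLT, countLT]
  congr 1
  refine filter_congr fun k hk => ?_
  have := h k hk; omega

theorem arcsLT_eq_of_notMem {S : Finset (Fin N × Fin N)} {s t : ℕ} (hst : s ≤ t)
    (h : ∀ i j, (i, j) ∈ S → (i : ℕ) < s ∨ t ≤ i) : arcsLT S t = arcsLT S s := by
  rw [arcsLT, arcsLT]
  congr 1
  refine filter_congr fun A hk => ?_
  have := h A.1 A.2 hk; omega

variable {b : Fin N → Bool} {S : Finset (Fin N × Fin N)} {U D : Finset (Fin N)}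

theorem IsMatching.eq_count (h : IsMatching b S U D) {t : ℕ} (ht : t ≤ N) (hc : IsCut S t) :
    t = countLT U t + countLT D t + 2 * arcsLT S t := by
  have h1 : (univ.filter fun k : Fin N => (k : ℕ) < t).card = t := by
    rw [Fin.card_filter_val_lt]; omega
  have i1 : Set.InjOn Prod.fst (S.filter fun A : Fin N × Fin N => (A.1 : ℕ) < t : Set (Fin N × Fin N)) := by
    rintro ⟨a, c⟩ hA ⟨a', d⟩ hB h'
    simp only at h'
    subst h'
    simp only [coe_filter, Set.mem_ofPred_eq] at hA hB
    rw [h.fst_inj _ _ _ hA.1 hB.1]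
  have i2 : Set.InjOn Prod.snd (S.filter fun A : Fin N × Fin N => (A.1 : ℕ) < t : Set (Fin N × Fin N)) := by
    rintro ⟨a, c⟩ hA ⟨a', d⟩ hB h'
    simp only at h'
    subst h'
    simp only [coe_filter, Set.mem_ofPred_eq] at hA hB
    rw [h.snd_inj _ _ _ hA.1 hB.1]
  have h2 : (univ.filter fun k : Fin N => (k : ℕ) < t) =
      ((U.filter fun k : Fin N => (k : ℕ) < t) ∪ (D.filter fun k : Fin N => (k : ℕ) < t)) ∪
        ((S.filter fun A : Fin N × Fin N => (A.1 : ℕ) < t).image Prod.fst ∪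
          (S.filter fun A : Fin N × Fin N => (A.1 : ℕ) < t).image Prod.snd) := by
    ext k
    simp only [mem_filter, mem_univ, true_and, mem_union, mem_image, Prod.exists,
      exists_and_right, exists_eq_right]
    constructor
    · intro hk
      rcases h.cover k with h3 | h3 | ⟨l, h3⟩ | ⟨l, h3⟩
      · exact Or.inl (Or.inl ⟨h3, hk⟩)
      · exact Or.inl (Or.inr ⟨h3, hk⟩)
      · exact Or.inr (Or.inl ⟨⟨l, h3⟩, hk⟩)
      · refine Or.inr (Or.inr ⟨l, h3, ?_⟩)
        have := h.lt _ _ h3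
        rw [Fin.lt_def] at this; omega
    · rintro ((h3 | h3) | (h3 | ⟨l, h3, h4⟩))
      · exact h3.2
      · exact h3.2
      · exact h3.2
      · exact hc _ _ h3 h4
  have d1 : Disjoint (U.filter fun k : Fin N => (k : ℕ) < t) (D.filter fun k : Fin N => (k : ℕ) < t) := by
    rw [disjoint_left]
    intro k hk hk'
    simp only [mem_filter] at hk hk'
    exact absurd (h.up_lt_down k hk.1 k hk'.1) (lt_irrefl _)
  have d2 : Disjoint ((S.filter fun A : Fin N × Fin N => (A.1 : ℕ) < t).image Prod.fst)
      ((S.filter fun A : Fin N × Fin N => (A.1 : ℕ) < t).image Prod.snd) := by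
    rw [disjoint_left]
    intro k hk hk'
    simp only [mem_image, mem_filter, Prod.exists, exists_and_right, exists_eq_right] at hk hk'
    obtain ⟨⟨l, hl⟩, -⟩ := hk
    obtain ⟨l', hl', -⟩ := hk'
    have := h.fst_false _ _ hl
    rw [h.snd_true _ _ hl'] at this
    exact absurd this (by simp)
  have d3 : Disjoint ((U.filter fun k : Fin N => (k : ℕ) < t) ∪ (D.filter fun k : Fin N => (k : ℕ) < t))
      ((S.filter fun A : Fin N × Fin N => (A.1 : ℕ) < t).image Prod.fst ∪
          (S.filter fun A : Fin N × Fin N => (A.1 : ℕ) < t).image Prod.snd) := by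
    rw [disjoint_left]
    intro k hk hk'
    simp only [mem_union, mem_image, mem_filter, Prod.exists, exists_and_right,
      exists_eq_right] at hk hk'
    have h4 : ∀ i j, (i, j) ∈ S → k < i ∨ j < k := by
      rcases hk with hk | hk
      · exact h.up_out k hk.1
      · exact h.down_out k hk.1
    rcases hk' with ⟨⟨l, hl⟩, -⟩ | ⟨l, hl, -⟩
    · have := h4 _ _ hl; have := h.lt _ _ hl; grind
    · have := h4 _ _ hl; have := h.lt _ _ hl; grind
  have h3 := congrArg card h2
  rw [h1, card_union_of_disjoint d3, card_union_of_disjoint d1, card_union_of_disjoint d2,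
    card_image_of_injOn i1, card_image_of_injOn i2] at h3
  rw [countLT, countLT, arcsLT]
  omega

theorem IsMatching.isCut_zero : IsCut S 0 := fun _ _ _ h => absurd h (Nat.not_lt_zero _)

theorem IsMatching.isCut_top : IsCut S N := fun _ j _ _ => j.2

theorem IsMatching.isCut_up (h : IsMatching b S U D) {k : Fin N} (hk : k ∈ U) : IsCut S k := by
  intro i j hij hi
  have := h.up_out k hk i j hij
  rw [Fin.lt_def, Fin.lt_def] at this; omega

theorem IsMatching.isCut_up_succ (h : IsMatching b S U D) {k : Fin N} (hk : k ∈ U) :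
    IsCut S (k + 1) := by
  intro i j hij hi
  have := h.up_out k hk i j hij
  have := h.lt _ _ hij
  simp only [Fin.lt_def] at *; omega

theorem IsMatching.isCut_down (h : IsMatching b S U D) {k : Fin N} (hk : k ∈ D) : IsCut S k := by
  intro i j hij hi
  have := h.down_out k hk i j hij
  rw [Fin.lt_def, Fin.lt_def] at this; omega

theorem IsMatching.isCut_down_succ (h : IsMatching b S U D) {k : Fin N} (hk : k ∈ D) :
    IsCut S (k + 1) := by
  intro i j hij hi
  have := h.down_out k hk i j hij
  have := h.lt _ _ hij
  simp only [Fin.lt_def] at *; omega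

theorem IsMatching.isCut_fst (h : IsMatching b S U D) {i j : Fin N} (hij : (i, j) ∈ S)
    (ho : ∀ B ∈ S, ¬(B.1 < i ∧ j < B.2)) : IsCut S i := by
  intro i' j' h' hi
  have h1 := ho _ h'
  have h2 := h.noncross _ _ _ _ h' hij hi
  have h3 := h.lt _ _ hij
  have h4 : j' ≠ i := by
    rintro rfl
    have := h.fst_false _ _ hij
    rw [h.snd_true _ _ h'] at this
    exact absurd this (by simp)
  have h5 : j' = j → i' = i := by rintro rfl; exact h.snd_inj _ _ _ h' hij
  simp only [Fin.lt_def, Fin.ext_iff] at *; omega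

theorem IsMatching.isCut_snd (h : IsMatching b S U D) {i j : Fin N} (hij : (i, j) ∈ S)
    (ho : ∀ B ∈ S, ¬(B.1 < i ∧ j < B.2)) : IsCut S (j + 1) := by
  intro i' j' h' hi
  have h1 := ho _ h'
  have h2 := h.noncross _ _ _ _ hij h'
  have h3 := h.lt _ _ h'
  have h4 : i' ≠ j := by
    rintro rfl
    have := h.fst_false _ _ h'
    rw [h.snd_true _ _ hij] at this
    exact absurd this (by simp)
  have h5 : i' = i → j' = j := by rintro rfl; exact h.fst_inj _ _ _ h' hij
  simp only [Fin.lt_def, Fin.ext_iff] at *; omega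

theorem IsMatching.arcsLT_snd (h : IsMatching b S U D) {i j : Fin N} (hij : (i, j) ∈ S)
    (ho : ∀ B ∈ S, ¬(B.1 < i ∧ j < B.2)) : arcsLT S (j + 1) = arcsLT S i + size (i, j) := by
  have h1 := h.eq_count (t := i) (by omega) (h.isCut_fst hij ho)
  have h2 := h.eq_count (t := j + 1) (by omega) (h.isCut_snd hij ho)
  have h3 := h.lt _ _ hij
  rw [Fin.lt_def] at h3
  have h4 : countLT U (j + 1) = countLT U i := by
    refine countLT_eq_of_notMem (by omega) fun k hk => ?_
    have := h.up_out k hk i j hij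
    simp only [Fin.lt_def] at this; omega
  have h5 : countLT D (j + 1) = countLT D i := by
    refine countLT_eq_of_notMem (by omega) fun k hk => ?_
    have := h.down_out k hk i j hij
    simp only [Fin.lt_def] at this; omega
  simp only [size, pos]
  omega

theorem size_pos {i j : Fin N} (h : i < j) : 1 ≤ size (i, j) := by
  rw [Fin.lt_def] at h
  simp only [size, pos]; omega

/-- A telescoping product over the outer arcs between two cuts. -/
@[to_additive]
theorem IsMatching.prod_outer_telescope {M : Type*} [CommMonoid M] (h : IsMatching b S U D)
    (G : ℕ → M) (f : Fin N × Fin N → M) {e : ℕ} (he : e ≤ N) (hce : IsCut S e) :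
    ∀ (n t : ℕ), e - t = n → t ≤ e → IsCut S t → (∀ k ∈ D, (k : ℕ) < t ∨ e ≤ k) →
    (∀ k ∈ U, t ≤ k → (k : ℕ) < e → G k = G (k + 1)) →
    (∀ i j, (i, j) ∈ S → (∀ B ∈ S, ¬(B.1 < i ∧ j < B.2)) → t ≤ i → (j : ℕ) < e →
      G i = f (i, j) * G (j + 1)) →
    (∏ A ∈ S.filter (fun A => (∀ B ∈ S, ¬(B.1 < A.1 ∧ A.2 < B.2)) ∧ t ≤ A.1 ∧ (A.2 : ℕ) < e),
      f A) * G e = G t := by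
  intro n
  induction n using Nat.strong_induction_on with
  | _ n ih =>
    intro t hn hte hct hD hU hS
    rcases hte.eq_or_lt with rfl | hlt
    · rw [filter_false_of_mem, prod_empty, one_mul]
      rintro ⟨i, j⟩ hA ⟨-, h1, h2⟩
      have := h.lt _ _ hA
      rw [Fin.lt_def] at this
      simp only at h1 h2; omega
    obtain ⟨k, rfl⟩ : ∃ k : Fin N, (k : ℕ) = t := ⟨⟨t, by omega⟩, rfl⟩
    rcases h.cover k with h1 | h1 | ⟨l, h1⟩ | ⟨l, h1⟩
    · rw [hU k h1 le_rfl hlt, ← ih (e - (k + 1)) (by omega) (k + 1) rfl hlt (h.isCut_up_succ h1)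
        (fun l hl => by have := hD l hl; omega) (fun l hl h2 h3 => hU l hl (by omega) h3)
        (fun i j h2 h3 h4 h5 => hS i j h2 h3 (by omega) h5)]
      congr 2
      refine filter_congr ?_
      rintro ⟨i, j⟩ hA
      have := h.up_out k h1 i j hA
      have := h.lt _ _ hA
      simp only [Fin.lt_def] at *
      have : k ≤ (i : ℕ) ↔ (k : ℕ) + 1 ≤ i := by omega
      rw [this]
    · have := hD k h1; omega
    · have hkl := h.lt _ _ h1
      have ho : ∀ B ∈ S, ¬(B.1 < k ∧ l < B.2) := by
        rintro ⟨i, j⟩ hB ⟨h2, h3⟩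
        have := hct i j hB h2
        simp only [Fin.lt_def] at *; omega
      have hle : (l : ℕ) < e := hce _ _ h1 hlt
      have hc := h.isCut_snd h1 ho
      have hkl' := hkl
      rw [Fin.lt_def] at hkl
      rw [hS k l h1 ho le_rfl hle, ← ih (e - (l + 1)) (by omega) (l + 1) rfl hle hc
        (fun m hm => by have := hD m hm; omega) (fun m hm h2 h3 => hU m hm (by omega) h3)
        (fun i j h2 h3 h4 h5 => hS i j h2 h3 (by omega) h5), ← mul_assoc]
      congr 1
      rw [← prod_insert (a := (k, l))]
      · refine prod_congr ?_ fun _ _ => rfl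
        ext ⟨i, j⟩
        simp only [mem_filter, mem_insert, Prod.mk.injEq]
        constructor
        · rintro ⟨h2, h3, h4, h5⟩
          by_cases h6 : i = k
          · subst h6; exact Or.inl ⟨rfl, h.fst_inj _ _ _ h2 h1⟩
          · refine Or.inr ⟨h2, h3, ?_, h5⟩
            have h7 := h.noncross _ _ _ _ h1 h2
            have h8 := h3 _ h1
            have h9 : i ≠ l := by
              rintro rfl
              have := h.fst_false _ _ h2
              rw [h.snd_true _ _ h1] at this
              exact absurd this (by simp)
            simp only [Fin.lt_def, Fin.ext_iff] at *; omega
        · rintro (⟨rfl, rfl⟩ | ⟨h2, h3, h4, h5⟩)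
          · exact ⟨h1, ho, le_rfl, hle⟩
          · exact ⟨h2, h3, by omega, h5⟩
      · simp only [mem_filter, not_and]
        intro _ _ h4; omega
    · have h2 := h.lt _ _ h1
      rw [Fin.lt_def] at h2
      have := hct _ _ h1 h2
      omega

end Counting

section Weights

variable {K : Type*} [Field K] {N : ℕ}

/-- The number of a remaining up arrow in the enumeration from the left. -/
def nu (S : Finset (Fin N × Fin N)) (U : Finset (Fin N)) (k : Fin N) : ℕ :=
  countLT U (k + 1) + arcsLT S (k + 1)

/-- The contribution of the sizes of the arcs. -/
def arcWeight (q : K) (S : Finset (Fin N × Fin N)) : K := ∏ A ∈ S, (qint q (size A))⁻¹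

/-- The contribution of the remaining up arrows. -/
def upWeight (q : K) (S : Finset (Fin N × Fin N)) (U : Finset (Fin N)) : K :=
  ∏ k ∈ U, (qint q (nu S U k))⁻¹

/-- The contribution of the remaining up arrows, where the numbers of those that are not among the
first `t` positions are raised by one. -/
def mixedWeight (q : K) (S : Finset (Fin N × Fin N)) (U : Finset (Fin N)) (t : ℕ) : K :=
  ∏ k ∈ U, (qint q (if (k : ℕ) < t then nu S U k else nu S U k + 1))⁻¹

variable {q : K} {b : Fin N → Bool} {S : Finset (Fin N × Fin N)} {U D : Finset (Fin N)}

theorem nu_pos {k : Fin N} (hk : k ∈ U) : 1 ≤ nu S U k := by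
  rw [nu, countLT_succ_of_mem hk]; omega

theorem IsMatching.nu_up (h : IsMatching b S U D) {k : Fin N} (hk : k ∈ U) :
    nu S U k = countLT U k + arcsLT S k + 1 := by
  rw [nu, countLT_succ_of_mem hk, arcsLT_eq_of_notMem (Nat.le_succ _)]
  · omega
  · intro i j hij
    have := h.up_out k hk i j hij
    have := h.lt _ _ hij
    simp only [Fin.lt_def] at *; omega

theorem mixedWeight_of_lt {t : ℕ} (h : ∀ k ∈ U, (k : ℕ) < t) :
    mixedWeight q S U t = upWeight q S U :=
  prod_congr rfl fun k hk => by rw [if_pos (h k hk)]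

theorem mixedWeight_zero :
    mixedWeight q S U 0 = ∏ k ∈ U, (qint q (nu S U k + 1))⁻¹ :=
  prod_congr rfl fun k _ => by rw [if_neg (Nat.not_lt_zero _)]

theorem mixedWeight_succ {k : Fin N} (hk : k ∈ U) :
    (qint q (nu S U k + 1))⁻¹ * mixedWeight q S U (k + 1) =
      (qint q (nu S U k))⁻¹ * mixedWeight q S U k := by
  rw [mixedWeight, mixedWeight, ← mul_prod_erase _ _ hk, ← mul_prod_erase _ _ hk, if_pos (by omega),
    if_neg (by omega)]
  rw [prod_congr rfl (g := fun l : Fin N =>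
    (qint q (if (l : ℕ) < k then nu S U l else nu S U l + 1))⁻¹)]
  · ring
  · intro l hl
    have : (l : ℕ) ≠ k := fun h => (mem_erase.1 hl).1 (Fin.ext h)
    have : ((l : ℕ) < k + 1) ↔ ((l : ℕ) < k) := by omega
    simp only [this]

theorem mixedWeight_congr {s t : ℕ} (h : ∀ k ∈ U, (k : ℕ) < s ↔ (k : ℕ) < t) :
    mixedWeight q S U s = mixedWeight q S U t :=
  prod_congr rfl fun k hk => by rw [if_congr (h k hk) rfl rfl]

theorem arcsLT_erase {i j : Fin N} (h : (i, j) ∈ S) (t : ℕ) :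
    arcsLT (S.erase (i, j)) t + (if (i : ℕ) < t then 1 else 0) = arcsLT S t := by
  rw [arcsLT, arcsLT, filter_erase]
  split_ifs with hi
  · rw [card_erase_add_one]; simp [h, hi]
  · rw [erase_eq_of_notMem, add_zero]; simp [hi]

theorem countLT_insert {k : Fin N} (h : k ∉ U) (t : ℕ) :
    countLT (insert k U) t = countLT U t + (if (k : ℕ) < t then 1 else 0) := by
  rw [countLT, countLT, filter_insert]
  split_ifs with hi
  · rw [card_insert_of_notMem]; simp [h]
  · rw [add_zero]

theorem IsMatching.fst_notMem_up (h : IsMatching b S U D) {i j : Fin N} (hij : (i, j) ∈ S) :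
    i ∉ U := by
  intro hi
  have := h.up_out i hi i j hij
  have := h.lt _ _ hij
  simp only [Fin.lt_def] at *; omega

theorem IsMatching.snd_notMem_up (h : IsMatching b S U D) {i j : Fin N} (hij : (i, j) ∈ S) :
    j ∉ U := by
  intro hi
  have := h.up_out j hi i j hij
  have := h.lt _ _ hij
  simp only [Fin.lt_def] at *; omega

theorem IsMatching.upWeight_split (h : IsMatching b S U D) {i j : Fin N} (hij : (i, j) ∈ S)
    (ho : ∀ B ∈ S, ¬(B.1 < i ∧ j < B.2)) :
    upWeight q (S.erase (i, j)) (insert i (insert j U)) =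
      (qint q (countLT U i + arcsLT S i + 1))⁻¹ *
        (qint q (countLT U i + arcsLT S i + 1 + size (i, j)))⁻¹ * mixedWeight q S U i := by
  have hlt := h.lt _ _ hij
  have hi := h.fst_notMem_up hij
  have hj := h.snd_notMem_up hij
  have hi' : i ∉ insert j U := by simp [hi, hlt.ne]
  rw [upWeight, prod_insert hi', prod_insert hj, mul_assoc]
  rw [Fin.lt_def] at hlt
  have hcj := h.arcsLT_snd hij ho
  have hsz := size_pos (h.lt _ _ hij)
  have hnu : ∀ k : Fin N, nu (S.erase (i, j)) (insert i (insert j U)) k +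
      (if i ≤ k then 1 else 0) = nu S U k + (if i ≤ k then 1 else 0) + (if j ≤ k then 1 else 0) := by
    intro k
    rw [nu, nu, countLT_insert hi', countLT_insert hj]
    have := arcsLT_erase hij (k + 1)
    have e1 : ((i : ℕ) < k + 1) ↔ i ≤ k := by rw [Fin.le_def]; omega
    have e2 : ((j : ℕ) < k + 1) ↔ j ≤ k := by rw [Fin.le_def]; omega
    simp only [e1, e2] at this ⊢
    split_ifs at * <;> omega
  have hci : arcsLT S (i + 1) = arcsLT S i + 1 := by
    have h1 := arcsLT_erase hij (i + 1)
    have h2 := arcsLT_erase hij i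
    rw [if_pos (by omega)] at h1
    rw [if_neg (by omega)] at h2
    rw [← h1, ← h2, arcsLT_eq_of_notMem (Nat.le_succ _)]
    intro i' j' h'
    have h3 : i' ≠ i := by
      rintro rfl
      have := h.fst_inj _ _ _ hij (mem_of_mem_erase h')
      subst this
      simp at h'
    rw [Ne, Fin.ext_iff] at h3; omega
  have hui : countLT U (i + 1) = countLT U i := by
    refine countLT_eq_of_notMem (by omega) fun k hk => ?_
    have := h.up_out k hk i j hij
    simp only [Fin.lt_def] at this; omega
  have huj : countLT U (j + 1) = countLT U i := by
    refine countLT_eq_of_notMem (by omega) fun k hk => ?_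
    have := h.up_out k hk i j hij
    simp only [Fin.lt_def] at this; omega
  have e1 := hnu i
  rw [if_pos le_rfl, if_neg (by rw [Fin.le_def]; omega), nu, nu, hci, hui, ← nu] at e1
  have e2 := hnu j
  rw [if_pos le_rfl, if_pos (by rw [Fin.le_def]; omega), nu, nu, hcj, huj, ← nu] at e2
  refine congrArg₂ _ (by congr 2; omega) (congrArg₂ _ (by congr 2; omega) ?_)
  · rw [mixedWeight]
    refine prod_congr rfl fun k hk => ?_
    have e3 := hnu k
    have := h.up_out k hk i j hij
    simp only [Fin.lt_def, Fin.le_def] at this e3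
    congr 2
    split_ifs at * <;> omega

/-- The telescoping sum over the diagrams that are obtained by opening an outer arc. -/
theorem IsMatching.sum_outerLeft (h : IsMatching b S U D) (hq : q ≠ 0)
    (hn : ∀ n : ℕ, 1 ≤ n → qint q n ≠ 0) {s e : ℕ} (hse : s ≤ e) (he : e ≤ N) (hcs : IsCut S s)
    (hce : IsCut S e) (hD : ∀ k ∈ D, e ≤ (k : ℕ)) :
    ∑ A ∈ S.filter (fun A => (∀ B ∈ S, ¬(B.1 < A.1 ∧ A.2 < B.2)) ∧ s ≤ A.1 ∧ (A.2 : ℕ) < e),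
      q⁻¹ ^ (countLT U A.1 + 1) * (qint q (size A) *
        upWeight q (S.erase A) (insert A.1 (insert A.2 U))) +
      q ^ arcsLT S e * (qint q (countLT U e + arcsLT S e + 1))⁻¹ * mixedWeight q S U e =
      q ^ arcsLT S s * (qint q (countLT U s + arcsLT S s + 1))⁻¹ * mixedWeight q S U s := by
  refine h.sum_outer_telescope
    (fun t => q ^ arcsLT S t * (qint q (countLT U t + arcsLT S t + 1))⁻¹ * mixedWeight q S U t)
    (fun A => q⁻¹ ^ (countLT U A.1 + 1) * (qint q (size A) *
        upWeight q (S.erase A) (insert A.1 (insert A.2 U)))) he hce _ s rfl hse hcs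
    (fun k hk => Or.inr (hD k hk)) ?_ ?_
  · intro k hk _ _
    have h1 := h.nu_up hk
    have h2 : arcsLT S (k + 1) = arcsLT S k := by
      rw [nu, countLT_succ_of_mem hk] at h1; omega
    simp only [h2, countLT_succ_of_mem hk]
    have h3 := mixedWeight_succ (q := q) (S := S) hk
    rw [h1] at h3
    rw [mul_assoc, mul_assoc, ← h3]
    congr 3
    congr 2
    omega
  · intro i j hij ho _ _
    simp only
    rw [h.upWeight_split hij ho, h.arcsLT_snd hij ho]
    have huj : countLT U (j + 1) = countLT U i := by
      have hlt := h.lt _ _ hij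
      rw [Fin.lt_def] at hlt
      refine countLT_eq_of_notMem (by omega) fun k hk => ?_
      have := h.up_out k hk i j hij
      simp only [Fin.lt_def] at this; omega
    have hmj : mixedWeight q S U (j + 1) = mixedWeight q S U i := by
      have hlt := h.lt _ _ hij
      rw [Fin.lt_def] at hlt
      refine mixedWeight_congr fun k hk => ?_
      have := h.up_out k hk i j hij
      simp only [Fin.lt_def] at this; omega
    rw [huj, hmj]
    have e1 : countLT U i + (arcsLT S i + size (i, j)) + 1 =
      (countLT U i + arcsLT S i + 1) + size (i, j) := by omega
    rw [e1]
    have n1 := hn (countLT U i + arcsLT S i + 1) (by omega)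
    have n2 := hn (countLT U i + arcsLT S i + 1 + size (i, j)) (by omega)
    have key := qint_add hq (countLT U i + arcsLT S i + 1) (size (i, j))
    have key2 : q ^ arcsLT S i * q⁻¹ ^ (countLT U i + arcsLT S i + 1) =
        q⁻¹ ^ (countLT U i + 1) := by
      rw [show countLT U i + arcsLT S i + 1 = arcsLT S i + (countLT U i + 1) by ring, pow_add,
        ← mul_assoc, ← mul_pow, mul_inv_cancel₀ hq, one_pow, one_mul]
    rw [← key2, pow_add q (arcsLT S i)]
    generalize qint q (countLT U i + arcsLT S i + 1 + size (i, j)) = X at *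
    generalize qint q (countLT U i + arcsLT S i + 1) = Y at *
    generalize qint q (size (i, j)) = Z at *
    clear key2
    generalize q⁻¹ ^ (countLT U i + arcsLT S i + 1) = W at *
    field_simp
    linear_combination (mixedWeight q S U i) * key

end Weights

section DownWeights

variable {K : Type*} [Field K] {N : ℕ}

/-- The number of arcs right of `k`. -/
def rho (S : Finset (Fin N × Fin N)) (k : Fin N) : ℕ := (S.filter fun A => k ≤ A.1).card

/-- A product over the remaining down arrows that depends on their numbers from the right and the
numbers of arcs right of them. -/
def downWeight (w : ℕ → ℕ → K) (S : Finset (Fin N × Fin N)) (D : Finset (Fin N)) : K :=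
  ∏ k ∈ D, w (numR D k) (rho S k)

variable {w : ℕ → ℕ → K} {S S' : Finset (Fin N × Fin N)} {D : Finset (Fin N)}

theorem downWeight_congr (h : ∀ k ∈ D, rho S k = rho S' k) :
    downWeight w S D = downWeight w S' D :=
  prod_congr rfl fun k hk => by rw [h k hk]

theorem downWeight_insert {k : Fin N} (h : ∀ l ∈ D, k < l) :
    downWeight w S (insert k D) = w (D.card + 1) (rho S k) * downWeight w S D := by
  have hk : k ∉ D := fun hk => absurd (h k hk) (lt_irrefl _)
  rw [downWeight, prod_insert hk]
  congr 1
  · congr 1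
    rw [numR, filter_true_of_mem, card_insert_of_notMem hk]
    intro l hl
    rcases mem_insert.1 hl with rfl | hl
    · exact le_rfl
    · exact (h l hl).le
  · refine prod_congr rfl fun l hl => ?_
    congr 1
    rw [numR, numR, filter_insert, if_neg (not_le.2 (h l hl))]

theorem rho_add_arcsLT (S : Finset (Fin N × Fin N)) (k : Fin N) :
    rho S k + arcsLT S k = S.card := by
  rw [rho, arcsLT, ← card_filter_add_card_filter_not (s := S) (fun A => k ≤ A.1)]
  congr 2
  refine filter_congr fun A _ => ?_
  rw [Fin.le_def]; omega

end DownWeights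

section Moves

variable {K : Type*} [Field K] {N : ℕ} {q : K} {w : ℕ → ℕ → K} {b : Fin N → Bool}
  {S : Finset (Fin N × Fin N)} {U D : Finset (Fin N)}

/-- The arcs of `S`, moved one position to the right. -/
def shiftArcs (S : Finset (Fin N × Fin N)) : Finset (Fin (N + 1) × Fin (N + 1)) :=
  S.image fun A => (A.1.succ, A.2.succ)

/-- The arrows of `U`, moved one position to the right. -/
def shiftSet (U : Finset (Fin N)) : Finset (Fin (N + 1)) := U.image Fin.succ

theorem shiftArcs_injective :
    Function.Injective fun A : Fin N × Fin N => (A.1.succ, A.2.succ) := by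
  rintro ⟨a, b⟩ ⟨c, d⟩ h
  simpa using h

theorem card_shiftSet : (shiftSet U).card = U.card :=
  card_image_of_injective _ (Fin.succ_injective N)

theorem card_shiftArcs : (shiftArcs S).card = S.card :=
  card_image_of_injective _ shiftArcs_injective

theorem zero_notMem_shiftSet : (0 : Fin (N + 1)) ∉ shiftSet U := by simp [shiftSet]

theorem zero_lt_shiftSet : ∀ l ∈ shiftSet U, (0 : Fin (N + 1)) < l := by
  intro l hl
  rw [shiftSet, mem_image] at hl
  obtain ⟨k, -, rfl⟩ := hl
  exact Fin.succ_pos k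

theorem prod_shiftSet (f : Fin (N + 1) → K) : ∏ k ∈ shiftSet U, f k = ∏ k ∈ U, f k.succ :=
  prod_image (fun _ _ _ _ h => Fin.succ_injective N h)

theorem prod_shiftArcs (f : Fin (N + 1) × Fin (N + 1) → K) :
    ∏ A ∈ shiftArcs S, f A = ∏ A ∈ S, f (A.1.succ, A.2.succ) :=
  prod_image (fun _ _ _ _ h => shiftArcs_injective h)

theorem countLT_shiftSet (t : ℕ) : countLT (shiftSet U) (t + 1) = countLT U t := by
  rw [countLT, shiftSet, filter_image, card_image_of_injective _ (Fin.succ_injective N), countLT]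
  simp

theorem arcsLT_shiftArcs (t : ℕ) : arcsLT (shiftArcs S) (t + 1) = arcsLT S t := by
  rw [arcsLT, shiftArcs, filter_image, card_image_of_injective _ shiftArcs_injective, arcsLT]
  simp

theorem size_succ (i j : Fin N) : size (i.succ, j.succ) = size (i, j) := by
  simp only [size, pos, Fin.val_succ]; congr 2; omega

theorem arcWeight_shiftArcs : arcWeight q (shiftArcs S) = arcWeight q S := by
  rw [arcWeight, prod_shiftArcs, arcWeight]
  simp only [size_succ]

theorem upWeight_shift :
    upWeight q (shiftArcs S) (insert 0 (shiftSet U)) =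
      (qint q 1)⁻¹ * mixedWeight q S U 0 := by
  have h0 : ∀ t, arcsLT (shiftArcs S) (t + 1) = arcsLT S t := arcsLT_shiftArcs
  rw [upWeight, prod_insert zero_notMem_shiftSet, prod_shiftSet, mixedWeight_zero]
  congr 1
  · rw [nu, countLT_insert zero_notMem_shiftSet, Fin.val_zero, countLT_shiftSet, h0, countLT_zero,
      arcsLT_zero, if_pos (by omega)]
  · refine prod_congr rfl fun k _ => ?_
    rw [nu, countLT_insert zero_notMem_shiftSet, Fin.val_succ, countLT_shiftSet, h0,
      Fin.val_zero, if_pos (by omega), nu]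
    congr 2; omega

theorem rho_shift (k : Fin N) : rho (shiftArcs S) k.succ = rho S k := by
  rw [rho, shiftArcs, filter_image, card_image_of_injective _ shiftArcs_injective, rho]
  simp

theorem numR_shift (k : Fin N) : numR (shiftSet D) k.succ = numR D k := by
  rw [numR, shiftSet, filter_image, card_image_of_injective _ (Fin.succ_injective N), numR]
  simp

theorem numR_insert_of_lt {k l : Fin N} (h : k < l) : numR (insert k D) l = numR D l := by
  rw [numR, numR, filter_insert, if_neg (not_le.2 h)]

theorem downWeight_shift : downWeight w (shiftArcs S) (shiftSet D) = downWeight w S D := by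
  rw [downWeight, prod_shiftSet, downWeight]
  simp only [rho_shift, numR_shift]

theorem IsMatching.shift' (h : IsMatching b S U D) :
    IsMatching (Fin.cons true b : Fin (N + 1) → Bool) (shiftArcs S) (insert 0 (shiftSet U))
      (shiftSet D) := h.shift

theorem IsMatching.cons_false_of_first (h : IsMatching b S U D) {k : Fin N} (hk : k ∈ U)
    (hmin : ∀ l ∈ U, k ≤ l) :
    IsMatching (Fin.cons false b : Fin (N + 1) → Bool) (insert (0, k.succ) (shiftArcs S))
      (shiftSet (U.erase k)) (shiftSet D) := by
  rw [cons_false_eq_update]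
  have := h.shift'.close (k := 0) (l := k.succ) (by simp) (by simp [shiftSet, hk])
    (Fin.succ_pos k) ?_
  · rw [erase_insert zero_notMem_shiftSet] at this
    rwa [shiftSet, image_erase (Fin.succ_injective N)]
  · intro m hm
    rw [mem_insert, shiftSet, mem_image] at hm
    obtain rfl | ⟨m, hm, rfl⟩ := hm
    · simp
    · right; simpa using hmin m hm

theorem IsMatching.cons_false_of_empty (h : IsMatching b S ∅ D) :
    IsMatching (Fin.cons false b : Fin (N + 1) → Bool) (shiftArcs S) ∅
      (insert 0 (shiftSet D)) := by
  rw [cons_false_eq_update]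
  have := h.shift'.demote (k := 0) (by simp) (by simp [shiftSet])
  simpa [shiftSet] using this

theorem zero_pair_notMem (k : Fin N) : ((0 : Fin (N + 1)), k.succ) ∉ shiftArcs S := by
  simp [shiftArcs]

theorem IsMatching.first_count (h : IsMatching b S U D) {k : Fin N} (hk : k ∈ U)
    (hmin : ∀ l ∈ U, k ≤ l) : (k : ℕ) = 2 * arcsLT S k := by
  have := h.eq_count (t := k) (by omega) (h.isCut_up hk)
  rw [countLT_of_ge U (fun l hl => hmin l hl),
    countLT_of_ge D (fun l hl => (h.up_lt_down k hk l hl).le)] at this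
  omega

theorem IsMatching.size_first (h : IsMatching b S U D) {k : Fin N} (hk : k ∈ U)
    (hmin : ∀ l ∈ U, k ≤ l) : size ((0 : Fin (N + 1)), k.succ) = nu S U k := by
  have := h.first_count hk hmin
  rw [h.nu_up hk, countLT_of_ge U (fun l hl => hmin l hl)]
  simp only [size, pos, Fin.val_zero, Fin.val_succ]
  omega

theorem IsMatching.arcWeight_mul_upWeight_cons_false (h : IsMatching b S U D) {k : Fin N}
    (hk : k ∈ U) (hmin : ∀ l ∈ U, k ≤ l) :
    arcWeight q (insert (0, k.succ) (shiftArcs S)) *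
      upWeight q (insert (0, k.succ) (shiftArcs S)) (shiftSet (U.erase k)) =
    arcWeight q S * upWeight q S U := by
  rw [arcWeight, prod_insert (zero_pair_notMem k), ← arcWeight, arcWeight_shiftArcs,
    h.size_first hk hmin, upWeight, upWeight, prod_shiftSet, ← mul_prod_erase _ _ hk]
  rw [prod_congr rfl (g := fun l => (qint q (nu S U l))⁻¹)]
  · ring
  · intro l hl
    rw [mem_erase] at hl
    have hkl : k < l := lt_of_le_of_ne (hmin l hl.2) hl.1.symm
    rw [nu, Fin.val_succ, countLT_shiftSet, arcsLT, filter_insert, if_pos (by simp),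
      card_insert_of_notMem (by simp [zero_pair_notMem]), ← arcsLT, arcsLT_shiftArcs, nu]
    have : countLT U (l + 1) = countLT (U.erase k) (l + 1) + 1 := by
      conv_lhs => rw [← insert_erase hk]
      rw [countLT_insert (by simp), if_pos (by rw [Fin.lt_def] at hkl; omega)]
    rw [this]
    congr 2; omega

theorem downWeight_cons_false (k : Fin N) :
    downWeight w (insert (0, k.succ) (shiftArcs S)) (shiftSet D) = downWeight w S D := by
  rw [← downWeight_shift (S := S) (D := D)]
  refine downWeight_congr fun l hl => ?_
  rw [rho, filter_insert, if_neg, ← rho]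
  exact not_le.2 (zero_lt_shiftSet l hl)

theorem downWeight_cons_false_empty :
    downWeight w (shiftArcs S) (insert 0 (shiftSet D)) =
      w (D.card + 1) S.card * downWeight w S D := by
  rw [downWeight_insert zero_lt_shiftSet, downWeight_shift, card_shiftSet]
  congr 2
  rw [rho, filter_true_of_mem (by simp), card_shiftArcs]

theorem IsMatching.upWeight_promote (h : IsMatching b S U D) {k : Fin N} (hk : k ∈ D) :
    upWeight q S (insert k U) = (qint q (U.card + arcsLT S k + 1))⁻¹ * upWeight q S U := by
  have hkU : k ∉ U := fun hk' => absurd (h.up_lt_down k hk' k hk) (lt_irrefl _)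
  rw [upWeight, prod_insert hkU]
  congr 1
  · rw [nu, countLT_insert hkU, if_pos (by omega), countLT_of_le, arcsLT_eq_of_notMem (s := k)]
    · congr 2; omega
    · omega
    · intro i j hij
      have := h.down_out k hk i j hij
      have := h.lt _ _ hij
      simp only [Fin.lt_def] at *; omega
    · intro l hl
      have := h.up_lt_down l hl k hk
      rw [Fin.lt_def] at this; omega
  · refine prod_congr rfl fun l hl => ?_
    have := h.up_lt_down l hl k hk
    rw [Fin.lt_def] at this
    rw [nu, countLT_insert hkU, if_neg (by omega), nu, add_zero]

theorem downWeight_erase_first {k : Fin N} (hk : k ∈ D) (hmin : ∀ l ∈ D, k ≤ l) :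
    downWeight w S D = w D.card (rho S k) * downWeight w S (D.erase k) := by
  conv_lhs => rw [← insert_erase hk]
  rw [downWeight_insert, card_erase_add_one hk]
  intro l hl
  rw [mem_erase] at hl
  exact lt_of_le_of_ne (hmin l hl.2) hl.1.symm

theorem IsMatching.upWeight_demote {k : Fin N} (hk : k ∈ U) (hmax : ∀ l ∈ U, l ≤ k) :
    upWeight q S U = (qint q (nu S U k))⁻¹ * upWeight q S (U.erase k) := by
  rw [upWeight, ← mul_prod_erase _ _ hk, upWeight]
  congr 1
  refine prod_congr rfl fun l hl => ?_
  rw [mem_erase] at hl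
  have := lt_of_le_of_ne (hmax l hl.2) hl.1
  rw [Fin.lt_def] at this
  have h1 : countLT U (l + 1) = countLT (U.erase k) (l + 1) := by
    conv_lhs => rw [← insert_erase hk]
    rw [countLT_insert (by simp), if_neg (by omega), add_zero]
  rw [nu, nu, h1]

theorem arcWeight_erase (hn : ∀ n : ℕ, 1 ≤ n → qint q n ≠ 0) (h : IsMatching b S U D)
    {i j : Fin N} (hij : (i, j) ∈ S) :
    arcWeight q (S.erase (i, j)) = qint q (size (i, j)) * arcWeight q S := by
  rw [arcWeight, arcWeight, ← mul_prod_erase _ _ hij, ← mul_assoc, mul_inv_cancel₀, one_mul]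
  exact hn _ (size_pos (h.lt _ _ hij))

theorem downWeight_split {i j : Fin N} (hD : ∀ k ∈ D, i < k) :
    downWeight w (S.erase (i, j)) D = downWeight w S D := by
  refine downWeight_congr fun k hk => ?_
  rw [rho, filter_erase, erase_eq_of_notMem, ← rho]
  simp [hD k hk]

/-- The number of arcs left of `D`. -/
def arcsLeft (S : Finset (Fin N × Fin N)) (D : Finset (Fin N)) : ℕ :=
  (S.filter fun A => ∀ k ∈ D, A.1 < k).card

theorem IsMatching.exists_end (h : IsMatching b S U D) :
    ∃ e : ℕ, e ≤ N ∧ IsCut S e ∧ (∀ k ∈ D, e ≤ (k : ℕ)) ∧ (∀ k ∈ U, (k : ℕ) < e) ∧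
      arcsLT S e = arcsLeft S D ∧ outerLeft S D = S.filter (fun A =>
        (∀ B ∈ S, ¬(B.1 < A.1 ∧ A.2 < B.2)) ∧ 0 ≤ (A.1 : ℕ) ∧ (A.2 : ℕ) < e) := by
  rcases D.eq_empty_or_nonempty with rfl | hD
  · refine ⟨N, le_rfl, IsMatching.isCut_top, by simp, fun k _ => k.2, ?_, ?_⟩
    · simp [arcsLT, arcsLeft]
    · simp [outerLeft]
  · have hm := D.min'_mem hD
    refine ⟨D.min' hD, by omega, h.isCut_down hm, fun k hk => D.min'_le k hk,
      fun k hk => h.up_lt_down k hk _ hm, ?_, ?_⟩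
    · rw [arcsLT, arcsLeft]
      congr 1
      refine filter_congr fun A _ => ?_
      constructor
      · intro h1 k hk; exact lt_of_lt_of_le h1 (D.min'_le k hk)
      · intro h1; exact h1 _ hm
    · rw [outerLeft]
      refine filter_congr fun A _ => ?_
      simp only [zero_le, true_and]
      refine and_congr_right fun _ => ?_
      constructor
      · intro h1; exact h1 _ hm
      · intro h1 k hk; exact lt_of_lt_of_le h1 (D.min'_le k hk)

theorem IsMatching.sum_split (h : IsMatching b S U D) (hq : q ≠ 0)
    (hn : ∀ n : ℕ, 1 ≤ n → qint q n ≠ 0) :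
    ∑ A ∈ outerLeft S D, q⁻¹ ^ ((U.filter fun m => m < A.1).card + 1) *
      (arcWeight q (S.erase A) * upWeight q (S.erase A) (insert A.1 (insert A.2 U))) =
    arcWeight q S * (mixedWeight q S U 0 -
      q ^ arcsLeft S D * (qint q (U.card + arcsLeft S D + 1))⁻¹ * upWeight q S U) := by
  obtain ⟨e, he, hce, hD, hU, hl, ho⟩ := h.exists_end
  have := h.sum_outerLeft hq hn (Nat.zero_le e) he IsMatching.isCut_zero hce hD
  rw [hl, countLT_of_le U hU, mixedWeight_of_lt hU, arcsLT_zero, countLT_zero, zero_add, zero_add,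
    pow_zero, one_mul, qint_one hq, inv_one, one_mul, ← ho] at this
  rw [← this, add_sub_cancel_right, mul_sum]
  refine sum_congr rfl ?_
  rintro ⟨i, j⟩ hA
  have hij : (i, j) ∈ S := (mem_filter.1 hA).1
  rw [arcWeight_erase hn h hij]
  simp only [countLT, Fin.lt_def]
  ring

theorem rho_first {k : Fin N} (hk : k ∈ D) (hmin : ∀ l ∈ D, k ≤ l) :
    rho S k + arcsLeft S D = S.card := by
  rw [← rho_add_arcsLT S k]
  congr 1
  rw [arcsLeft, arcsLT]
  congr 1
  refine filter_congr fun A _ => ?_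
  constructor
  · intro h1; exact h1 _ hk
  · intro h1 l hl; exact lt_of_lt_of_le h1 (hmin l hl)

theorem arcsLT_first {k : Fin N} (hk : k ∈ D) (hmin : ∀ l ∈ D, k ≤ l) :
    arcsLT S k = arcsLeft S D := by
  have := rho_first (S := S) hk hmin
  have := rho_add_arcsLT S k
  omega

theorem arcsLeft_empty : arcsLeft S ∅ = S.card := by simp [arcsLeft]

theorem firstOf_cases (D : Finset (Fin N)) :
    (D = ∅ ∧ firstOf D = ∅) ∨ ∃ k ∈ D, (∀ l ∈ D, k ≤ l) ∧ firstOf D = {k} := by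
  rcases D.eq_empty_or_nonempty with rfl | hD
  · left; simp [firstOf]
  · right
    refine ⟨D.min' hD, D.min'_mem hD, fun l hl => D.min'_le l hl, ?_⟩
    ext k
    rw [mem_firstOf, mem_singleton]
    constructor
    · rintro ⟨h1, h2⟩; exact le_antisymm (h2 _ (D.min'_mem hD)) (D.min'_le k h1)
    · rintro rfl; exact ⟨D.min'_mem hD, fun l hl => D.min'_le l hl⟩

theorem lastOf_cases (U : Finset (Fin N)) :
    (U = ∅ ∧ lastOf U = ∅) ∨ ∃ k ∈ U, (∀ l ∈ U, l ≤ k) ∧ lastOf U = {k} := by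
  rcases U.eq_empty_or_nonempty with rfl | hU
  · left; simp [lastOf]
  · right
    refine ⟨U.max' hU, U.max'_mem hU, fun l hl => U.le_max' l hl, ?_⟩
    ext k
    rw [mem_lastOf, mem_singleton]
    constructor
    · rintro ⟨h1, h2⟩; exact le_antisymm (U.le_max' k h1) (h2 _ (U.max'_mem hU))
    · rintro rfl; exact ⟨U.max'_mem hU, fun l hl => U.le_max' l hl⟩

theorem IsMatching.length_eq (h : IsMatching b S U D) : N = U.card + D.card + 2 * S.card := by
  have := h.eq_count (le_refl N) IsMatching.isCut_top
  rwa [countLT_of_le U (fun k _ => k.2), countLT_of_le D (fun k _ => k.2), arcsLT,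
    filter_true_of_mem (fun A _ => A.1.2)] at this

end Moves

section Enumeration

variable {K : Type*} [Field K] {N : ℕ} {q : K}

/-- The quantum factorial. -/
def qfact (q : K) (n : ℕ) : K := ∏ i ∈ range n, qint q (i + 1)

theorem qfact_succ (n : ℕ) : qfact q (n + 1) = qfact q n * qint q (n + 1) := prod_range_succ _ _

theorem numR_injOn (X : Finset (Fin N)) : Set.InjOn (numR X) X := by
  have key : ∀ k ∈ X, ∀ l ∈ X, k < l → numR X l < numR X k := by
    intro k hk l hl hkl
    refine card_lt_card ⟨fun m hm => ?_, fun h => ?_⟩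
    · simp only [mem_filter] at hm ⊢; exact ⟨hm.1, hkl.le.trans hm.2⟩
    · have := h (show k ∈ _ by simp [hk])
      simp only [mem_filter] at this
      exact absurd hkl (not_lt.2 this.2)
  intro k hk l hl h
  rcases lt_trichotomy k l with h1 | h1 | h1
  · have := key k hk l hl h1; omega
  · exact h1
  · have := key l hl k hk h1; omega

theorem numL_injOn (X : Finset (Fin N)) : Set.InjOn (numL X) X := by
  have key : ∀ k ∈ X, ∀ l ∈ X, k < l → numL X k < numL X l := by
    intro k hk l hl hkl
    refine card_lt_card ⟨fun m hm => ?_, fun h => ?_⟩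
    · simp only [mem_filter] at hm ⊢; exact ⟨hm.1, hm.2.trans hkl.le⟩
    · have := h (show l ∈ _ by simp [hl])
      simp only [mem_filter] at this
      exact absurd hkl (not_lt.2 this.2)
  intro k hk l hl h
  rcases lt_trichotomy k l with h1 | h1 | h1
  · have := key k hk l hl h1; omega
  · exact h1
  · have := key l hl k hk h1; omega

theorem numR_pos {X : Finset (Fin N)} {k : Fin N} (hk : k ∈ X) : 1 ≤ numR X k :=
  card_pos.2 ⟨k, by simp [hk]⟩

theorem numL_pos {X : Finset (Fin N)} {k : Fin N} (hk : k ∈ X) : 1 ≤ numL X k :=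
  card_pos.2 ⟨k, by simp [hk]⟩

theorem image_numR (X : Finset (Fin N)) : X.image (numR X) = Icc 1 X.card := by
  refine eq_of_subset_of_card_le (fun i hi => ?_) ?_
  · rw [mem_image] at hi
    obtain ⟨k, hk, rfl⟩ := hi
    rw [mem_Icc]
    exact ⟨numR_pos hk, card_filter_le _ _⟩
  · rw [card_image_of_injOn (numR_injOn X)]; simp

theorem image_numL (X : Finset (Fin N)) : X.image (numL X) = Icc 1 X.card := by
  refine eq_of_subset_of_card_le (fun i hi => ?_) ?_
  · rw [mem_image] at hi
    obtain ⟨k, hk, rfl⟩ := hi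
    rw [mem_Icc]
    exact ⟨numL_pos hk, card_filter_le _ _⟩
  · rw [card_image_of_injOn (numL_injOn X)]; simp

theorem prod_numR {M : Type*} [CommMonoid M] (X : Finset (Fin N)) (f : ℕ → M) :
    ∏ k ∈ X, f (numR X k) = ∏ i ∈ Icc 1 X.card, f i := by
  rw [← image_numR, prod_image (numR_injOn X)]

theorem prod_numL {M : Type*} [CommMonoid M] (X : Finset (Fin N)) (f : ℕ → M) :
    ∏ k ∈ X, f (numL X k) = ∏ i ∈ Icc 1 X.card, f i := by
  rw [← image_numL, prod_image (numL_injOn X)]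

theorem prod_Icc_one {M : Type*} [CommMonoid M] (n : ℕ) (f : ℕ → M) :
    ∏ i ∈ Icc 1 n, f i = ∏ i ∈ range n, f (i + 1) := by
  have h := prod_Ico_eq_prod_range f 1 (n + 1)
  have e : Icc 1 n = Ico 1 (n + 1) := by ext; simp
  rw [e, h]
  simp [add_comm]

variable {b : Fin N → Bool} {S : Finset (Fin N × Fin N)} {U D E : Finset (Fin N)}

theorem IsMatching.card_lefts (h : IsMatching b S U D) : (lefts S).card = S.card := by
  rw [lefts, card_image_of_injOn]
  rintro ⟨a, c⟩ hA ⟨a', d⟩ hB h'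
  simp only at h'
  subst h'
  rw [h.fst_inj _ _ _ hA hB]

theorem IsMatching.card_lefts_filter (h : IsMatching b S U D) (p : Fin N → Prop)
    [DecidablePred p] : ((lefts S).filter p).card = (S.filter fun A => p A.1).card := by
  rw [lefts, filter_image, card_image_of_injOn]
  rintro ⟨a, c⟩ hA ⟨a', d⟩ hB h'
  simp only [coe_filter, Set.mem_ofPred_eq] at hA hB h'
  subst h'
  rw [h.fst_inj _ _ _ hA.1 hB.1]

theorem mem_lefts {k : Fin N} : k ∈ lefts S ↔ ∃ l, (k, l) ∈ S := by
  simp [lefts]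

theorem IsMatching.disjoint_lefts_up (h : IsMatching b S U D) : Disjoint (lefts S) U := by
  rw [disjoint_left]
  intro k hk hk'
  rw [mem_lefts] at hk
  obtain ⟨l, hl⟩ := hk
  exact h.fst_notMem_up hl hk'

theorem IsMatching.disjoint_lefts_down (h : IsMatching b S U D) : Disjoint (lefts S) D := by
  rw [disjoint_left]
  intro k hk hk'
  rw [mem_lefts] at hk
  obtain ⟨l, hl⟩ := hk
  have := h.down_out k hk' k l hl
  have := h.lt _ _ hl
  simp only [Fin.lt_def] at *; omega

theorem IsMatching.disjoint_up_down (h : IsMatching b S U D) : Disjoint U D := by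
  rw [disjoint_left]
  intro k hk hk'
  exact absurd (h.up_lt_down k hk k hk') (lt_irrefl _)

theorem IsMatching.numL_up (h : IsMatching b S U D) (hE : E ⊆ D) {k : Fin N} (hk : k ∈ U) :
    numL (lefts S ∪ U ∪ E) k = nu S U k := by
  have h1 : Disjoint ((lefts S).filter fun l => l ≤ k) (U.filter fun l => l ≤ k) :=
    disjoint_filter_filter h.disjoint_lefts_up
  rw [numL, filter_union, filter_union, (filter_eq_empty_iff (s := E)).2, union_empty,
    card_union_of_disjoint h1, h.card_lefts_filter, nu, add_comm]
  · congr 1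
    · rw [countLT]
      congr 1
      refine filter_congr fun l _ => ?_
      rw [Fin.le_def]; omega
    · rw [arcsLT]
      congr 1
      refine filter_congr fun l _ => ?_
      rw [Fin.le_def]; omega
  · intro l hl
    exact not_le.2 (h.up_lt_down k hk l (hE hl))

theorem IsMatching.prod_numL_eq (h : IsMatching b S U D) (hn : ∀ n : ℕ, 1 ≤ n → qint q n ≠ 0)
    (hE : E ⊆ D) :
    ∏ k ∈ lefts S ∪ E, qint q (numL (lefts S ∪ U ∪ E) k) =
      qfact q (U.card + S.card + E.card) * upWeight q S U := by
  have d1 : Disjoint (lefts S ∪ E) U := by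
    rw [disjoint_union_left]
    exact ⟨h.disjoint_lefts_up, (h.disjoint_up_down.mono_right hE).symm⟩
  have d2 : Disjoint (lefts S) E := h.disjoint_lefts_down.mono_right hE
  have h1 := prod_numL (lefts S ∪ U ∪ E) (qint q)
  have h2 : lefts S ∪ U ∪ E = (lefts S ∪ E) ∪ U := by
    rw [union_assoc, union_comm U, ← union_assoc]
  have h3 : (lefts S ∪ U ∪ E).card = U.card + S.card + E.card := by
    rw [h2, card_union_of_disjoint d1, card_union_of_disjoint d2, h.card_lefts]; omega
  rw [h3, prod_Icc_one, ← qfact, h2, prod_union d1, ← h2] at h1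
  have h4 : ∏ k ∈ U, (qint q (numL (lefts S ∪ U ∪ E) k) * (qint q (nu S U k))⁻¹) = 1 := by
    refine prod_eq_one fun k hk => ?_
    rw [h.numL_up hE hk, mul_inv_cancel₀ (hn _ (nu_pos hk))]
  rw [← h1, mul_assoc, upWeight, ← prod_mul_distrib, h4, mul_one]

theorem IsMatching.numR_lefts_union (h : IsMatching b S U D) (hE : E ⊆ D) (k : Fin N) :
    numR (lefts S ∪ E) k = rho S k + numR E k := by
  rw [numR, filter_union, card_union_of_disjoint, h.card_lefts_filter, rho, numR]
  exact disjoint_filter_filter (h.disjoint_lefts_down.mono_right hE)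

end Enumeration

section BIII

variable {K : Type*} [Field K] {N : ℕ} {q Q : K} {b : Fin N → Bool}
  {S : Finset (Fin N × Fin N)} {U D : Finset (Fin N)}

/-- The vectors of the remaining down arrows for type BIII. -/
def kappaBIII (q Q : K) (N : ℕ) (D : Finset (Fin N)) (ε : Fin N → Bool) : K :=
  ∏ k ∈ D, downVec (-(q ^ (numR D k - 1) * Q⁻¹)) (ε k)

theorem numR_insert_self {k : Fin N} (h : ∀ l ∈ D, k < l) : numR (insert k D) k = D.card + 1 := by
  rw [numR, filter_true_of_mem, card_insert_of_notMem]
  · exact fun hk => lt_irrefl _ (h k hk)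
  · intro l hl
    rcases mem_insert.1 hl with rfl | hl
    · exact le_rfl
    · exact (h l hl).le

theorem prod_numR_insert {M : Type*} [CommMonoid M] {k : Fin N} (h : ∀ l ∈ D, k < l)
    (f : ℕ → Fin N → M) :
    ∏ l ∈ insert k D, f (numR (insert k D) l) l =
      f (D.card + 1) k * ∏ l ∈ D, f (numR D l) l := by
  rw [prod_insert (fun hk => lt_irrefl _ (h k hk)), numR_insert_self h]
  congr 1
  exact prod_congr rfl fun l hl => by rw [numR_insert_of_lt (h l hl)]

theorem isDownSystem_BIII : IsDownSystem q (kappaBIII q Q) (fun d => q ^ d * Q⁻¹) fun _ => 0 where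
  nil ε := by simp [kappaBIII]
  shift N D x ε := by
    rw [kappaBIII, kappaBIII, ← shiftSet, prod_shiftSet]
    simp only [numR_shift, Fin.cons_succ]
  step N D k ε h := by
    have : kappaBIII q Q N (insert k D) ε =
        downVec (-(q ^ D.card * Q⁻¹)) (ε k) * kappaBIII q Q N D ε := by
      rw [kappaBIII, prod_numR_insert h (fun n k => downVec (-(q ^ (n - 1) * Q⁻¹)) (ε k)), kappaBIII,
        Nat.add_sub_cancel]
    rw [this]
    cases ε k <;> simp [downVec, upVec]

/-- The weight of a remaining down arrow for type BIII. -/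
def wBIII (q : K) (p r : ℕ) : K := (qint q (r + p))⁻¹

theorem IsMatching.psiBIII_eq (h : IsMatching b S U D) (hn : ∀ n : ℕ, 1 ≤ n → qint q n ≠ 0) :
    psiBIII q Q b = arcWeight q S * upWeight q S U * downWeight (wBIII q) S D *
      (qfact q (U.card + S.card + D.card) * ∏ i ∈ range (U.card + S.card), sym (Q * q ^ i)) := by
  rw [psiBIII, h.arcs_eq, h.ups_eq, h.downs_eq, h.prod_numL_eq hn subset_rfl, prod_Icc_one,
    ← arcWeight, downWeight]
  simp only [h.numR_lefts_union subset_rfl, Nat.add_sub_cancel, wBIII]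
  ring

theorem psiBIII_nil (b : Fin 0 → Bool) (hn : ∀ n : ℕ, 1 ≤ n → qint q n ≠ 0) :
    psiBIII q Q b = 1 := by
  have h := isMatching b
  have h1 : downs b = ∅ := by ext k; exact k.elim0
  have h2 : ups b = ∅ := by ext k; exact k.elim0
  have h3 : arcs b = ∅ := by ext k; exact k.1.elim0
  rw [h.psiBIII_eq hn, h1, h2, h3]
  simp [arcWeight, upWeight, downWeight, qfact]

theorem psiBIII_cons_false (hn : ∀ n : ℕ, 1 ≤ n → qint q n ≠ 0) (b : Fin N → Bool) :
    psiBIII q Q (Fin.cons false b : Fin (N + 1) → Bool) = psiBIII q Q b := by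
  have h := isMatching b
  rw [h.psiBIII_eq hn]
  rcases (ups b).eq_empty_or_nonempty with hU | hU
  · rw [hU] at h ⊢
    rw [h.cons_false_of_empty.psiBIII_eq hn, downWeight_cons_false_empty, arcWeight_shiftArcs,
      card_shiftArcs, card_insert_of_notMem zero_notMem_shiftSet, card_shiftSet, card_empty,
      zero_add, ← add_assoc, qfact_succ, wBIII, upWeight, upWeight, prod_empty, prod_empty]
    have := hn ((arcs b).card + (downs b).card + 1) (by omega)
    rw [← add_assoc, card_empty, zero_add]
    field_simp
  · have hk := (ups b).min'_mem hU
    have hmin : ∀ l ∈ ups b, (ups b).min' hU ≤ l := fun l hl => min'_le _ l hl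
    generalize (ups b).min' hU = k at hk hmin
    rw [(h.cons_false_of_first hk hmin).psiBIII_eq hn, downWeight_cons_false,
      h.arcWeight_mul_upWeight_cons_false hk hmin, card_insert_of_notMem (zero_pair_notMem k),
      card_shiftArcs, card_shiftSet, card_shiftSet,
      show ((ups b).erase k).card + ((arcs b).card + 1) = (ups b).card + (arcs b).card by
        rw [card_erase_of_mem hk]; have := card_pos.2 hU; omega]

theorem identity_BIII (hq : q ≠ 0) (hQ : Q ≠ 0) (hn : ∀ n : ℕ, 1 ≤ n → qint q n ≠ 0)
    (u l r d : ℕ) :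
    q ^ (u + d + 2 * (l + r)) * Q + q⁻¹ ^ u * (q ^ d * Q⁻¹) +
      q⁻¹ ^ (u + 1) * (sym (Q * q ^ (u + (l + r))) * qint q (r + d) *
        (qint q (u + l + 1))⁻¹) =
    qint q (u + (l + r) + d + 1) * sym (Q * q ^ (u + (l + r))) *
      (q ^ l * (qint q (u + l + 1))⁻¹) := by
  have h1 := hn (u + l + 1) (by omega)
  have e := qint_add hq (u + l + 1) (r + d)
  rw [show u + l + 1 + (r + d) = u + (l + r) + d + 1 by ring] at e
  rw [e, sym]
  generalize qint q (u + l + 1) = X at *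
  generalize qint q (r + d) = Y at *
  simp only [inv_pow, mul_inv, pow_add, pow_mul, pow_one]
  field_simp
  ring

theorem psiBIII_cons_true (hq : q ≠ 0) (hQ : Q ≠ 0) (hn : ∀ n : ℕ, 1 ≤ n → qint q n ≠ 0)
    (f : Fin N → Bool) :
    psiBIII q Q (Fin.cons true f : Fin (N + 1) → Bool) =
      q ^ N * Q * psiBIII q Q f +
      ∑ A ∈ outerLeft (arcs f) (downs f), q⁻¹ ^ (((ups f).filter fun m => m < A.1).card + 1) *
        psiBIII q Q (Function.update f A.1 true) +
      ∑ k ∈ firstOf (downs f), q⁻¹ ^ ((ups f).card + 1) * psiBIII q Q (Function.update f k true) +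
      q⁻¹ ^ (ups f).card * (q ^ (downs f).card * Q⁻¹) * psiBIII q Q f +
      ∑ k ∈ lastOf (ups f), q⁻¹ ^ ((ups f).card - 1) * 0 *
        psiBIII q Q (Function.update f k false) := by
  have h := isMatching f
  have hlen := h.length_eq
  generalize arcs f = S at *
  generalize ups f = U at *
  generalize downs f = D at *
  set Θ : K := qfact q (U.card + S.card + D.card) *
    ∏ i ∈ range (U.card + S.card), sym (Q * q ^ i) with hΘ
  set Θ' : K := Θ * (qint q (U.card + S.card + D.card + 1) * sym (Q * q ^ (U.card + S.card)))
    with hΘ'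
  have hplus : psiBIII q Q (Fin.cons true f : Fin (N + 1) → Bool) =
      arcWeight q S * mixedWeight q S U 0 * downWeight (wBIII q) S D * Θ' := by
    rw [h.shift'.psiBIII_eq hn, arcWeight_shiftArcs, upWeight_shift, downWeight_shift,
      card_insert_of_notMem zero_notMem_shiftSet, card_shiftSet, card_shiftSet, card_shiftArcs,
      qint_one hq, show U.card + 1 + S.card = U.card + S.card + 1 by ring,
      show U.card + S.card + 1 + D.card = U.card + S.card + D.card + 1 by ring, qfact_succ,
      prod_range_succ, hΘ', hΘ]
    ring
  have hsplit : ∑ A ∈ outerLeft S D, q⁻¹ ^ ((U.filter fun m => m < A.1).card + 1) *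
        psiBIII q Q (Function.update f A.1 true) =
      arcWeight q S * (mixedWeight q S U 0 - q ^ arcsLeft S D *
        (qint q (U.card + arcsLeft S D + 1))⁻¹ * upWeight q S U) *
        (downWeight (wBIII q) S D * Θ') := by
    rw [← h.sum_split hq hn, sum_mul]
    refine sum_congr rfl ?_
    rintro ⟨i, j⟩ hA
    simp only [outerLeft, mem_filter] at hA
    obtain ⟨hij, ho, hD⟩ := hA
    have hlt := h.lt _ _ hij
    have hi' : i ∉ insert j U := by simp [h.fst_notMem_up hij, hlt.ne]
    have hS := card_erase_add_one hij
    rw [(h.split hij (fun i' j' h' => ho _ h') hD).psiBIII_eq hn,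
      downWeight_split (fun k hk => hlt.trans (hD k hk)), card_insert_of_notMem hi',
      card_insert_of_notMem (h.snd_notMem_up hij),
      show U.card + 1 + 1 + (S.erase (i, j)).card = U.card + S.card + 1 by omega,
      show U.card + S.card + 1 + D.card = U.card + S.card + D.card + 1 by ring, qfact_succ,
      prod_range_succ, hΘ', hΘ]
    ring
  rw [hplus, hsplit, h.psiBIII_eq hn]
  simp only [mul_zero, zero_mul, sum_const_zero, add_zero]
  have hlen' : N = U.card + D.card + 2 * S.card := hlen
  rcases firstOf_cases D with ⟨hD, hf⟩ | ⟨k, hk, hmin, hf⟩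
  · rw [hf, sum_empty, hD, arcsLeft_empty]
    subst hD
    have key := identity_BIII hq hQ hn U.card S.card 0 0
    rw [card_empty] at *
    simp only [add_zero, qint_zero, mul_zero, zero_mul, pow_zero, one_mul] at key hlen' hΘ hΘ' ⊢
    rw [← hlen'] at key
    rw [← hΘ, hΘ']
    linear_combination (-(arcWeight q S * upWeight q S U * downWeight (wBIII q) S ∅ * Θ)) * key
  · have hr := rho_first (S := S) hk hmin
    have key := identity_BIII hq hQ hn U.card (arcsLeft S D) (rho S k) D.card
    rw [hf, sum_singleton, (h.promote hk hmin).psiBIII_eq hn, h.upWeight_promote hk,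
      arcsLT_first hk hmin, downWeight_erase_first hk hmin, card_insert_of_notMem
        (fun hk' => lt_irrefl _ (h.up_lt_down k hk' k hk)), card_erase_of_mem hk]
    have hd : 1 ≤ D.card := card_pos.2 ⟨k, hk⟩
    rw [show U.card + 1 + S.card + (D.card - 1) = U.card + S.card + D.card by omega,
      show U.card + 1 + S.card = U.card + S.card + 1 by ring, prod_range_succ, ← mul_assoc
        (qfact _ _), ← hΘ, hΘ']
    rw [show arcsLeft S D + rho S k = S.card by omega, ← hlen'] at key
    have hw : wBIII q D.card (rho S k) * qint q (rho S k + D.card) = 1 :=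
      inv_mul_cancel₀ (hn _ (by omega))
    linear_combination (-(arcWeight q S * upWeight q S U * wBIII q D.card (rho S k) *
      downWeight (wBIII q) S (D.erase k) * Θ)) * key + (arcWeight q S * upWeight q S U *
      downWeight (wBIII q) S (D.erase k) * Θ * q⁻¹ ^ (U.card + 1) *
      sym (Q * q ^ (U.card + S.card)) * (qint q (U.card + arcsLeft S D + 1))⁻¹) * hw

theorem PsiBIII_eq_PsiStd (hq : q ≠ 0) (hQ : Q ≠ 0) (hn : ∀ n : ℕ, 1 ≤ n → qint q n ≠ 0) :
    PsiBIII N q Q = PsiStd N q Q :=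
  sum_genKet_eq_PsiStd isDownSystem_BIII (fun _ b => psiBIII q Q b) (fun b => psiBIII_nil b hn)
    (fun _ b => psiBIII_cons_false hn b) (fun _ f => psiBIII_cons_true hq hQ hn f) N

end BIII

section NumberFilters

variable {N : ℕ}

theorem numR_filter_numR (D : Finset (Fin N)) (p : ℕ → Prop) [DecidablePred p] (k : Fin N) :
    numR (D.filter fun l => p (numR D l)) k = ((Icc 1 (numR D k)).filter p).card := by
  have h1 : ∀ l ∈ D.filter (fun l => k ≤ l), numR D l = numR (D.filter fun l => k ≤ l) l := by
    intro l hl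
    rw [mem_filter] at hl
    rw [numR, numR, filter_filter]
    congr 1
    refine filter_congr fun m _ => ?_
    constructor
    · intro h; exact ⟨hl.2.trans h, h⟩
    · intro h; exact h.2
  rw [numR, filter_comm, filter_congr (q := fun l => p (numR (D.filter fun l => k ≤ l) l))
    (fun l hl => by rw [h1 l hl]), numR]
  rw [← image_numR (D.filter fun l => k ≤ l), filter_image, card_image_of_injOn]
  exact (numR_injOn _).mono (by intro x hx; exact (mem_filter.1 hx).1)

theorem card_filter_numR (D : Finset (Fin N)) (p : ℕ → Prop) [DecidablePred p] :
    (D.filter fun l => p (numR D l)).card = ((Icc 1 D.card).filter p).card := by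
  rw [← image_numR D, filter_image, card_image_of_injOn]
  exact (numR_injOn _).mono (by intro x hx; exact (mem_filter.1 hx).1)

theorem card_Icc_filter_even (n : ℕ) : ((Icc 1 n).filter Even).card = n / 2 := by
  induction n with
  | zero => simp
  | succ n ih =>
    rw [← insert_Icc_right_eq_Icc_add_one (by omega), filter_insert]
    split_ifs with h
    · rw [card_insert_of_notMem (by simp), ih]
      obtain ⟨m, hm⟩ := h; omega
    · rw [ih]
      rw [Nat.not_even_iff_odd] at h
      obtain ⟨m, hm⟩ := h; omega

theorem card_Icc_filter_odd (n : ℕ) : ((Icc 1 n).filter Odd).card = (n + 1) / 2 := by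
  have h := card_filter_add_card_filter_not (s := Icc 1 n) Even
  rw [card_Icc_filter_even, Nat.card_Icc] at h
  rw [filter_congr (fun x _ => Nat.not_even_iff_odd (n := x))] at h
  omega

end NumberFilters

section BII

variable {K : Type*} [Field K] {N : ℕ} {q Q : K} {b : Fin N → Bool}
  {S : Finset (Fin N × Fin N)} {U D : Finset (Fin N)}

/-- The vectors of the remaining down arrows for type BII. -/
def kappaBII (q Q : K) (N : ℕ) (D : Finset (Fin N)) (ε : Fin N → Bool) : K :=
  ∏ k ∈ D, downVec (if Odd (numR D k) then -Q⁻¹ else q⁻¹ * Q) (ε k)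

theorem ketBII_eq : ketBII q Q b = genKet q (kappaBII q Q N) b := by
  ext ε
  rw [ketBII, genKet, kappaBII, mul_assoc]
  congr 1
  simp only [apply_ite (downVec (K := K)), ite_apply]
  rw [prod_ite, oDowns, eDowns]
  simp only [Nat.not_odd_iff_even, downNum]
  congr!

/-- The coefficient of `v₁ ⊗ κ D` in the expansion of `v₋₁ ⊗ κ D` for type BII. -/
def gammaBII (q Q : K) (d : ℕ) : K := if Even d then Q⁻¹ else -(q⁻¹ * Q)

theorem isDownSystem_BII : IsDownSystem q (kappaBII q Q) (gammaBII q Q) fun _ => 0 where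
  nil ε := by simp [kappaBII]
  shift N D x ε := by
    rw [kappaBII, kappaBII, ← shiftSet, prod_shiftSet]
    simp only [numR_shift, Fin.cons_succ]
  step N D k ε h := by
    have : kappaBII q Q N (insert k D) ε =
        downVec (-gammaBII q Q D.card) (ε k) * kappaBII q Q N D ε := by
      rw [kappaBII, prod_numR_insert h
        (fun n k => downVec (if Odd n then -Q⁻¹ else q⁻¹ * Q) (ε k)), kappaBII, gammaBII]
      congr 2
      simp only [Nat.odd_add_one, Nat.not_odd_iff_even]
      split_ifs <;> simp
    rw [this]
    cases ε k <;> simp [downVec, upVec]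

/-- The weight of a remaining down arrow for type BII. -/
def wBII (q : K) (p r : ℕ) : K := if Even p then (qint q (r + p / 2))⁻¹ else 1

/-- The numbers of the o-unpaired down arrows in the enumeration from the right. -/
def oddNumbers (S : Finset (Fin N × Fin N)) (D : Finset (Fin N)) : Finset ℕ :=
  (D.filter fun k => Odd (numR D k)).image fun k => rho S k + (numR D k + 1) / 2

/-- The product over the arcs and the remaining up arrows for type BII. -/
def gapProd (q Q : K) (n : ℕ) (I : Finset ℕ) : K :=
  ∏ i ∈ Icc 1 n \ I, sym (q ^ (i - 1) * Q)

theorem gapProd_succ {n : ℕ} {I : Finset ℕ} (h : n + 1 ∉ I) :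
    gapProd q Q (n + 1) I = gapProd q Q n I * sym (q ^ n * Q) := by
  rw [gapProd, ← insert_Icc_right_eq_Icc_add_one (by omega), insert_sdiff_of_notMem _ h,
    prod_insert (by simp), mul_comm]
  rfl

theorem gapProd_succ_insert {n : ℕ} {I : Finset ℕ} :
    gapProd q Q (n + 1) (insert (n + 1) I) = gapProd q Q n I := by
  rw [gapProd, ← insert_Icc_right_eq_Icc_add_one (by omega), insert_sdiff_insert]
  rw [gapProd]
  refine prod_congr ?_ fun _ _ => rfl
  ext i
  simp only [mem_sdiff, mem_insert, mem_Icc]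
  constructor
  · rintro ⟨h1, h2⟩; exact ⟨h1, fun h => h2 (Or.inr h)⟩
  · rintro ⟨h1, h2⟩; exact ⟨h1, fun h => h.elim (fun h => by omega) h2⟩

theorem gapProd_insert {n x : ℕ} {I : Finset ℕ} (hx : x ∈ Icc 1 n) (hI : x ∉ I) :
    gapProd q Q n I = gapProd q Q n (insert x I) * sym (q ^ (x - 1) * Q) := by
  rw [gapProd, gapProd, sdiff_insert, mul_comm,
    mul_prod_erase _ (fun i => sym (q ^ (i - 1) * Q)) (mem_sdiff.2 ⟨hx, hI⟩)]

theorem numR_le_card (D : Finset (Fin N)) (k : Fin N) : numR D k ≤ D.card := card_filter_le _ _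

theorem rho_le_card (S : Finset (Fin N × Fin N)) (k : Fin N) : rho S k ≤ S.card :=
  card_filter_le _ _

theorem rho_anti (S : Finset (Fin N × Fin N)) {k l : Fin N} (h : k ≤ l) : rho S l ≤ rho S k :=
  card_le_card fun A hA => by simp only [mem_filter] at hA ⊢; exact ⟨hA.1, h.trans hA.2⟩

theorem le_of_mem_oddNumbers {i : ℕ} (h : i ∈ oddNumbers S D) :
    i ≤ S.card + (D.card + 1) / 2 := by
  rw [oddNumbers, mem_image] at h
  obtain ⟨k, -, rfl⟩ := h
  have := numR_le_card D k
  have := rho_le_card S k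
  omega

theorem oddNumbers_congr {S' : Finset (Fin N × Fin N)} (h : ∀ k ∈ D, rho S k = rho S' k) :
    oddNumbers S D = oddNumbers S' D :=
  image_congr fun k hk => by simp only [h k (mem_filter.1 hk).1]

theorem oddNumbers_shift : oddNumbers (shiftArcs S) (shiftSet D) = oddNumbers S D := by
  rw [oddNumbers, oddNumbers]
  conv_lhs => rw [show shiftSet D = D.image Fin.succ from rfl, filter_image, image_image]
  rw [← shiftSet]
  simp only [Function.comp_def, rho_shift, numR_shift]

theorem oddNumbers_insert {k : Fin N} (h : ∀ l ∈ D, k < l) :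
    oddNumbers S (insert k D) = if Even D.card then
      insert (rho S k + (D.card + 2) / 2) (oddNumbers S D) else oddNumbers S D := by
  have e : (D.filter fun l => Odd (numR (insert k D) l)) = D.filter fun l => Odd (numR D l) :=
    filter_congr fun l hl => by rw [numR_insert_of_lt (h l hl)]
  have e2 : ((D.filter fun l => Odd (numR D l)).image fun l =>
      rho S l + (numR (insert k D) l + 1) / 2) = oddNumbers S D :=
    image_congr fun l hl => by simp only [numR_insert_of_lt (h l (mem_filter.1 hl).1)]
  rw [oddNumbers, filter_insert, numR_insert_self h, e]
  simp only [Nat.odd_add_one, Nat.not_odd_iff_even]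
  split_ifs with h1
  · rw [image_insert, numR_insert_self h, e2]
  · exact e2

theorem IsMatching.psiBII_eq (h : IsMatching b S U D) (hn : ∀ n : ℕ, 1 ≤ n → qint q n ≠ 0) :
    psiBII q Q b = arcWeight q S * upWeight q S U * downWeight (wBII q) S D *
      (qfact q (U.card + S.card + D.card / 2) *
        gapProd q Q (U.card + S.card + (D.card + 1) / 2) (oddNumbers S D)) := by
  have he : eDowns b = D.filter fun k => Even (numR D k) := by
    rw [eDowns, h.downs_eq]; simp only [downNum, h.downs_eq]
  have ho : oDowns b = D.filter fun k => Odd (numR D k) := by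
    rw [oDowns, h.downs_eq]; simp only [downNum, h.downs_eq]
  have hes : (D.filter fun k => Even (numR D k)) ⊆ D := filter_subset _ _
  have hos : (D.filter fun k => Odd (numR D k)) ⊆ D := filter_subset _ _
  rw [psiBII, h.arcs_eq, h.ups_eq, he, ho, h.prod_numL_eq hn hes, ← arcWeight,
    card_filter_numR D Even, card_Icc_filter_even]
  have h1 : ∏ k ∈ D.filter (fun k => Even (numR D k)),
      (qint q (numR (lefts S ∪ D.filter fun k => Even (numR D k)) k))⁻¹ =
      downWeight (wBII q) S D := by
    rw [downWeight]
    simp only [wBII]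
    rw [prod_ite, prod_const_one, mul_one]
    simp only [h.numR_lefts_union hes, numR_filter_numR D Even, card_Icc_filter_even]
  have hU : ∀ k ∈ lefts S ∪ (D.filter fun k => Odd (numR D k)), k ∉ U := by
    intro k hk hk'
    rcases mem_union.1 hk with hk | hk
    · exact disjoint_left.1 h.disjoint_lefts_up hk hk'
    · exact disjoint_left.1 h.disjoint_up_down hk' (hos hk)
  have d1 : Disjoint (lefts S ∪ U) (D.filter fun k => Odd (numR D k)) := by
    rw [disjoint_union_left]
    exact ⟨h.disjoint_lefts_down.mono_right hos, h.disjoint_up_down.mono_right hos⟩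
  set X := lefts S ∪ U ∪ D.filter fun k => Odd (numR D k) with hX
  have hcard : X.card = U.card + S.card + (D.card + 1) / 2 := by
    rw [hX, card_union_of_disjoint d1, card_union_of_disjoint h.disjoint_lefts_up, h.card_lefts,
      card_filter_numR D Odd, card_Icc_filter_odd]
    omega
  have h2 : ∏ k ∈ lefts S ∪ U, sym (q ^ (numR X k - 1) * Q) =
      gapProd q Q (U.card + S.card + (D.card + 1) / 2) (oddNumbers S D) := by
    have e1 : lefts S ∪ U = X \ D.filter fun k => Odd (numR D k) := by
      rw [hX, union_sdiff_cancel_right d1]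
    have e2 : oddNumbers S D = (D.filter fun k => Odd (numR D k)).image (numR X) := by
      rw [oddNumbers]
      refine image_congr fun k hk => ?_
      have hk' : k ∈ D := (mem_filter.1 hk).1
      have : numR X k = numR (lefts S ∪ D.filter fun k => Odd (numR D k)) k := by
        rw [numR, numR, hX, union_right_comm, filter_union _ _ U,
          (filter_eq_empty_iff (s := U)).2, union_empty]
        intro l hl
        exact not_le.2 (h.up_lt_down l hl k hk')
      rw [this, h.numR_lefts_union hos, numR_filter_numR D Odd, card_Icc_filter_odd]
    rw [gapProd, ← hcard, ← image_numR X, e1, e2, ← image_sdiff_of_injOn (numR_injOn X)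
      (by rw [hX]; exact subset_union_right), prod_image]
    exact (numR_injOn X).mono (by intro x hx; exact (mem_sdiff.1 hx).1)
  rw [h1, h2]
  ring

theorem psiBII_nil (b : Fin 0 → Bool) (hn : ∀ n : ℕ, 1 ≤ n → qint q n ≠ 0) :
    psiBII q Q b = 1 := by
  have h := isMatching b
  have h1 : downs b = ∅ := by ext k; exact k.elim0
  have h2 : ups b = ∅ := by ext k; exact k.elim0
  have h3 : arcs b = ∅ := by ext k; exact k.1.elim0
  rw [h.psiBII_eq hn, h1, h2, h3]
  simp [arcWeight, upWeight, downWeight, qfact, gapProd]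

theorem oddNumbers_cons_false (k : Fin N) :
    oddNumbers (insert (0, k.succ) (shiftArcs S)) (shiftSet D) = oddNumbers S D := by
  rw [← oddNumbers_shift (S := S) (D := D)]
  refine oddNumbers_congr fun l hl => ?_
  rw [rho, filter_insert, if_neg, ← rho]
  exact not_le.2 (zero_lt_shiftSet l hl)

theorem psiBII_cons_false (hn : ∀ n : ℕ, 1 ≤ n → qint q n ≠ 0) (b : Fin N → Bool) :
    psiBII q Q (Fin.cons false b : Fin (N + 1) → Bool) = psiBII q Q b := by
  have h := isMatching b
  rw [h.psiBII_eq hn]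
  rcases (ups b).eq_empty_or_nonempty with hU | hU
  · rw [hU] at h ⊢
    have hr : rho (shiftArcs (arcs b)) 0 = (arcs b).card := by
      rw [rho, filter_true_of_mem (by simp), card_shiftArcs]
    rw [h.cons_false_of_empty.psiBII_eq hn, downWeight_cons_false_empty, arcWeight_shiftArcs,
      card_shiftArcs, card_insert_of_notMem zero_notMem_shiftSet, card_shiftSet, card_empty,
      zero_add, oddNumbers_insert zero_lt_shiftSet, oddNumbers_shift, wBII, card_shiftSet, hr,
      upWeight, upWeight, prod_empty, prod_empty]
    simp only [Nat.even_add_one]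
    rcases Nat.even_or_odd (downs b).card with hd | hd
    · rw [if_neg (not_not.2 hd), if_pos hd]
      obtain ⟨m, hm⟩ := hd
      rw [show ((downs b).card + 1 + 1) / 2 = m + 1 by omega,
        ← add_assoc, gapProd_succ_insert,
        show ((downs b).card + 1) / 2 = m by omega, show (downs b).card / 2 = m by omega,
        card_empty, zero_add]
      ring
    · have hd' := Nat.not_even_iff_odd.2 hd
      rw [if_pos hd', if_neg hd']
      obtain ⟨m, hm⟩ := hd
      have := hn ((arcs b).card + m + 1) (by omega)
      rw [show ((downs b).card + 1 + 1) / 2 = m + 1 by omega,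
        show ((downs b).card + 1) / 2 = m + 1 by omega, ← add_assoc, qfact_succ,
        show (downs b).card / 2 = m by omega, card_empty, zero_add]
      rw [← add_assoc]
      field_simp
  · have hk := (ups b).min'_mem hU
    have hmin : ∀ l ∈ ups b, (ups b).min' hU ≤ l := fun l hl => min'_le _ l hl
    generalize (ups b).min' hU = k at hk hmin
    rw [(h.cons_false_of_first hk hmin).psiBII_eq hn, downWeight_cons_false,
      h.arcWeight_mul_upWeight_cons_false hk hmin, card_insert_of_notMem (zero_pair_notMem k),
      card_shiftArcs, card_shiftSet, card_shiftSet, oddNumbers_cons_false,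
      show ((ups b).erase k).card + ((arcs b).card + 1) = (ups b).card + (arcs b).card by
        rw [card_erase_of_mem hk]; have := card_pos.2 hU; omega]

theorem identity_BII_even (hq : q ≠ 0) (hQ : Q ≠ 0) (hn : ∀ n : ℕ, 1 ≤ n → qint q n ≠ 0)
    (u l r m : ℕ) :
    q ^ (u + 2 * m + 2 * (l + r)) * Q + q⁻¹ ^ u * Q⁻¹ +
      q⁻¹ ^ (u + 1) * (sym (q ^ (u + (l + r) + m) * Q) * qint q (r + m) *
        (qint q (u + l + 1))⁻¹) =
    qint q (u + (l + r) + m + 1) * sym (q ^ (u + (l + r) + m) * Q) *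
      (q ^ l * (qint q (u + l + 1))⁻¹) := by
  have h1 := hn (u + l + 1) (by omega)
  have e := qint_add hq (u + l + 1) (r + m)
  rw [show u + l + 1 + (r + m) = u + (l + r) + m + 1 by ring] at e
  rw [e, sym]
  generalize qint q (u + l + 1) = X at *
  generalize qint q (r + m) = Y at *
  simp only [inv_pow, mul_inv, pow_add, pow_mul, pow_one]
  field_simp
  ring

theorem identity_BII_odd (hq : q ≠ 0) (hQ : Q ≠ 0) (hn : ∀ n : ℕ, 1 ≤ n → qint q n ≠ 0)
    (u l r m : ℕ) :
    q ^ (u + (2 * m + 1) + 2 * (l + r)) * Q + q⁻¹ ^ u * (-(q⁻¹ * Q)) +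
      q⁻¹ ^ (u + 1) * (sym (q ^ (r + m) * Q) * qint q (u + (l + r) + m + 1) *
        (qint q (u + l + 1))⁻¹) =
    qint q (u + (l + r) + m + 1) * sym (q ^ (u + (l + r) + (m + 1)) * Q) *
      (q ^ l * (qint q (u + l + 1))⁻¹) := by
  have h1 := hn (u + l + 1) (by omega)
  have e1 := sub_inv_mul_qint hq (u + l + 1)
  have e2 := sub_inv_mul_qint hq (u + (l + r) + m + 1)
  rw [sym, sym]
  generalize qint q (u + l + 1) = X at *
  generalize qint q (u + (l + r) + m + 1) = Y at *
  have key : q ^ (u + l + 1) * (q ^ (u + (l + r) + m + 1) - q⁻¹ ^ (u + (l + r) + m + 1)) * X =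
      q ^ (u + l + 1) * (q ^ (u + l + 1) - q⁻¹ ^ (u + l + 1)) * Y := by
    rw [← e1, ← e2]; ring
  simp only [inv_pow, mul_inv, pow_add, pow_mul, pow_one] at key ⊢
  field_simp at key ⊢
  linear_combination (Q ^ 2 * q ^ r * q ^ m) * key

theorem psiBII_cons_true (hq : q ≠ 0) (hQ : Q ≠ 0) (hn : ∀ n : ℕ, 1 ≤ n → qint q n ≠ 0)
    (f : Fin N → Bool) :
    psiBII q Q (Fin.cons true f : Fin (N + 1) → Bool) =
      q ^ N * Q * psiBII q Q f +
      ∑ A ∈ outerLeft (arcs f) (downs f), q⁻¹ ^ (((ups f).filter fun m => m < A.1).card + 1) *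
        psiBII q Q (Function.update f A.1 true) +
      ∑ k ∈ firstOf (downs f), q⁻¹ ^ ((ups f).card + 1) * psiBII q Q (Function.update f k true) +
      q⁻¹ ^ (ups f).card * gammaBII q Q (downs f).card * psiBII q Q f +
      ∑ k ∈ lastOf (ups f), q⁻¹ ^ ((ups f).card - 1) * 0 *
        psiBII q Q (Function.update f k false) := by
  have h := isMatching f
  have hlen := h.length_eq
  generalize arcs f = S at *
  generalize ups f = U at *
  generalize downs f = D at *
  set Θ : K := qfact q (U.card + S.card + D.card / 2) *
    gapProd q Q (U.card + S.card + (D.card + 1) / 2) (oddNumbers S D) with hΘ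
  set Θ' : K := Θ * (qint q (U.card + S.card + D.card / 2 + 1) *
    sym (q ^ (U.card + S.card + (D.card + 1) / 2) * Q)) with hΘ'
  have hmem : U.card + S.card + (D.card + 1) / 2 + 1 ∉ oddNumbers S D := by
    intro hm
    have := le_of_mem_oddNumbers hm
    omega
  have hplus : psiBII q Q (Fin.cons true f : Fin (N + 1) → Bool) =
      arcWeight q S * mixedWeight q S U 0 * downWeight (wBII q) S D * Θ' := by
    rw [h.shift'.psiBII_eq hn, arcWeight_shiftArcs, upWeight_shift, downWeight_shift,
      card_insert_of_notMem zero_notMem_shiftSet, card_shiftSet, card_shiftSet, card_shiftArcs,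
      qint_one hq, show U.card + 1 + S.card = U.card + S.card + 1 by ring, oddNumbers_shift,
      show U.card + S.card + 1 + D.card / 2 = U.card + S.card + D.card / 2 + 1 by ring,
      show U.card + S.card + 1 + (D.card + 1) / 2 = U.card + S.card + (D.card + 1) / 2 + 1 by ring,
      qfact_succ, gapProd_succ hmem, hΘ', hΘ]
    ring
  have hsplit : ∑ A ∈ outerLeft S D, q⁻¹ ^ ((U.filter fun m => m < A.1).card + 1) *
        psiBII q Q (Function.update f A.1 true) =
      arcWeight q S * (mixedWeight q S U 0 - q ^ arcsLeft S D *
        (qint q (U.card + arcsLeft S D + 1))⁻¹ * upWeight q S U) *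
        (downWeight (wBII q) S D * Θ') := by
    rw [← h.sum_split hq hn, sum_mul]
    refine sum_congr rfl ?_
    rintro ⟨i, j⟩ hA
    simp only [outerLeft, mem_filter] at hA
    obtain ⟨hij, ho, hD⟩ := hA
    have hlt := h.lt _ _ hij
    have hi' : i ∉ insert j U := by simp [h.fst_notMem_up hij, hlt.ne]
    have hS := card_erase_add_one hij
    have hodd : oddNumbers (S.erase (i, j)) D = oddNumbers S D := by
      refine oddNumbers_congr fun k hk => ?_
      rw [rho, filter_erase, erase_eq_of_notMem, ← rho]
      simp [hlt.trans (hD k hk)]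
    rw [(h.split hij (fun i' j' h' => ho _ h') hD).psiBII_eq hn,
      downWeight_split (fun k hk => hlt.trans (hD k hk)), card_insert_of_notMem hi',
      card_insert_of_notMem (h.snd_notMem_up hij), hodd,
      show U.card + 1 + 1 + (S.erase (i, j)).card = U.card + S.card + 1 by omega,
      show U.card + S.card + 1 + D.card / 2 = U.card + S.card + D.card / 2 + 1 by ring,
      show U.card + S.card + 1 + (D.card + 1) / 2 = U.card + S.card + (D.card + 1) / 2 + 1 by ring,
      qfact_succ, gapProd_succ hmem, hΘ', hΘ]
    ring
  rw [hplus, hsplit, h.psiBII_eq hn]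
  simp only [mul_zero, zero_mul, sum_const_zero, add_zero]
  rcases firstOf_cases D with ⟨hD, hf⟩ | ⟨k, hk, hmin, hf⟩
  · rw [hf, sum_empty, hD, arcsLeft_empty]
    subst hD
    have key := identity_BII_even hq hQ hn U.card S.card 0 0
    have hg : gammaBII q Q (∅ : Finset (Fin N)).card = Q⁻¹ := by simp [gammaBII]
    rw [hg, ← hΘ]
    rw [card_empty] at *
    simp only [add_zero, qint_zero, mul_zero, zero_mul,
      show (0 + 1) / 2 = 0 from rfl] at key hlen hΘ' ⊢
    rw [← hlen] at key
    rw [hΘ']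
    linear_combination (-(arcWeight q S * upWeight q S U * downWeight (wBII q) S ∅ * Θ)) * key
  · have hr := rho_first (S := S) hk hmin
    have hkU : k ∉ U := fun hk' => lt_irrefl _ (h.up_lt_down k hk' k hk)
    have hlt : ∀ l ∈ D.erase k, k < l := by
      intro l hl
      rw [mem_erase] at hl
      exact lt_of_le_of_ne (hmin l hl.2) hl.1.symm
    have hD1 := card_erase_add_one hk
    have hodd := oddNumbers_insert (S := S) hlt
    rw [insert_erase hk] at hodd
    rw [hf, sum_singleton, (h.promote hk hmin).psiBII_eq hn, h.upWeight_promote hk,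
      arcsLT_first hk hmin, downWeight_erase_first hk hmin, card_insert_of_notMem hkU, ← hΘ, hΘ']
    rcases Nat.even_or_odd D.card with hd | hd
    · have hd' : ¬ Even (D.erase k).card := by
        rw [← hD1, Nat.even_add_one] at hd; exact hd
      rw [if_neg hd'] at hodd
      have hg : gammaBII q Q D.card = Q⁻¹ := by rw [gammaBII, if_pos hd]
      have hw : wBII q D.card (rho S k) * qint q (rho S k + D.card / 2) = 1 := by
        rw [wBII, if_pos hd]
        refine inv_mul_cancel₀ (hn _ ?_)
        obtain ⟨m, hm⟩ := hd; omega
      obtain ⟨m, hm⟩ := hd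
      have key := identity_BII_even hq hQ hn U.card (arcsLeft S D) (rho S k) m
      rw [hg, ← hodd, show U.card + 1 + S.card + (D.erase k).card / 2 =
        U.card + S.card + D.card / 2 by omega,
        show U.card + 1 + S.card + ((D.erase k).card + 1) / 2 =
          U.card + S.card + (D.card + 1) / 2 + 1 by omega, gapProd_succ hmem,
        ← mul_assoc (qfact _ _), ← hΘ]
      rw [show arcsLeft S D + rho S k = S.card by omega,
        show U.card + 2 * m + 2 * S.card = N by omega] at key
      rw [show (D.card + 1) / 2 = m by omega]
      rw [show D.card / 2 = m by omega] at hw ⊢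
      linear_combination (-(arcWeight q S * upWeight q S U * wBII q D.card (rho S k) *
        downWeight (wBII q) S (D.erase k) * Θ)) * key + (arcWeight q S * upWeight q S U *
        downWeight (wBII q) S (D.erase k) * Θ * q⁻¹ ^ (U.card + 1) *
        sym (q ^ (U.card + S.card + m) * Q) * (qint q (U.card + arcsLeft S D + 1))⁻¹) * hw
    · have hd' : Even (D.erase k).card := by
        rw [← hD1, Nat.odd_add_one] at hd; exact Nat.not_odd_iff_even.1 hd
      have hdn := Nat.not_even_iff_odd.2 hd
      rw [if_pos hd'] at hodd
      have hg : gammaBII q Q D.card = -(q⁻¹ * Q) := by rw [gammaBII, if_neg hdn]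
      have hw : wBII q D.card (rho S k) = 1 := by rw [wBII, if_neg hdn]
      obtain ⟨m, hm⟩ := hd
      have key := identity_BII_odd hq hQ hn U.card (arcsLeft S D) (rho S k) m
      have hx : rho S k + ((D.erase k).card + 2) / 2 = rho S k + m + 1 := by omega
      rw [hx] at hodd
      have hmem' : rho S k + m + 1 ∉ oddNumbers S (D.erase k) := by
        intro hx
        rw [oddNumbers, mem_image] at hx
        obtain ⟨l, hl, hl'⟩ := hx
        have h1 := (mem_filter.1 hl).1
        have := rho_anti S (hlt l h1).le
        have := numR_le_card (D.erase k) l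
        omega
      have hgap := gapProd_insert (q := q) (Q := Q) (n := U.card + S.card + (m + 1))
        (x := rho S k + m + 1) (by rw [mem_Icc]; omega) hmem'
      rw [← hodd, Nat.add_sub_cancel] at hgap
      have hΘ2 : Θ = qfact q (U.card + S.card + m) *
          gapProd q Q (U.card + S.card + (m + 1)) (oddNumbers S D) := by
        rw [hΘ, show D.card / 2 = m by omega, show (D.card + 1) / 2 = m + 1 by omega]
      rw [hg, hw, show U.card + 1 + S.card + (D.erase k).card / 2 =
        U.card + S.card + m + 1 by omega,
        show U.card + 1 + S.card + ((D.erase k).card + 1) / 2 =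
          U.card + S.card + (m + 1) by omega, hgap, qfact_succ]
      rw [show arcsLeft S D + rho S k = S.card by omega,
        show U.card + (2 * m + 1) + 2 * S.card = N by omega] at key
      rw [show (D.card + 1) / 2 = m + 1 by omega, show D.card / 2 = m by omega, hΘ2]
      linear_combination (-(arcWeight q S * upWeight q S U *
        downWeight (wBII q) S (D.erase k) * (qfact q (U.card + S.card + m) *
          gapProd q Q (U.card + S.card + (m + 1)) (oddNumbers S D)))) * key

theorem PsiBII_eq_PsiStd (hq : q ≠ 0) (hQ : Q ≠ 0) (hn : ∀ n : ℕ, 1 ≤ n → qint q n ≠ 0) :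
    PsiBII N q Q = PsiStd N q Q := by
  rw [PsiBII, sum_congr rfl (fun b _ => by rw [ketBII_eq])]
  exact sum_genKet_eq_PsiStd isDownSystem_BII (fun _ b => psiBII q Q b) (fun b => psiBII_nil b hn)
    (fun _ b => psiBII_cons_false hn b) (fun _ f => psiBII_cons_true hq hQ hn f) N

end BII

section BIWeights

variable {K : Type*} [Field K] {N : ℕ} {q : K} {M : ℕ} {b : Fin N → Bool}
  {S : Finset (Fin N × Fin N)} {U D : Finset (Fin N)}

/-- The weight of a remaining down arrow for type BI. -/
def wBI (q : K) (M p r : ℕ) : K :=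
  if p < M then (qint q (r + p))⁻¹
  else if Even (p - M) then (qint q (2 * (r + M + (p - M) / 2)))⁻¹ else 1

/-- The factor of an outer arc for type BI. -/
def zeta (q : K) (M : ℕ) (A : Fin N × Fin N) : K :=
  qint q (BI.d₃ A + size A + M) / qint q (BI.d₃ A + 2 * size A + M)

/-- The number of elements of `D` right of an arc. -/
def rightDowns (D : Finset (Fin N)) (A : Fin N × Fin N) : ℕ := (D.filter fun k => A.2 < k).card

/-- There are at least `M` remaining down arrows, and none of them is unpaired. -/
def IsPairedOff (M d : ℕ) : Prop := M ≤ d ∧ Even (d - M)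

instance (M d : ℕ) : Decidable (IsPairedOff M d) := inferInstanceAs (Decidable (_ ∧ _))

/-- The outer arcs right of some remaining down arrow that are left of the star and inside no
dashed arc. -/
def staticArcs (M : ℕ) (S : Finset (Fin N × Fin N)) (D : Finset (Fin N)) :
    Finset (Fin N × Fin N) :=
  S.filter fun A => (∀ B ∈ S, ¬(B.1 < A.1 ∧ A.2 < B.2)) ∧ (∃ k ∈ D, k < A.1) ∧
    IsPairedOff M (rightDowns D A)

/-- The contribution of the outer arcs right of some remaining down arrow. -/
def zStatic (q : K) (M : ℕ) (S : Finset (Fin N × Fin N)) (D : Finset (Fin N)) : K :=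
  ∏ A ∈ staticArcs M S D, zeta q M A

/-- The contribution of the outer arcs between the remaining up arrows and the remaining down
arrows. -/
def zLast (q : K) (M : ℕ) (S : Finset (Fin N × Fin N)) (U D : Finset (Fin N)) : K :=
  ∏ A ∈ (outerLeft S D).filter (fun A => ∀ k ∈ U, k < A.1), zeta q M A

/-- The number of arcs left of some remaining up arrow. -/
def arcsBeforeUp (S : Finset (Fin N × Fin N)) (U : Finset (Fin N)) : ℕ :=
  (S.filter fun A => ∃ k ∈ U, A.1 < k).card

/-- The contribution of the arrows left of all remaining down arrows. -/
def zMoving (q : K) (M : ℕ) (S : Finset (Fin N × Fin N)) (U D : Finset (Fin N)) : K :=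
  if IsPairedOff M D.card then zLast q M S U D * qint q (N + M - arcsBeforeUp S U) else 1

/-- The number of dashed arcs and unpaired down arrows. -/
def tau (M d : ℕ) : ℕ := (d - M + 1) / 2

/-- The contribution of the numbers of arcs and arrows for type BI. -/
def thetaBI (q : K) (M r m : ℕ) : K := qfact q (r + m) * ∏ i ∈ range r, sym (q ^ (M + i))

theorem zeta_succ (A : Fin N × Fin N) : zeta q M (A.1.succ, A.2.succ) = zeta q M A := by
  obtain ⟨i, j⟩ := A
  have : BI.d₃ (i.succ, j.succ) = BI.d₃ (i, j) := by
    simp only [BI.d₃, pos, Fin.val_succ]; omega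
  rw [zeta, size_succ, this, zeta]

theorem forall_shiftArcs_outside (A : Fin N × Fin N) :
    (∀ B ∈ shiftArcs S, ¬(B.1 < A.1.succ ∧ A.2.succ < B.2)) ↔
      ∀ B ∈ S, ¬(B.1 < A.1 ∧ A.2 < B.2) := by
  rw [shiftArcs, forall_mem_image]
  simp only [Fin.succ_lt_succ_iff]

theorem forall_shiftSet_lt (k : Fin N) : (∀ l ∈ shiftSet D, k.succ < l) ↔ ∀ l ∈ D, k < l := by
  rw [shiftSet, forall_mem_image]
  simp only [Fin.succ_lt_succ_iff]

theorem exists_shiftSet_lt (k : Fin N) : (∃ l ∈ shiftSet D, l < k.succ) ↔ ∃ l ∈ D, l < k := by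
  rw [shiftSet, exists_mem_image]
  simp only [Fin.succ_lt_succ_iff]

theorem outerLeft_shift :
    outerLeft (shiftArcs S) (shiftSet D) = shiftArcs (outerLeft S D) := by
  rw [outerLeft, shiftArcs, filter_image, shiftArcs, outerLeft]
  congr 1
  refine filter_congr fun A _ => ?_
  rw [← shiftArcs, forall_shiftArcs_outside, forall_shiftSet_lt]

theorem zLast_shift : zLast q M (shiftArcs S) (shiftSet U) (shiftSet D) = zLast q M S U D := by
  rw [zLast, outerLeft_shift, zLast, prod_filter, prod_filter, prod_shiftArcs]
  refine prod_congr rfl fun A _ => ?_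
  rw [zeta_succ]
  simp [shiftSet]

theorem zLast_shift_insert_zero :
    zLast q M (shiftArcs S) (insert 0 (shiftSet U)) (shiftSet D) = zLast q M S U D := by
  rw [← zLast_shift (S := S) (U := U) (D := D), zLast, zLast]
  refine prod_congr ?_ fun _ _ => rfl
  refine filter_congr fun A hA => ?_
  rw [outerLeft_shift, shiftArcs, mem_image] at hA
  obtain ⟨A, -, rfl⟩ := hA
  simp

theorem rightDowns_shift (A : Fin N × Fin N) :
    rightDowns (shiftSet D) (A.1.succ, A.2.succ) = rightDowns D A := by
  rw [rightDowns, shiftSet, filter_image, card_image_of_injective _ (Fin.succ_injective N),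
    rightDowns]
  simp

theorem zStatic_shift : zStatic q M (shiftArcs S) (shiftSet D) = zStatic q M S D := by
  rw [zStatic, zStatic, staticArcs, staticArcs, prod_filter, prod_filter, prod_shiftArcs]
  refine prod_congr rfl fun A _ => ?_
  rw [zeta_succ, rightDowns_shift]
  refine if_congr ?_ rfl rfl
  rw [forall_shiftArcs_outside, exists_shiftSet_lt]

theorem arcsBeforeUp_empty : arcsBeforeUp S ∅ = 0 := by simp [arcsBeforeUp]

theorem arcsBeforeUp_shift : arcsBeforeUp (shiftArcs S) (shiftSet U) = arcsBeforeUp S U := by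
  rw [arcsBeforeUp, shiftArcs, filter_image, card_image_of_injective _ shiftArcs_injective,
    arcsBeforeUp]
  simp [shiftSet]

theorem arcsBeforeUp_shift_insert_zero :
    arcsBeforeUp (shiftArcs S) (insert 0 (shiftSet U)) = arcsBeforeUp S U := by
  rw [← arcsBeforeUp_shift (S := S) (U := U), arcsBeforeUp, arcsBeforeUp]
  congr 1
  refine filter_congr fun A _ => ?_
  simp only [exists_mem_insert, Fin.not_lt_zero, false_or]

theorem arcsBeforeUp_of_last {k : Fin N} (hk : k ∈ U) (hmax : ∀ l ∈ U, l ≤ k) :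
    arcsBeforeUp S U = arcsLT S k := by
  rw [arcsBeforeUp, arcsLT]
  congr 1
  refine filter_congr fun A _ => ?_
  constructor
  · rintro ⟨l, hl, h⟩; exact lt_of_lt_of_le h (hmax l hl)
  · intro h; exact ⟨k, hk, h⟩

theorem zMoving_shift_insert_zero : zMoving q M (shiftArcs S) (insert 0 (shiftSet U)) (shiftSet D) =
    if IsPairedOff M D.card then zLast q M S U D * qint q (N + 1 + M - arcsBeforeUp S U) else 1 := by
  rw [zMoving, card_shiftSet, zLast_shift_insert_zero, arcsBeforeUp_shift_insert_zero]

theorem zStatic_congr {S' : Finset (Fin N × Fin N)}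
    (h : ∀ A : Fin N × Fin N, (∃ k ∈ D, k < A.1) → (A ∈ S ↔ A ∈ S'))
    (ho : ∀ A ∈ S, (∃ k ∈ D, k < A.1) →
      ((∀ B ∈ S, ¬(B.1 < A.1 ∧ A.2 < B.2)) ↔ ∀ B ∈ S', ¬(B.1 < A.1 ∧ A.2 < B.2))) :
    zStatic q M S D = zStatic q M S' D := by
  rw [zStatic, zStatic]
  refine prod_congr ?_ fun _ _ => rfl
  ext A
  simp only [staticArcs, mem_filter]
  constructor
  · rintro ⟨h1, h2, h3, h4⟩
    exact ⟨(h A h3).1 h1, (ho A h1 h3).1 h2, h3, h4⟩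
  · rintro ⟨h1, h2, h3, h4⟩
    have h1' := (h A h3).2 h1
    exact ⟨h1', (ho A h1' h3).2 h2, h3, h4⟩

theorem IsMatching.zStatic_split (h : IsMatching b S U D) {i j : Fin N}
    (hD : ∀ k ∈ D, j < k) (hij : i < j) : zStatic q M (S.erase (i, j)) D = zStatic q M S D := by
  symm
  apply zStatic_congr
  · rintro ⟨a, c⟩ ⟨k, hk, hka⟩
    have := hD k hk
    simp only at hka
    rw [mem_erase, and_iff_right]
    rintro h
    simp only [Prod.mk.injEq] at h
    grind
  · rintro ⟨a, c⟩ hA ⟨k, hk, hka⟩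
    have := hD k hk
    have := h.lt _ _ hA
    simp only at hka ⊢
    constructor
    · intro h1 B hB; exact h1 B (mem_of_mem_erase hB)
    · intro h1 B hB
      by_cases hB' : B = (i, j)
      · subst hB'; rintro ⟨h2, h3⟩; simp only at h2 h3; grind
      · exact h1 B (mem_erase.2 ⟨hB', hB⟩)

theorem IsMatching.zStatic_cons_false (h : IsMatching b S U D) {k : Fin N}
    (hk : k ∈ U) :
    zStatic q M (insert (0, k.succ) (shiftArcs S)) (shiftSet D) = zStatic q M S D := by
  rw [← zStatic_shift (S := S) (D := D)]
  symm
  have hD : ∀ l ∈ shiftSet D, k.succ < l := by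
    intro l hl
    rw [shiftSet, mem_image] at hl
    obtain ⟨l, hl, rfl⟩ := hl
    exact Fin.succ_lt_succ_iff.2 (h.up_lt_down k hk l hl)
  apply zStatic_congr
  · rintro ⟨a, c⟩ ⟨l, hl, hka⟩
    rw [mem_insert, or_iff_right]
    rintro h
    simp only [Prod.mk.injEq] at h
    rw [h.1] at hka
    exact absurd hka (Fin.not_lt_zero l)
  · rintro ⟨a, c⟩ hA ⟨l, hl, hka⟩
    have h1 := h.shift'.lt _ _ hA
    have h2 := hD l hl
    rw [forall_mem_insert, and_iff_right]
    simp only at hka ⊢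
    rintro ⟨-, h3⟩
    grind

theorem IsMatching.zStatic_insert (h : IsMatching b S U (insert k D)) (hk : ∀ l ∈ D, k < l) :
    zStatic q M S (insert k D) = zStatic q M S D *
      if IsPairedOff M D.card then zLast q M S (insert k U) D else 1 := by
  have hout := h.down_out k (mem_insert_self k D)
  have e1 : ∀ A ∈ S, k < A.1 → rightDowns (insert k D) A = rightDowns D A := by
    rintro ⟨a, c⟩ hA hka
    have := h.lt _ _ hA
    rw [rightDowns, filter_insert, if_neg, rightDowns]
    simp only at hka ⊢
    grind
  have e2 : staticArcs M S (insert k D) = staticArcs M S D ∪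
      if IsPairedOff M D.card then (outerLeft S D).filter (fun A => ∀ l ∈ insert k U, l < A.1)
      else ∅ := by
    ext ⟨a, c⟩
    simp only [staticArcs, mem_union, mem_filter]
    constructor
    · rintro ⟨h1, h2, ⟨l, hl, hla⟩, h4⟩
      have hka : k < a := by
        rcases mem_insert.1 hl with rfl | hl
        · exact hla
        · exact (hk l hl).trans hla
      rw [e1 _ h1 hka] at h4
      by_cases h5 : ∃ m ∈ D, m < a
      · exact Or.inl ⟨h1, h2, h5, h4⟩
      · right
        push Not at h5
        have h6 : ∀ m ∈ D, c < m := by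
          intro m hm
          have := h5 m hm
          have := h.down_out m (mem_insert_of_mem hm) a c h1
          grind
        have h7 : rightDowns D (a, c) = D.card := by
          rw [rightDowns, filter_true_of_mem h6]
        rw [h7] at h4
        rw [if_pos h4, mem_filter, outerLeft, mem_filter]
        refine ⟨⟨h1, h2, h6⟩, fun l hl => ?_⟩
        rcases mem_insert.1 hl with rfl | hl
        · exact hka
        · exact (h.up_lt_down l hl k (mem_insert_self k D)).trans hka
    · rintro (⟨h1, h2, ⟨l, hl, hla⟩, h4⟩ | h1)
      · refine ⟨h1, h2, ⟨l, mem_insert_of_mem hl, hla⟩, ?_⟩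
        rwa [e1 _ h1 ((hk l hl).trans hla)]
      · split_ifs at h1 with h2
        · rw [mem_filter, outerLeft, mem_filter] at h1
          obtain ⟨⟨h3, h4, h5⟩, h6⟩ := h1
          have hka := h6 k (mem_insert_self k U)
          refine ⟨h3, h4, ⟨k, mem_insert_self k D, hka⟩, ?_⟩
          rw [e1 _ h3 hka, rightDowns, filter_true_of_mem h5]
          exact h2
        · simp at h1
  rw [zStatic, e2, prod_union]
  · congr 1
    split_ifs <;> simp [zLast]
  · rw [disjoint_left]
    rintro ⟨a, c⟩ h1 h2
    split_ifs at h2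
    · simp only [staticArcs, mem_filter, outerLeft] at h1 h2
      obtain ⟨-, -, ⟨l, hl, hla⟩, -⟩ := h1
      have := h2.1.2.2 l hl
      have := h.lt _ _ h2.1.1
      grind
    · simp at h2

/-- The component of `Ψ` for type BI, as a function of the arcs, the remaining up arrows and the
remaining down arrows. -/
def cleanBI (q : K) (M : ℕ) (S : Finset (Fin N × Fin N)) (U D : Finset (Fin N)) : K :=
  arcWeight q S * upWeight q S U * downWeight (wBI q M) S D *
    (zStatic q M S D * thetaBI q M (U.card + S.card + tau M D.card) (min D.card (M - 1)) *
      zMoving q M S U D)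

theorem thetaBI_succ (r m : ℕ) : thetaBI q M (r + 1) m =
    thetaBI q M r m * (qint q (r + m + 1) * sym (q ^ (M + r))) := by
  rw [thetaBI, show r + 1 + m = r + m + 1 by ring, qfact_succ, prod_range_succ, thetaBI]; ring

theorem zLast_congr {S' : Finset (Fin N × Fin N)} {U' D' : Finset (Fin N)}
    (h : ∀ A, (A ∈ outerLeft S D ∧ ∀ k ∈ U, k < A.1) ↔ (A ∈ outerLeft S' D' ∧ ∀ k ∈ U', k < A.1)) :
    zLast q M S U D = zLast q M S' U' D' := by
  rw [zLast, zLast]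
  refine prod_congr ?_ fun _ _ => rfl
  ext A
  simp only [mem_filter, h]

theorem IsMatching.zMoving_cons_false (h : IsMatching b S U D)
    (hn : ∀ n : ℕ, 1 ≤ n → qint q n ≠ 0) {k : Fin N}
    (hk : k ∈ U) (hmin : ∀ l ∈ U, k ≤ l) :
    zMoving q M (insert (0, k.succ) (shiftArcs S)) (shiftSet (U.erase k)) (shiftSet D) =
      zMoving q M S U D := by
  rw [zMoving, zMoving, card_shiftSet]
  split_ifs with hc
  swap
  · rfl
  have hm := h.cons_false_of_first hk hmin
  have hD : ∀ l ∈ shiftSet D, k.succ < l := by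
    intro l hl
    rw [shiftSet, mem_image] at hl
    obtain ⟨l, hl, rfl⟩ := hl
    exact Fin.succ_lt_succ_iff.2 (h.up_lt_down k hk l hl)
  have hshift := zLast_shift (q := q) (M := M) (S := S) (U := U) (D := D)
  have hsub : ∀ A : Fin (N + 1) × Fin (N + 1), k.succ < A.1 →
      (A ∈ outerLeft (insert (0, k.succ) (shiftArcs S)) (shiftSet D) ↔
        A ∈ outerLeft (shiftArcs S) (shiftSet D)) := by
    rintro ⟨a, c⟩ hka
    simp only at hka
    simp only [outerLeft, mem_filter, mem_insert, Prod.mk.injEq, forall_eq_or_imp]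
    constructor
    · rintro ⟨⟨h1, -⟩ | h1, h2, h3⟩
      · subst h1; exact absurd hka (Fin.not_lt_zero _)
      · exact ⟨h1, h2.2, h3⟩
    · rintro ⟨h1, h2, h3⟩
      refine ⟨Or.inr h1, ⟨?_, h2⟩, h3⟩
      rintro ⟨-, h4⟩
      have := h.shift'.lt _ _ h1
      grind
  rcases (U.erase k).eq_empty_or_nonempty with hU | hU
  · have hU' : U = {k} := by rw [← insert_erase hk, hU]; rfl
    rw [hU]
    clear hmin hU
    subst hU'
    rw [show shiftSet (∅ : Finset (Fin N)) = ∅ from rfl, arcsBeforeUp_empty,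
      arcsBeforeUp_of_last (mem_singleton_self k) (by simp)]
    have hz : zLast q M (insert (0, k.succ) (shiftArcs S)) ∅ (shiftSet D) =
        zeta q M (0, k.succ) * zLast q M S {k} D := by
      rw [← hshift, zLast, zLast, ← prod_insert]
      · refine prod_congr ?_ fun _ _ => rfl
        ext ⟨a, c⟩
        simp only [mem_filter, mem_insert, notMem_empty, IsEmpty.forall_iff, implies_true, and_true]
        constructor
        · intro h1
          have h1' := h1
          rw [outerLeft, mem_filter] at h1
          rcases mem_insert.1 h1.1 with h2 | h2
          · exact Or.inl h2
          · right
            have h3 := h.shift'.up_out k.succ (by simp [shiftSet]) a c h2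
            have h4 := h1.2.1 _ (mem_insert_self _ _)
            have h5 : (0 : Fin (N + 1)) < a := by
              rw [shiftArcs, mem_image] at h2
              obtain ⟨A, -, hA⟩ := h2
              simp only [Prod.mk.injEq] at hA
              rw [← hA.1]; exact Fin.succ_pos _
            have h6 : k.succ < a := by grind
            exact ⟨(hsub (a, c) h6).1 h1', by simpa [shiftSet] using h6⟩
        · rintro (h1 | ⟨h1, h2⟩)
          · rw [h1, outerLeft, mem_filter]
            refine ⟨mem_insert_self _ _, ?_, hD⟩
            intro B _ hB
            exact absurd hB.1 (Fin.not_lt_zero _)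
          · exact (hsub (a, c) (h2 k.succ (by simp [shiftSet]))).2 h1
      · intro h1
        rw [mem_filter, outerLeft, mem_filter] at h1
        exact zero_pair_notMem k h1.1.1
    have hs := h.size_first hk (by simp)
    rw [h.nu_up hk, countLT_of_ge _ (by simp)] at hs
    have hcnt := h.first_count hk (by simp)
    have hkN := k.2
    have e1 : BI.d₃ ((0 : Fin (N + 1)), k.succ) + size ((0 : Fin (N + 1)), k.succ) + M =
        N + M - arcsLT S k := by
      rw [hs]; simp only [BI.d₃, pos, Fin.val_succ]; omega
    have e2 : BI.d₃ ((0 : Fin (N + 1)), k.succ) + 2 * size ((0 : Fin (N + 1)), k.succ) + M =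
        N + 1 + M - 0 := by
      rw [hs]; simp only [BI.d₃, pos, Fin.val_succ]; omega
    rw [hz, zeta, e1, e2]
    have := hn (N + 1 + M - 0) (by omega)
    field_simp
  · obtain ⟨l, hl, hmax⟩ : ∃ l ∈ U.erase k, ∀ m ∈ U.erase k, m ≤ l :=
      ⟨_, max'_mem _ hU, fun m hm => le_max' _ m hm⟩
    have hkl : k < l := by
      rw [mem_erase] at hl
      exact lt_of_le_of_ne (hmin l hl.2) hl.1.symm
    have hlU : l ∈ U := (mem_erase.1 hl).2
    have hmax' : ∀ m ∈ U, m ≤ l := by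
      intro m hm
      by_cases hmk : m = k
      · rw [hmk]; exact hkl.le
      · exact hmax m (mem_erase.2 ⟨hmk, hm⟩)
    rw [arcsBeforeUp_of_last (k := l.succ) (by simp [shiftSet] at hl ⊢; exact hl) (by
        intro m hm
        rw [shiftSet, mem_image] at hm
        obtain ⟨m, hm, rfl⟩ := hm
        exact Fin.succ_le_succ_iff.2 (hmax m hm)),
      arcsBeforeUp_of_last hlU hmax']
    congr 1
    · rw [← hshift]
      apply zLast_congr
      intro A
      have hiff : (∀ m ∈ shiftSet (U.erase k), m < A.1) ↔ ∀ m ∈ shiftSet U, m < A.1 := by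
        constructor
        · intro h1 m hm
          rw [shiftSet, mem_image] at hm
          obtain ⟨m, hm, rfl⟩ := hm
          exact lt_of_le_of_lt (Fin.succ_le_succ_iff.2 (hmax' m hm))
            (h1 l.succ (mem_image_of_mem _ hl))
        · intro h1 m hm
          exact h1 m (image_subset_image (erase_subset _ _) hm)
      rw [hiff, and_congr_left_iff]
      intro h1
      exact hsub A (h1 k.succ (mem_image_of_mem _ hk))
    · rw [arcsLT, filter_insert, if_pos (by simp), card_insert_of_notMem (by
        simp [zero_pair_notMem]), ← arcsLT, Fin.val_succ, arcsLT_shiftArcs]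
      congr 1; omega

end BIWeights

section BIRecursion

variable {K : Type*} [Field K] {N : ℕ} {q : K} {M : ℕ} {b : Fin N → Bool}
  {S : Finset (Fin N × Fin N)} {U D : Finset (Fin N)}

theorem cleanBI_nil (hM : 1 ≤ M) : cleanBI q M (∅ : Finset (Fin 0 × Fin 0)) ∅ ∅ = 1 := by
  have h : ¬ IsPairedOff M (∅ : Finset (Fin 0)).card := fun h => by
    have := h.1; rw [card_empty] at this; omega
  rw [cleanBI, zMoving, if_neg h]
  simp [arcWeight, upWeight, downWeight, thetaBI, zStatic, staticArcs, qfact, tau]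

theorem IsMatching.cleanBI_cons_false_of_first (h : IsMatching b S U D)
    (hn : ∀ n : ℕ, 1 ≤ n → qint q n ≠ 0) {k : Fin N} (hk : k ∈ U) (hmin : ∀ l ∈ U, k ≤ l) :
    cleanBI q M (insert (0, k.succ) (shiftArcs S)) (shiftSet (U.erase k)) (shiftSet D) =
      cleanBI q M S U D := by
  have hc := card_erase_add_one hk
  rw [cleanBI, h.arcWeight_mul_upWeight_cons_false hk hmin, downWeight_cons_false,
    h.zStatic_cons_false hk, h.zMoving_cons_false hn hk hmin, card_shiftSet, card_shiftSet,
    card_insert_of_notMem (zero_pair_notMem k), card_shiftArcs,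
    show (U.erase k).card + (S.card + 1) = U.card + S.card by omega, cleanBI]

theorem zLast_insert_zero :
    zLast q M (shiftArcs S) ∅ (insert 0 (shiftSet D)) = 1 := by
  rw [zLast, filter_eq_empty_iff.2, prod_empty]
  intro A hA
  simp [outerLeft] at hA

theorem IsMatching.cleanBI_cons_false_of_empty (h : IsMatching b S ∅ D) (hq : q ≠ 0)
    (hn : ∀ n : ℕ, 1 ≤ n → qint q n ≠ 0) (hM : 1 ≤ M) :
    cleanBI q M (shiftArcs S) ∅ (insert 0 (shiftSet D)) = cleanBI q M S ∅ D := by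
  have hlen := h.length_eq
  have hz := h.cons_false_of_empty.zStatic_insert (q := q) (M := M) zero_lt_shiftSet
  have hs : (∅ : Finset (Fin (N + 1))) = shiftSet (∅ : Finset (Fin N)) := rfl
  have hlast : zLast q M (shiftArcs S) (insert 0 ∅) (shiftSet D) = zLast q M S ∅ D := by
    rw [hs, zLast_shift_insert_zero]
  rw [hlast, card_shiftSet, zStatic_shift] at hz
  rw [cleanBI, downWeight_cons_false_empty, hz, zMoving,
    card_insert_of_notMem zero_notMem_shiftSet, card_shiftSet, card_shiftArcs, zLast_insert_zero,
    arcWeight_shiftArcs, arcsBeforeUp_empty, cleanBI, zMoving, arcsBeforeUp_empty, upWeight,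
    upWeight, prod_empty, prod_empty, card_empty]
  rw [card_empty] at *
  generalize D.card = d at *
  generalize S.card = s at *
  rcases lt_trichotomy (d + 1) M with hd | hd | hd
  · have h1 : ¬ IsPairedOff M d := fun h => by have := h.1; omega
    have h2 : ¬ IsPairedOff M (d + 1) := fun h => by have := h.1; omega
    rw [if_neg h1, if_neg h2, if_neg h1, wBI, if_pos hd, tau, tau,
      show (d - M + 1) / 2 = 0 by omega, show (d + 1 - M + 1) / 2 = 0 by omega,
      show min (d + 1) (M - 1) = d + 1 by omega, show min d (M - 1) = d by omega, thetaBI, thetaBI,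
      show 0 + s + 0 + (d + 1) = 0 + s + 0 + d + 1 by omega, qfact_succ]
    have := hn (s + (d + 1)) (by omega)
    rw [show 0 + s + 0 + d + 1 = s + (d + 1) by omega]
    field_simp
  · have h1 : ¬ IsPairedOff M d := fun h => by have := h.1; omega
    have h2 : IsPairedOff M (d + 1) := ⟨hd.ge, by simp [hd]⟩
    rw [if_neg h1, if_pos h2, if_neg h1, wBI, if_neg (by omega), if_pos h2.2, tau, tau,
      show (d - M + 1) / 2 = 0 by omega, show (d + 1 - M + 1) / 2 = 0 by omega,
      show min (d + 1) (M - 1) = min d (M - 1) by omega,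
      show N + 1 + M - 0 = 2 * (s + M + (d + 1 - M) / 2) by omega]
    have := hn (2 * (s + M + (d + 1 - M) / 2)) (by omega)
    field_simp
  · rw [show min (d + 1) (M - 1) = min d (M - 1) by omega]
    by_cases h1 : IsPairedOff M d
    · have h2 : ¬ Even (d + 1 - M) := by
        rw [show d + 1 - M = d - M + 1 by omega, Nat.even_add_one, not_not]
        exact h1.2
      rw [if_pos h1, if_neg (fun h => h2 h.2), if_pos h1, wBI, if_neg (by omega), if_neg h2, tau,
        tau]
      obtain ⟨h3, m, h4⟩ := h1
      rw [show (d + 1 - M + 1) / 2 = m + 1 by omega, show (d - M + 1) / 2 = m by omega,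
        show min d (M - 1) = M - 1 by omega, show 0 + s + (m + 1) = s + m + 1 by omega,
        thetaBI_succ, show 0 + s + m = s + m by omega,
        show s + m + (M - 1) + 1 = M + (s + m) by omega, ← qint_two_mul hq,
        show N + M - 0 = 2 * (M + (s + m)) by omega]
      ring
    · have h2 : Even (d + 1 - M) := by
        rw [show d + 1 - M = d - M + 1 by omega, Nat.even_add_one]
        exact fun h => h1 ⟨by omega, h⟩
      have h3 : IsPairedOff M (d + 1) := ⟨hd.le, h2⟩
      rw [if_neg h1, if_pos h3, if_neg h1, wBI, if_neg (by omega), if_pos h2, tau, tau]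
      obtain ⟨m, h4⟩ := h2
      rw [show (d + 1 - M + 1) / 2 = m by omega, show (d - M + 1) / 2 = m by omega,
        show N + 1 + M - 0 = 2 * (s + M + (d + 1 - M) / 2) by omega]
      have := hn (2 * (s + M + (d + 1 - M) / 2)) (by omega)
      field_simp

theorem cleanBI_shift (hq : q ≠ 0) :
    cleanBI q M (shiftArcs S) (insert 0 (shiftSet U)) (shiftSet D) =
      arcWeight q S * mixedWeight q S U 0 * downWeight (wBI q M) S D * (zStatic q M S D *
        thetaBI q M (U.card + S.card + tau M D.card + 1) (min D.card (M - 1)) *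
        if IsPairedOff M D.card then zLast q M S U D * qint q (N + 1 + M - arcsBeforeUp S U)
        else 1) := by
  rw [cleanBI, arcWeight_shiftArcs, upWeight_shift, downWeight_shift, zStatic_shift,
    zMoving_shift_insert_zero, card_insert_of_notMem zero_notMem_shiftSet, card_shiftSet,
    card_shiftSet, card_shiftArcs, qint_one hq, inv_one, one_mul,
    show U.card + 1 + S.card + tau M D.card = U.card + S.card + tau M D.card + 1 by ring]

theorem IsMatching.cleanBI_split (h : IsMatching b S U D) {A : Fin N × Fin N}
    (hA : A ∈ outerLeft S D) :
    cleanBI q M (S.erase A) (insert A.1 (insert A.2 U)) D =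
      arcWeight q (S.erase A) * upWeight q (S.erase A) (insert A.1 (insert A.2 U)) *
        downWeight (wBI q M) S D * (zStatic q M S D *
        thetaBI q M (U.card + S.card + tau M D.card + 1) (min D.card (M - 1)) *
        zMoving q M (S.erase A) (insert A.1 (insert A.2 U)) D) := by
  obtain ⟨i, j⟩ := A
  simp only [outerLeft, mem_filter] at hA
  obtain ⟨hij, ho, hD⟩ := hA
  have hlt := h.lt _ _ hij
  have hi' : i ∉ insert j U := by simp [h.fst_notMem_up hij, hlt.ne]
  have hS := card_erase_add_one hij
  rw [cleanBI, downWeight_split (fun k hk => hlt.trans (hD k hk)), h.zStatic_split hD hlt,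
    card_insert_of_notMem hi', card_insert_of_notMem (h.snd_notMem_up hij),
    show U.card + 1 + 1 + (S.erase (i, j)).card + tau M D.card =
      U.card + S.card + tau M D.card + 1 by omega]

theorem IsMatching.sum_cleanBI_split (h : IsMatching b S U D) (hq : q ≠ 0)
    (hn : ∀ n : ℕ, 1 ≤ n → qint q n ≠ 0) (hc : ¬ IsPairedOff M D.card) :
    ∑ A ∈ outerLeft S D, q⁻¹ ^ ((U.filter fun m => m < A.1).card + 1) *
        cleanBI q M (S.erase A) (insert A.1 (insert A.2 U)) D =
      arcWeight q S * (mixedWeight q S U 0 - q ^ arcsLeft S D *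
        (qint q (U.card + arcsLeft S D + 1))⁻¹ * upWeight q S U) *
        (downWeight (wBI q M) S D * (zStatic q M S D *
        thetaBI q M (U.card + S.card + tau M D.card + 1) (min D.card (M - 1)))) := by
  rw [← h.sum_split hq hn, sum_mul]
  refine sum_congr rfl fun A hA => ?_
  rw [h.cleanBI_split hA, zMoving, if_neg hc]
  ring

theorem IsMatching.zStatic_erase_first (h : IsMatching b S U D) {k : Fin N} (hk : k ∈ D)
    (hmin : ∀ l ∈ D, k ≤ l) :
    zStatic q M S D = zStatic q M S (D.erase k) *
      if IsPairedOff M (D.erase k).card then zLast q M S (insert k U) (D.erase k) else 1 := by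
  rw [← IsMatching.zStatic_insert (b := b) (U := U), insert_erase hk]
  · rwa [insert_erase hk]
  · intro l hl
    rw [mem_erase] at hl
    exact lt_of_le_of_ne (hmin l hl.2) hl.1.symm

/-- The coefficient of `v₁ ⊗ κ D` in the expansion of `v₋₁ ⊗ κ D` for type BI. -/
def gammaBI (q : K) (M d : ℕ) : K := if d < M then q ^ d * (q ^ M)⁻¹ else 0

theorem IsMatching.cleanBI_cons_true_of_lt (h : IsMatching b S U D) (hq : q ≠ 0)
    (hn : ∀ n : ℕ, 1 ≤ n → qint q n ≠ 0) (hd : D.card < M) :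
    cleanBI q M (shiftArcs S) (insert 0 (shiftSet U)) (shiftSet D) =
      q ^ N * q ^ M * cleanBI q M S U D +
      ∑ A ∈ outerLeft S D, q⁻¹ ^ ((U.filter fun m => m < A.1).card + 1) *
        cleanBI q M (S.erase A) (insert A.1 (insert A.2 U)) D +
      ∑ k ∈ firstOf D, q⁻¹ ^ (U.card + 1) * cleanBI q M S (insert k U) (D.erase k) +
      q⁻¹ ^ U.card * gammaBI q M D.card * cleanBI q M S U D := by
  have hlen := h.length_eq
  have hc : ¬ IsPairedOff M D.card := fun hc => by have := hc.1; omega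
  have hQ : q ^ M ≠ 0 := pow_ne_zero _ hq
  have ht : tau M D.card = 0 := by rw [tau]; omega
  rw [cleanBI_shift hq, h.sum_cleanBI_split hq hn hc, if_neg hc, thetaBI_succ, gammaBI, if_pos hd,
    ht, cleanBI, zMoving, if_neg hc, ht, show min D.card (M - 1) = D.card by omega, add_zero]
  set Θ : K := thetaBI q M (U.card + S.card) D.card with hΘ
  rcases firstOf_cases D with ⟨hD, hf⟩ | ⟨k, hk, hmin, hf⟩
  · rw [hf, sum_empty, hD, arcsLeft_empty]
    subst hD
    have key := identity_BIII hq hQ hn U.card S.card 0 0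
    rw [card_empty] at *
    simp only [add_zero, qint_zero, mul_zero, zero_mul, ← pow_add] at key hlen ⊢
    rw [← hlen] at key
    linear_combination (-(arcWeight q S * upWeight q S U * downWeight (wBI q M) S ∅ *
      zStatic q M S ∅ * Θ)) * key
  · have hr := rho_first (S := S) hk hmin
    have hd1 : 1 ≤ D.card := card_pos.2 ⟨k, hk⟩
    have hc' : ¬ IsPairedOff M (D.erase k).card := fun hc => by
      have := hc.1; rw [card_erase_of_mem hk] at this; omega
    have key := identity_BIII hq hQ hn U.card (arcsLeft S D) (rho S k) D.card
    rw [hf, sum_singleton, h.zStatic_erase_first hk hmin, if_neg hc', cleanBI,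
      h.upWeight_promote hk, zMoving, if_neg hc',
      arcsLT_first hk hmin, downWeight_erase_first hk hmin, card_insert_of_notMem
        (fun hk' => lt_irrefl _ (h.up_lt_down k hk' k hk)), card_erase_of_mem hk,
      show tau M (D.card - 1) = 0 by rw [tau]; omega,
      show min (D.card - 1) (M - 1) = D.card - 1 by omega,
      show U.card + 1 + S.card + 0 = U.card + S.card + 1 by ring]
    have hΘ1 : thetaBI q M (U.card + S.card + 1) (D.card - 1) =
        Θ * sym (q ^ (M + (U.card + S.card))) := by
      rw [thetaBI, hΘ, thetaBI, prod_range_succ,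
        show U.card + S.card + 1 + (D.card - 1) = U.card + S.card + D.card by omega]
      ring
    rw [hΘ1]
    rw [show arcsLeft S D + rho S k = S.card by omega, ← hlen] at key
    simp only [← pow_add] at key ⊢
    have hw : wBI q M D.card (rho S k) * qint q (rho S k + D.card) = 1 := by
      rw [wBI, if_pos hd]
      exact inv_mul_cancel₀ (hn _ (by omega))
    linear_combination (-(arcWeight q S * upWeight q S U * wBI q M D.card (rho S k) *
      downWeight (wBI q M) S (D.erase k) * zStatic q M S (D.erase k) * Θ)) * key +
      (arcWeight q S * upWeight q S U *
      downWeight (wBI q M) S (D.erase k) * zStatic q M S (D.erase k) * Θ * q⁻¹ ^ (U.card + 1) *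
      sym (q ^ (M + (U.card + S.card))) * (qint q (U.card + arcsLeft S D + 1))⁻¹) * hw

theorem IsMatching.cleanBI_cons_true_of_odd (h : IsMatching b S U D) (hq : q ≠ 0)
    (hn : ∀ n : ℕ, 1 ≤ n → qint q n ≠ 0) (hM : 1 ≤ M) (hd : M ≤ D.card)
    (hodd : Odd (D.card - M)) :
    cleanBI q M (shiftArcs S) (insert 0 (shiftSet U)) (shiftSet D) =
      q ^ N * q ^ M * cleanBI q M S U D +
      ∑ A ∈ outerLeft S D, q⁻¹ ^ ((U.filter fun m => m < A.1).card + 1) *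
        cleanBI q M (S.erase A) (insert A.1 (insert A.2 U)) D +
      ∑ k ∈ firstOf D, q⁻¹ ^ (U.card + 1) * cleanBI q M S (insert k U) (D.erase k) := by
  have hlen := h.length_eq
  have hc : ¬ IsPairedOff M D.card := fun hc => Nat.not_even_iff_odd.2 hodd hc.2
  rw [cleanBI_shift hq, h.sum_cleanBI_split hq hn hc, if_neg hc, thetaBI_succ, cleanBI, zMoving,
    if_neg hc]
  obtain ⟨k, hk, hmin, hf⟩ := (firstOf_cases D).resolve_left
    (fun h => by rw [h.1, card_empty] at hd; omega)
  have hr := rho_first (S := S) hk hmin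
  have hd1 := card_erase_add_one hk
  have hodd' := hodd
  obtain ⟨m, hm⟩ := hodd
  have hc' : IsPairedOff M (D.erase k).card := ⟨by omega, m, by omega⟩
  have hw : wBI q M D.card (rho S k) = 1 := by
    rw [wBI, if_neg (by omega), if_neg (Nat.not_even_iff_odd.2 hodd')]
  have hup : ∀ l ∈ insert k U, l ≤ k := by
    intro l hl
    rcases mem_insert.1 hl with rfl | hl
    · exact le_rfl
    · exact (h.up_lt_down l hl k hk).le
  rw [hf, sum_singleton, h.zStatic_erase_first hk hmin, if_pos hc', cleanBI,
    h.upWeight_promote hk, zMoving, if_pos hc', arcsBeforeUp_of_last (mem_insert_self k U) hup,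
    arcsLT_first hk hmin, downWeight_erase_first hk hmin, hw, card_insert_of_notMem
      (fun hk' => lt_irrefl _ (h.up_lt_down k hk' k hk)), tau, tau,
    show (D.card - M + 1) / 2 = m + 1 by omega,
    show ((D.erase k).card - M + 1) / 2 = m by omega,
    show min D.card (M - 1) = M - 1 by omega, show min (D.erase k).card (M - 1) = M - 1 by omega,
    show U.card + 1 + S.card + m = U.card + S.card + (m + 1) by ring,
    show U.card + S.card + (m + 1) + (M - 1) + 1 = M + (U.card + S.card + (m + 1)) by omega,
    ← qint_two_mul hq]
  have hY := hn (U.card + arcsLeft S D + 1) (by omega)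
  have key := qint_add' hq (N + M - arcsLeft S D) (U.card + arcsLeft S D + 1)
  rw [show N + M - arcsLeft S D + (U.card + arcsLeft S D + 1) =
    2 * (M + (U.card + S.card + (m + 1))) by omega] at key
  have k1 : q ^ arcsLeft S D * q⁻¹ ^ (U.card + arcsLeft S D + 1) = q⁻¹ ^ (U.card + 1) := by
    rw [show U.card + arcsLeft S D + 1 = arcsLeft S D + (U.card + 1) by ring, pow_add,
      ← mul_assoc, ← mul_pow, mul_inv_cancel₀ hq, one_pow, one_mul]
  have k2 : q ^ arcsLeft S D * q ^ (N + M - arcsLeft S D) = q ^ N * q ^ M := by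
    rw [← pow_add, ← pow_add]; congr 1; omega
  have key' : qint q (2 * (M + (U.card + S.card + (m + 1)))) * (q ^ arcsLeft S D *
      (qint q (U.card + arcsLeft S D + 1))⁻¹) = q ^ N * q ^ M + q⁻¹ ^ (U.card + 1) *
      (qint q (N + M - arcsLeft S D) * (qint q (U.card + arcsLeft S D + 1))⁻¹) := by
    rw [← k1, ← k2, key]
    generalize qint q (U.card + arcsLeft S D + 1) = Y at *
    generalize q⁻¹ ^ (U.card + arcsLeft S D + 1) = Z at *
    field_simp
    ring
  linear_combination (arcWeight q S * upWeight q S U * downWeight (wBI q M) S (D.erase k) *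
    zStatic q M S (D.erase k) * zLast q M S (insert k U) (D.erase k) *
    thetaBI q M (U.card + S.card + (m + 1)) (M - 1)) * key'

end BIRecursion

section BIPairedOff

variable {K : Type*} [Field K] {N : ℕ} {q : K} {M : ℕ} {b : Fin N → Bool}
  {S : Finset (Fin N × Fin N)} {U D : Finset (Fin N)}

theorem IsMatching.fst_ne_snd (h : IsMatching b S U D) {i j i' j' : Fin N} (hij : (i, j) ∈ S)
    (hij' : (i', j') ∈ S) : i ≠ j' := by
  rintro rfl
  have := h.fst_false _ _ hij
  rw [h.snd_true _ _ hij'] at this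
  exact absurd this (by simp)

/-- The position behind the last remaining up arrow. -/
theorem IsMatching.exists_start (h : IsMatching b S U D) :
    ∃ t : ℕ, t ≤ N ∧ IsCut S t ∧ (∀ k ∈ U, (k : ℕ) < t) ∧ (∀ k ∈ D, t ≤ (k : ℕ)) ∧
      (∀ e, (∀ k ∈ U, (k : ℕ) < e) → t ≤ e) ∧ arcsBeforeUp S U = arcsLT S t ∧
      ((U = ∅ ∧ t = 0 ∧ lastOf U = ∅) ∨ ∃ l ∈ U, (∀ m ∈ U, m ≤ l) ∧ t = l + 1 ∧
        lastOf U = {l} ∧ nu S U l = U.card + arcsLT S t) := by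
  rcases lastOf_cases U with ⟨rfl, hl⟩ | ⟨l, hl, hmax, hlast⟩
  · exact ⟨0, Nat.zero_le N, IsMatching.isCut_zero, by simp, by simp, by simp, by
      rw [arcsBeforeUp_empty, arcsLT_zero], Or.inl ⟨rfl, rfl, hl⟩⟩
  · have hlt : ∀ k ∈ U, (k : ℕ) < l + 1 := fun k hk => Nat.lt_succ_of_le (hmax k hk)
    have hnu := h.nu_up hl
    rw [nu, countLT_succ_of_mem hl] at hnu
    refine ⟨l + 1, l.2, h.isCut_up_succ hl, hlt, fun k hk => h.up_lt_down l hl k hk,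
      fun e he => he l hl, ?_, Or.inr ⟨l, hl, hmax, rfl, hlast, ?_⟩⟩
    · rw [arcsBeforeUp_of_last hl hmax]; omega
    · rw [nu, countLT_of_le U hlt]

/-- The contribution of the outer arcs behind the first `t` positions. -/
def zRight (q : K) (M : ℕ) (S : Finset (Fin N × Fin N)) (D : Finset (Fin N)) (t : ℕ) : K :=
  ∏ A ∈ (outerLeft S D).filter (fun A => t ≤ (A.1 : ℕ)), zeta q M A

theorem IsMatching.zRight_fst (h : IsMatching b S U D) {i j : Fin N} (hij : (i, j) ∈ S)
    (ho : ∀ B ∈ S, ¬(B.1 < i ∧ j < B.2)) (hD : ∀ k ∈ D, j < k) :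
    zRight q M S D i = zeta q M (i, j) * zRight q M S D (j + 1) := by
  have hlt := h.lt _ _ hij
  rw [zRight, zRight, ← prod_insert]
  · refine prod_congr ?_ fun _ _ => rfl
    ext ⟨a, c⟩
    simp only [mem_filter, mem_insert, Prod.mk.injEq]
    constructor
    · rintro ⟨h1, h2⟩
      have h3 := (mem_filter.1 h1).1
      have h4 := (mem_filter.1 h1).2.1 _ hij
      by_cases h5 : a = i
      · subst h5; exact Or.inl ⟨rfl, h.fst_inj _ _ _ h3 hij⟩
      · have h6 := h.noncross _ _ _ _ hij h3
        have h7 := h.fst_ne_snd h3 hij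
        refine Or.inr ⟨h1, ?_⟩
        simp only [Fin.lt_def, Fin.ext_iff] at *; omega
    · rintro (⟨rfl, rfl⟩ | ⟨h1, h2⟩)
      · exact ⟨mem_filter.2 ⟨hij, ho, hD⟩, le_rfl⟩
      · refine ⟨h1, ?_⟩
        rw [Fin.lt_def] at hlt; omega
  · rw [mem_filter]
    rintro ⟨-, h1⟩
    rw [Fin.lt_def] at hlt
    simp only at h1; omega

theorem IsMatching.zMoving_split_before (h : IsMatching b S U D) (hc : IsPairedOff M D.card)
    {i j l : Fin N} (hA : (i, j) ∈ outerLeft S D) (hl : l ∈ U) (hmax : ∀ m ∈ U, m ≤ l)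
    (hjl : j ≤ l) :
    zMoving q M (S.erase (i, j)) (insert i (insert j U)) D =
      zLast q M S U D * qint q (N + 1 + M - arcsBeforeUp S U) := by
  obtain ⟨hij, ho, hD⟩ := mem_filter.1 hA
  have hlt := h.lt _ _ hij
  have hlt' : i < l := lt_of_lt_of_le hlt hjl
  have hl' : l ∈ insert i (insert j U) := by simp [hl]
  have hmax' : ∀ m ∈ insert i (insert j U), m ≤ l := by
    intro m hm
    rcases mem_insert.1 hm with rfl | hm
    · exact hlt'.le
    rcases mem_insert.1 hm with rfl | hm
    · exact hjl
    · exact hmax m hm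
  have hce := arcsLT_erase hij l
  rw [if_pos (Fin.lt_def.1 hlt')] at hce
  rw [zMoving, if_pos hc, arcsBeforeUp_of_last hl' hmax', arcsBeforeUp_of_last hl hmax]
  congr 1
  · apply zLast_congr
    rintro ⟨a, c⟩
    simp only [outerLeft, mem_filter, mem_erase, ne_eq, Prod.mk.injEq]
    constructor
    · rintro ⟨⟨⟨h1, h2⟩, h3, h4⟩, h5⟩
      have h6 := h5 l hl'
      have h7 := h.lt _ _ h2
      refine ⟨⟨h2, fun B hB => ?_, h4⟩, fun m hm => h5 m (by simp [hm])⟩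
      by_cases hB' : B = (i, j)
      · subst hB'; rintro ⟨h8, h9⟩; simp only at h8 h9; grind
      · exact h3 B ⟨hB', hB⟩
    · rintro ⟨⟨h2, h3, h4⟩, h5⟩
      have h6 := h5 l hl
      refine ⟨⟨⟨?_, h2⟩, fun B hB => h3 B hB.2, h4⟩, fun m hm => lt_of_le_of_lt (hmax' m hm) h6⟩
      rintro ⟨rfl, -⟩
      exact absurd h6 (not_lt.2 hlt'.le)
  · congr 1; omega

theorem IsMatching.zMoving_split_behind (h : IsMatching b S U D) (hc : IsPairedOff M D.card)
    {i j : Fin N} (hA : (i, j) ∈ outerLeft S D) (hi : ∀ m ∈ U, m < i) :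
    zMoving q M (S.erase (i, j)) (insert i (insert j U)) D =
      zRight q M S D (j + 1) * qint q (N + M - (arcsLT S i + size (i, j) - 1)) := by
  obtain ⟨hij, ho, hD⟩ := mem_filter.1 hA
  have hlt := h.lt _ _ hij
  have hj : j ∈ insert i (insert j U) := by simp
  have hmax : ∀ m ∈ insert i (insert j U), m ≤ j := by
    intro m hm
    rcases mem_insert.1 hm with rfl | hm
    · exact hlt.le
    rcases mem_insert.1 hm with rfl | hm
    · exact le_rfl
    · exact ((hi m hm).trans hlt).le
  have hce := arcsLT_erase hij j
  have hj1 : arcsLT S (j + 1) = arcsLT S j := by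
    refine arcsLT_eq_of_notMem (by omega) fun i' j' h' => ?_
    have := h.fst_ne_snd h' hij
    rw [Ne, Fin.ext_iff] at this; omega
  rw [if_pos (Fin.lt_def.1 hlt), ← hj1, h.arcsLT_snd hij ho] at hce
  rw [zMoving, if_pos hc, arcsBeforeUp_of_last hj hmax]
  · congr 1
    · rw [zLast, zRight]
      refine prod_congr ?_ fun _ _ => rfl
      ext ⟨a, c⟩
      simp only [outerLeft, mem_filter, mem_erase, ne_eq, Prod.mk.injEq]
      constructor
      · rintro ⟨⟨⟨h1, h2⟩, h3, h4⟩, h5⟩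
        have h6 := h5 j hj
        have h7 := h.lt _ _ h2
        refine ⟨⟨h2, fun B hB => ?_, h4⟩, h6⟩
        by_cases hB' : B = (i, j)
        · subst hB'; rintro ⟨h8, h9⟩; simp only at h8 h9; grind
        · exact h3 B ⟨hB', hB⟩
      · rintro ⟨⟨h2, h3, h4⟩, h5⟩
        have h6 : j < a := h5
        refine ⟨⟨⟨?_, h2⟩, fun B hB => h3 B hB.2, h4⟩, fun m hm => lt_of_le_of_lt (hmax m hm) h6⟩
        rintro ⟨rfl, -⟩
        exact absurd h6 (not_lt.2 hlt.le)
    · congr 1; omega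

/-- The telescoping sum over the diagrams that are obtained by opening an outer arc behind the last
remaining up arrow. -/
theorem IsMatching.sum_split_behind (h : IsMatching b S U D) (hq : q ≠ 0)
    (hn : ∀ n : ℕ, 1 ≤ n → qint q n ≠ 0) (hM : 1 ≤ M) {t e : ℕ} (hte : t ≤ e) (he : e ≤ N)
    (hct : IsCut S t) (hce : IsCut S e) (hU : ∀ k ∈ U, (k : ℕ) < t) (hD : ∀ k ∈ D, e ≤ (k : ℕ)) :
    ∑ A ∈ S.filter (fun A => (∀ B ∈ S, ¬(B.1 < A.1 ∧ A.2 < B.2)) ∧ t ≤ A.1 ∧ (A.2 : ℕ) < e),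
      q⁻¹ ^ (U.card + 1) * (qint q (size A) * upWeight q (S.erase A) (insert A.1 (insert A.2 U)) *
        (zRight q M S D (A.2 + 1) * qint q (N + M - (arcsLT S A.1 + size A - 1)))) +
      q⁻¹ ^ (U.card + 1) * (qint q (N - e + M) * (qint q (U.card + arcsLT S e + 1))⁻¹ *
        zRight q M S D e * upWeight q S U) =
      q⁻¹ ^ (U.card + 1) * (qint q (N - t + M) * (qint q (U.card + arcsLT S t + 1))⁻¹ *
        zRight q M S D t * upWeight q S U) := by
  refine h.sum_outer_telescope
    (fun t => q⁻¹ ^ (U.card + 1) * (qint q (N - t + M) * (qint q (U.card + arcsLT S t + 1))⁻¹ *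
        zRight q M S D t * upWeight q S U))
    (fun A => q⁻¹ ^ (U.card + 1) * (qint q (size A) *
      upWeight q (S.erase A) (insert A.1 (insert A.2 U)) *
        (zRight q M S D (A.2 + 1) * qint q (N + M - (arcsLT S A.1 + size A - 1)))))
    he hce _ t rfl hte hct (fun k hk => Or.inr (hD k hk)) ?_ ?_
  · intro k hk h1 _
    have := hU k hk; omega
  · intro i j hij ho hti hje
    have hlt := h.lt _ _ hij
    have hDj : ∀ k ∈ D, j < k := fun k hk => by rw [Fin.lt_def]; have := hD k hk; omega
    have hci : countLT U i = U.card := countLT_of_le U fun k hk => by have := hU k hk; omega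
    have hm : mixedWeight q S U i = upWeight q S U :=
      mixedWeight_of_lt fun k hk => by have := hU k hk; omega
    have hcnt := h.eq_count (t := i) (by omega) (h.isCut_fst hij ho)
    have hcnt' := h.eq_count (t := j + 1) (by omega) (h.isCut_snd hij ho)
    have hd0 : countLT D i = 0 := countLT_of_ge D fun k hk => by have := hD k hk; omega
    have hd1 : countLT D (j + 1) = 0 := countLT_of_ge D fun k hk => by have := hD k hk; omega
    have hu1 : countLT U (j + 1) = U.card := countLT_of_le U fun k hk => by
      have := hU k hk; rw [Fin.lt_def] at hlt; omega
    have hsnd := h.arcsLT_snd hij ho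
    have hsz := size_pos hlt
    simp only
    rw [h.upWeight_split hij ho, h.zRight_fst hij ho hDj, hci, hm, hsnd]
    rw [hsnd, hd1, hu1] at hcnt'
    rw [hd0, hci] at hcnt
    have hjN := j.2
    set a := arcsLT S i with ha
    set m := size (i, j) with hm'
    set z := N - (j + 1) + M with hz
    have e0 : BI.d₃ (i, j) = N - (j + 1) := rfl
    rw [zeta, e0, ← hm', show N - (j + 1) + m + M = m + z by omega,
      show N - (j + 1) + 2 * m + M = 2 * m + z by omega, show N - i + M = 2 * m + z by omega,
      show U.card + (a + m) + 1 = U.card + a + 1 + m by ring,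
      show N + M - (a + m - 1) = (U.card + a + 1 + m) + z by omega]
    have n1 := hn (U.card + a + 1) (by omega)
    have n2 := hn (U.card + a + 1 + m) (by omega)
    have n3 := hn (2 * m + z) (by omega)
    have k1 := qint_add hq m z
    have k2 := qint_add hq (U.card + a + 1) m
    have k3 := qint_add hq (U.card + a + 1 + m) z
    have key : qint q (m + z) * qint q (U.card + a + 1 + m) -
        qint q z * qint q (U.card + a + 1) = qint q m * qint q (U.card + a + 1 + m + z) := by
      have e1 : q⁻¹ ^ m * q ^ m = 1 := by rw [← mul_pow, inv_mul_cancel₀ hq, one_pow]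
      have k2' := qint_add' hq (U.card + a + 1) m
      rw [k1, k3]
      have : qint q m * q⁻¹ ^ (U.card + a + 1 + m) =
          q⁻¹ ^ m * (qint q (U.card + a + 1 + m) - q ^ m * qint q (U.card + a + 1)) := by
        rw [k2, pow_add]; ring
      linear_combination (-qint q z) * this + qint q z * qint q (U.card + a + 1) * e1
    generalize qint q (U.card + a + 1 + m + z) = X at *
    generalize qint q (U.card + a + 1 + m) = Y at *
    generalize qint q (U.card + a + 1) = W at *
    generalize qint q (m + z) = V at *
    generalize qint q (2 * m + z) = T at *
    generalize qint q z = Z at *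
    generalize qint q m = R at *
    generalize q⁻¹ ^ (U.card + 1) = P at *
    clear k1 k2 k3
    field_simp
    linear_combination (P * zRight q M S D (j + 1) * upWeight q S U) * key

theorem identity_BI (hq : q ≠ 0) (hn : ∀ n : ℕ, 1 ≤ n → qint q n ≠ 0) (y u l : ℕ) :
    q ^ (y + u + 2 * l) * qint q (y + u + l) + q⁻¹ ^ u * qint q (u + l) =
      qint q (y + 2 * u + 2 * l) * ((q ^ l * qint q (y + u + l + 1) -
        q⁻¹ ^ (u + 1) * qint q y) * (qint q (u + l + 1))⁻¹) := by
  have h1 := qint_add' hq y (u + l + 1)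
  have h2 := qint_add hq (y + u + l) (u + l)
  have hc := hn (u + l + 1) (by omega)
  have e1 : q ^ l * q⁻¹ ^ (u + l + 1) = q⁻¹ ^ (u + 1) := by
    rw [show u + l + 1 = l + (u + 1) by ring, pow_add, ← mul_assoc, ← mul_pow, mul_inv_cancel₀ hq,
      one_pow, one_mul]
  have e2 : q ^ (y + l) * q⁻¹ ^ (y + u + l) = q⁻¹ ^ u := by
    rw [show y + u + l = y + l + u by ring, pow_add _ (y + l), ← mul_assoc, ← mul_pow,
      mul_inv_cancel₀ hq, one_pow, one_mul]
  rw [show y + u + l + 1 = y + (u + l + 1) by ring, h1,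
    show y + 2 * u + 2 * l = y + u + l + (u + l) by ring, h2, ← e1, ← e2]
  field_simp
  ring

theorem IsMatching.cleanBI_cons_true_of_even (h : IsMatching b S U D) (hq : q ≠ 0)
    (hn : ∀ n : ℕ, 1 ≤ n → qint q n ≠ 0) (hM : 1 ≤ M) (hc : IsPairedOff M D.card) :
    cleanBI q M (shiftArcs S) (insert 0 (shiftSet U)) (shiftSet D) =
      q ^ N * q ^ M * cleanBI q M S U D +
      ∑ A ∈ outerLeft S D, q⁻¹ ^ ((U.filter fun m => m < A.1).card + 1) *
        cleanBI q M (S.erase A) (insert A.1 (insert A.2 U)) D +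
      ∑ k ∈ firstOf D, q⁻¹ ^ (U.card + 1) * cleanBI q M S (insert k U) (D.erase k) +
      ∑ k ∈ lastOf U, q⁻¹ ^ (U.card - 1) * q⁻¹ * cleanBI q M S (U.erase k) (insert k D) := by
  have hlen := h.length_eq
  obtain ⟨hMd, m, hm⟩ := hc
  have hc : IsPairedOff M D.card := ⟨hMd, m, hm⟩
  obtain ⟨k, hk, hmin, hf⟩ := (firstOf_cases D).resolve_left
    (fun h => by rw [h.1, card_empty] at hMd; omega)
  obtain ⟨e, he, hce, hDe, hUe, hle, hoe⟩ := h.exists_end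
  obtain ⟨t, ht, hct, hUt, hDt, hte, hbt, hcases⟩ := h.exists_start
  have hte := hte e hUe
  have hcntt := h.eq_count ht hct
  have hcnte := h.eq_count he hce
  rw [countLT_of_le U hUt, countLT_of_ge D hDt] at hcntt
  rw [countLT_of_le U hUe, countLT_of_ge D hDe] at hcnte
  have hr := rho_first (S := S) hk hmin
  have hd1 := card_erase_add_one hk
  have hkU : k ∉ U := fun hk' => lt_irrefl _ (h.up_lt_down k hk' k hk)
  set L := zLast q M S U D with hL
  set Θ : K := thetaBI q M (U.card + S.card + tau M D.card) (M - 1) with hΘ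
  set P : K := arcWeight q S * downWeight (wBI q M) S D * zStatic q M S D with hP
  have hmind : min D.card (M - 1) = M - 1 := by omega
  have htau : tau M D.card = m := by rw [tau]; omega
  have hΘ1 : thetaBI q M (U.card + S.card + tau M D.card + 1) (M - 1) =
      Θ * qint q (N + M + U.card) := by
    rw [thetaBI_succ, ← hΘ, htau,
      show U.card + S.card + m + (M - 1) + 1 = M + (U.card + S.card + m) by clear hcases; omega,
      ← qint_two_mul hq]
    congr 2; clear hcases; omega
  have hself : cleanBI q M S U D =
      P * upWeight q S U * Θ * (L * qint q (N + M - arcsLT S t)) := by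
    rw [cleanBI, zMoving, if_pos hc, hmind, hbt]; ring
  have hshift : cleanBI q M (shiftArcs S) (insert 0 (shiftSet U)) (shiftSet D) =
      P * mixedWeight q S U 0 * (Θ * qint q (N + M + U.card)) *
        (L * qint q (N + 1 + M - arcsLT S t)) := by
    rw [cleanBI_shift hq, if_pos hc, hmind, hbt, hΘ1]; ring
  have hbefore := h.sum_outerLeft hq hn (Nat.zero_le t) ht IsMatching.isCut_zero hct hDt
  have hbehind := h.sum_split_behind hq hn hM hte he hct hce hUt hDe
  rw [countLT_of_le U hUt, mixedWeight_of_lt hUt, arcsLT_zero, countLT_zero, zero_add, zero_add,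
    pow_zero, one_mul, qint_one hq, inv_one, one_mul] at hbefore
  have hzt : zRight q M S D t = L := by
    rw [hL, zRight, zLast]
    refine prod_congr ?_ fun _ _ => rfl
    refine filter_congr fun A _ => ?_
    rcases hcases with ⟨h1, h2, -⟩ | ⟨l, h1, h2, h3, -⟩
    · simp [h1, h2]
    · constructor
      · intro h4 x hx
        have := hUt x hx
        rw [Fin.lt_def]; omega
      · intro h4; rw [h3]; exact h4 l h1
  have hze : zRight q M S D e = 1 := by
    rw [zRight, filter_eq_empty_iff.2, prod_empty]
    rintro ⟨i, j⟩ hA h1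
    rw [hoe] at hA
    have h2 := (mem_filter.1 hA).2.2.2
    have h3 := h.lt _ _ (mem_filter.1 hA).1
    rw [Fin.lt_def] at h3
    simp only at h1 h2; omega
  rw [hzt, hze, hle] at hbehind
  have hsum : ∑ A ∈ outerLeft S D, q⁻¹ ^ ((U.filter fun m => m < A.1).card + 1) *
        cleanBI q M (S.erase A) (insert A.1 (insert A.2 U)) D =
      P * (Θ * qint q (N + M + U.card)) * (L * qint q (N + 1 + M - arcsLT S t) *
        (mixedWeight q S U 0 - q ^ arcsLT S t * (qint q (U.card + arcsLT S t + 1))⁻¹ *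
          upWeight q S U) + (q⁻¹ ^ (U.card + 1) * (qint q (N - t + M) *
          (qint q (U.card + arcsLT S t + 1))⁻¹ * L * upWeight q S U) -
          q⁻¹ ^ (U.card + 1) * (qint q (N - e + M) *
          (qint q (U.card + arcsLeft S D + 1))⁻¹ * 1 * upWeight q S U))) := by
    rw [← hbefore, ← hbehind, add_sub_cancel_right, add_sub_cancel_right,
      ← sum_filter_add_sum_filter_not (outerLeft S D) (fun A => (A.2 : ℕ) < t), mul_add, mul_sum,
      mul_sum, mul_sum]
    congr 1
    · refine sum_congr ?_ ?_
      · ext A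
        simp only [outerLeft, mem_filter, zero_le, true_and]
        constructor
        · rintro ⟨⟨h1, h2, h3⟩, h4⟩; exact ⟨h1, h2, h4⟩
        · rintro ⟨h1, h2, h3⟩
          exact ⟨⟨h1, h2, fun k hk => by rw [Fin.lt_def]; have := hDt k hk; omega⟩, h3⟩
      · rintro ⟨i, j⟩ hA
        rw [mem_filter] at hA
        have hAo : (i, j) ∈ outerLeft S D := by
          rw [outerLeft, mem_filter]
          exact ⟨hA.1, hA.2.1, fun k hk => by
            rw [Fin.lt_def]; have := hDt k hk; have := hA.2.2.2; omega⟩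
        obtain ⟨l, hl, hmax, hlt, -⟩ := hcases.resolve_left (fun h0 => by
          have := hA.2.2.2; omega)
        rw [h.cleanBI_split hAo, h.zMoving_split_before hc hAo hl hmax (by
          have := hA.2.2.2
          rw [Fin.le_def]; simp only at this; omega), hmind, hΘ1, hbt, arcWeight_erase hn h hA.1]
        simp only [countLT, Fin.lt_def]
        ring
    · refine sum_congr ?_ ?_
      · ext ⟨i, j⟩
        rw [hoe, mem_filter, mem_filter, mem_filter]
        constructor
        · rintro ⟨⟨h1, h2, h3, h4⟩, h5⟩
          refine ⟨h1, h2, ?_, h4⟩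
          by_contra! h6
          exact h5 (hct _ _ h1 h6)
        · rintro ⟨h1, h2, h3, h4⟩
          refine ⟨⟨h1, h2, Nat.zero_le _, h4⟩, ?_⟩
          have h5 := h.lt _ _ h1
          rw [Fin.lt_def] at h5
          simp only at h3 ⊢; omega
      · rintro ⟨i, j⟩ hA
        rw [mem_filter] at hA
        have hAo : (i, j) ∈ outerLeft S D := by
          rw [hoe, mem_filter]
          exact ⟨hA.1, hA.2.1, Nat.zero_le _, hA.2.2.2⟩
        have hi : ∀ m ∈ U, m < i := fun m hm => by
          have := hUt m hm; have := hA.2.2.1; rw [Fin.lt_def]; simp only at this; omega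
        rw [h.cleanBI_split hAo, h.zMoving_split_behind hc hAo hi, hmind, hΘ1,
          arcWeight_erase hn h hA.1, filter_true_of_mem hi]
        ring
  have hpromote : cleanBI q M S (insert k U) (D.erase k) =
      P * upWeight q S U * (Θ * qint q (N + M + U.card)) *
        (qint q (N - e + M) * (qint q (U.card + arcsLeft S D + 1))⁻¹) := by
    have hc' : ¬ IsPairedOff M (D.erase k).card := by
      clear hcases; rintro ⟨h1, m', h2⟩; omega
    have hτ : U.card + 1 + S.card + tau M (D.erase k).card =
        U.card + S.card + tau M D.card + 1 := by
      clear hcases; rw [tau, htau]; omega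
    have hw : wBI q M D.card (rho S k) * qint q (N - e + M) = 1 := by
      clear hcases
      rw [wBI, if_neg (by omega), if_pos hc.2,
        show N - e + M = 2 * (rho S k + M + (D.card - M) / 2) by omega]
      exact inv_mul_cancel₀ (hn _ (by omega))
    rw [cleanBI, zMoving, if_neg hc', h.upWeight_promote hk, arcsLT_first hk hmin,
      card_insert_of_notMem hkU, hτ, show min (D.erase k).card (M - 1) = M - 1 by clear hcases; omega, hΘ1, hP,
      h.zStatic_erase_first hk hmin, if_neg hc', downWeight_erase_first hk hmin]
    linear_combination (-(arcWeight q S * ((qint q (U.card + arcsLeft S D + 1))⁻¹ *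
      upWeight q S U) * downWeight (wBI q M) S (D.erase k) * zStatic q M S (D.erase k) *
      (Θ * qint q (N + M + U.card)))) * hw
  have hdemote : ∑ l ∈ lastOf U, q⁻¹ ^ (U.card - 1) * q⁻¹ *
      cleanBI q M S (U.erase l) (insert l D) =
      q⁻¹ ^ U.card * qint q (U.card + arcsLT S t) * (P * upWeight q S U * Θ * L) := by
    rcases hcases with ⟨h1, h2, h3⟩ | ⟨l, hl, hmax, h3, h4, h5⟩
    · rw [h3, h1, h2, sum_empty, card_empty, arcsLT_zero, qint_zero]; ring
    · have hm' := h.demote hl hmax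
      have hlD : ∀ x ∈ D, l < x := h.up_lt_down l hl
      have hz := hm'.zStatic_insert (q := q) (M := M) hlD
      rw [insert_erase hl, if_pos hc] at hz
      have hc' : ¬ IsPairedOff M (D.card + 1) := by
        rintro ⟨h1, m', h2⟩; omega
      have hw : ∀ r, wBI q M (D.card + 1) r = 1 := by
        intro r
        rw [wBI, if_neg (by omega), if_neg (fun h => hc' ⟨by omega, h⟩)]
      have hU1 := card_erase_add_one hl
      have hτ : (U.erase l).card + S.card + tau M (D.card + 1) =
          U.card + S.card + tau M D.card := by rw [tau, htau]; omega
      have hnu := hn _ (nu_pos (S := S) hl)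
      rw [h4, sum_singleton, cleanBI, hz, downWeight_insert hlD, hw, zMoving,
        card_insert_of_notMem (fun hx => lt_irrefl _ (hlD l hx)), if_neg hc', hτ,
        show min (D.card + 1) (M - 1) = M - 1 by omega, IsMatching.upWeight_demote hl hmax, ← hΘ,
        ← pow_succ, show U.card - 1 + 1 = U.card by omega, ← h5]
      field_simp
      rw [hP]; ring
  rw [hshift, hself, hsum, hf, sum_singleton, hpromote, hdemote]
  have key := identity_BI hq hn (N - t + M) U.card (arcsLT S t)
  rw [show N - t + M + U.card + 2 * arcsLT S t = N + M by omega,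
    show N - t + M + U.card + arcsLT S t = N + M - arcsLT S t by omega,
    show N - t + M + 2 * U.card + 2 * arcsLT S t = N + M + U.card by omega,
    show N + M - arcsLT S t + 1 = N + 1 + M - arcsLT S t by omega, pow_add] at key
  linear_combination (-(P * upWeight q S U * Θ * L)) * key

end BIPairedOff

section NumberOrder

variable {N : ℕ} {D : Finset (Fin N)}

theorem numR_le_numR {k l : Fin N} (hk : k ∈ D) : numR D k ≤ numR D l ↔ l ≤ k := by
  constructor
  · intro h
    by_contra! h1
    refine absurd h (not_le.2 (card_lt_card ⟨fun m hm => ?_, fun h2 => ?_⟩))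
    · simp only [mem_filter] at hm ⊢; exact ⟨hm.1, h1.le.trans hm.2⟩
    · have := h2 (show k ∈ _ by simp [hk])
      simp only [mem_filter] at this
      exact absurd h1 (not_lt.2 this.2)
  · intro h
    exact card_le_card fun m hm => by
      simp only [mem_filter] at hm ⊢; exact ⟨hm.1, h.trans hm.2⟩

theorem numR_lt_numR {k l : Fin N} (hl : l ∈ D) : numR D k < numR D l ↔ l < k := by
  rw [← not_le, numR_le_numR hl, not_le]

theorem exists_numR_eq {n : ℕ} (h1 : 1 ≤ n) (h2 : n ≤ D.card) : ∃ k ∈ D, numR D k = n := by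
  have : n ∈ D.image (numR D) := by rw [image_numR, mem_Icc]; exact ⟨h1, h2⟩
  simpa using this

theorem numR_add_countLT (D : Finset (Fin N)) (k : Fin N) : numR D k + countLT D k = D.card := by
  rw [numR, countLT, ← card_filter_add_card_filter_not (s := D) (fun l => k ≤ l)]
  congr 2
  refine filter_congr fun l _ => ?_
  rw [Fin.le_def]; omega

theorem numR_inj {k l : Fin N} (hk : k ∈ D) (hl : l ∈ D) (h : numR D k = numR D l) : k = l :=
  numR_injOn D hk hl h

end NumberOrder

section BIKets

variable {K : Type*} [Field K] {N : ℕ} {q : K} {M : ℕ} {D : Finset (Fin N)}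

/-- The dashed arcs connecting elements of `D`. -/
def dashed (M : ℕ) (D : Finset (Fin N)) : Finset (Fin N × Fin N) :=
  univ.filter fun E => E.1 ∈ D ∧ E.2 ∈ D ∧ M < numR D E.2 ∧
    Odd (numR D E.2 - M) ∧ numR D E.1 = numR D E.2 + 1

theorem mem_dashed {E : Fin N × Fin N} : E ∈ dashed M D ↔ E.1 ∈ D ∧ E.2 ∈ D ∧ M < numR D E.2 ∧
    Odd (numR D E.2 - M) ∧ numR D E.1 = numR D E.2 + 1 := by simp [dashed]

/-- The condition that a remaining down arrow with the given number, out of `d`, is unpaired. -/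
def IsLoose (M d n : ℕ) : Prop := n = d ∧ M < d ∧ Odd (d - M)

instance (M d n : ℕ) : Decidable (IsLoose M d n) := inferInstanceAs (Decidable (_ ∧ _))

/-- The vectors of the remaining down arrows for type BI. -/
def kappaBI (q : K) (M N : ℕ) (D : Finset (Fin N)) (ε : Fin N → Bool) : K :=
  (∏ k ∈ D.filter (fun k => numR D k ≤ M), downVec (-(q ^ (M + 1 - numR D k))⁻¹) (ε k)) *
    (∏ E ∈ dashed M D, dashedVec q (ε E.1) (ε E.2)) *
    ∏ k ∈ D.filter (fun k => IsLoose M D.card (numR D k)), downVec 0 (ε k)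

theorem dashed_insert {k : Fin N} (h : ∀ l ∈ D, k < l) (hd : M < D.card → Even (D.card - M)) :
    dashed M (insert k D) = dashed M D := by
  have hk : k ∉ D := fun hk => lt_irrefl _ (h k hk)
  ext ⟨i, j⟩
  simp only [mem_dashed, mem_insert]
  constructor
  · rintro ⟨hi, hj, h1, h2, h3⟩
    have hj' : j ∈ D := by
      refine hj.resolve_left ?_
      rintro rfl
      rw [numR_insert_self h] at h3
      have := numR_le_card (insert j D) i
      rw [card_insert_of_notMem hk] at this
      omega
    rw [numR_insert_of_lt (h j hj')] at h1 h2 h3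
    have hi' : i ∈ D := by
      refine hi.resolve_left ?_
      rintro rfl
      rw [numR_insert_self h] at h3
      have := hd (by omega)
      rw [show numR D j = D.card by omega] at h2
      exact Nat.not_even_iff_odd.2 h2 this
    rw [numR_insert_of_lt (h i hi')] at h3
    exact ⟨hi', hj', h1, h2, h3⟩
  · rintro ⟨hi, hj, h1⟩
    rw [numR_insert_of_lt (h i hi), numR_insert_of_lt (h j hj)]
    exact ⟨Or.inr hi, Or.inr hj, h1⟩

theorem dashed_insert_insert {k y : Fin N} (hy : ∀ l ∈ D, y < l) (hky : k < y) (hM : M ≤ D.card)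
    (hd : Even (D.card - M)) :
    dashed M (insert k (insert y D)) = insert (k, y) (dashed M D) := by
  have hk : ∀ l ∈ insert y D, k < l := by
    intro l hl
    rcases mem_insert.1 hl with rfl | hl
    · exact hky
    · exact hky.trans (hy l hl)
  have hy' : y ∉ D := fun h => lt_irrefl _ (hy y h)
  have hk' : k ∉ insert y D := fun h => lt_irrefl _ (hk k h)
  rw [← dashed_insert hy (fun _ => hd)]
  ext ⟨i, j⟩
  simp only [mem_dashed, mem_insert (a := (i, j)), Prod.mk.injEq]
  constructor
  · rintro ⟨hi, hj, h1, h2, h3⟩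
    have hj' : j ∈ insert y D := by
      refine (mem_insert.1 hj).resolve_left ?_
      rintro rfl
      rw [numR_insert_self hk] at h3
      have := numR_le_card (insert j (insert y D)) i
      rw [card_insert_of_notMem hk'] at this
      omega
    rcases mem_insert.1 hi with rfl | hi
    · left
      refine ⟨rfl, ?_⟩
      rw [numR_insert_self hk, numR_insert_of_lt (hk j hj')] at h3
      refine numR_inj hj' (mem_insert_self y D) ?_
      rw [numR_insert_self hy, ← card_insert_of_notMem hy']
      omega
    · right
      rw [numR_insert_of_lt (hk j hj')] at h1 h2 h3
      rw [numR_insert_of_lt (hk i hi)] at h3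
      exact ⟨hi, hj', h1, h2, h3⟩
  · rintro (⟨rfl, rfl⟩ | ⟨hi, hj, h1⟩)
    · rw [numR_insert_self hk, numR_insert_of_lt hky, numR_insert_self hy,
        card_insert_of_notMem hy']
      refine ⟨mem_insert_self _ _, by simp, by omega, ?_, rfl⟩
      rw [show D.card + 1 - M = D.card - M + 1 by omega]
      exact hd.add_one
    · rw [numR_insert_of_lt (hk i hi), numR_insert_of_lt (hk j hj)]
      exact ⟨mem_insert_of_mem hi, mem_insert_of_mem hj, h1⟩

theorem dashed_shift : dashed M (shiftSet D) = shiftArcs (dashed M D) := by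
  ext ⟨i, j⟩
  rw [mem_dashed, shiftArcs, mem_image]
  constructor
  · rintro ⟨h1, h2, h3⟩
    simp only [shiftSet, mem_image] at h1 h2
    obtain ⟨i, hi, rfl⟩ := h1
    obtain ⟨j, hj, rfl⟩ := h2
    simp only [numR_shift] at h3
    exact ⟨(i, j), mem_dashed.2 ⟨hi, hj, h3⟩, rfl⟩
  · rintro ⟨⟨i', j'⟩, h, h'⟩
    rw [mem_dashed] at h
    simp only [Prod.mk.injEq] at h'
    obtain ⟨rfl, rfl⟩ := h'
    simp only [numR_shift]
    exact ⟨mem_image_of_mem _ h.1, mem_image_of_mem _ h.2.1, h.2.2⟩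

theorem prod_labelled_insert {k : Fin N} (h : ∀ l ∈ D, k < l) (ε : Fin N → Bool) :
    ∏ l ∈ (insert k D).filter (fun l => numR (insert k D) l ≤ M),
      downVec (-(q ^ (M + 1 - numR (insert k D) l))⁻¹) (ε l) =
    (if D.card + 1 ≤ M then downVec (-(q ^ (M - D.card))⁻¹) (ε k) else 1) *
      ∏ l ∈ D.filter (fun l => numR D l ≤ M), downVec (-(q ^ (M + 1 - numR D l))⁻¹) (ε l) := by
  rw [prod_filter, prod_filter, prod_numR_insert h
    (fun n l => if n ≤ M then downVec (-(q ^ (M + 1 - n))⁻¹) (ε l) else 1), Nat.add_sub_add_right]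

theorem prod_loose_insert {k : Fin N} (h : ∀ l ∈ D, k < l) (ε : Fin N → Bool) :
    ∏ l ∈ (insert k D).filter (fun l => IsLoose M (insert k D).card (numR (insert k D) l)),
      downVec (0 : K) (ε l) =
    if M < D.card + 1 ∧ Odd (D.card + 1 - M) then downVec 0 (ε k) else 1 := by
  rw [card_insert_of_notMem (fun hk => lt_irrefl _ (h k hk)), prod_filter, prod_numR_insert h
    (fun n l => if IsLoose M (D.card + 1) n then downVec (0 : K) (ε l) else 1), prod_eq_one, mul_one]
  · simp [IsLoose]
  · intro l _
    have := numR_le_card D l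
    rw [if_neg]
    rintro ⟨h1, -⟩; omega

theorem prod_loose_eq_one (h : ¬(M < D.card ∧ Odd (D.card - M))) (ε : Fin N → Bool) :
    ∏ l ∈ D.filter (fun l => IsLoose M D.card (numR D l)), downVec (0 : K) (ε l) = 1 := by
  rw [filter_eq_empty_iff.2, prod_empty]
  rintro l - ⟨-, h1⟩
  exact h h1

theorem kappaBI_insert_of_lt {k : Fin N} (h : ∀ l ∈ D, k < l) (hd : D.card < M)
    (ε : Fin N → Bool) :
    kappaBI q M N (insert k D) ε = downVec (-(q ^ (M - D.card))⁻¹) (ε k) * kappaBI q M N D ε := by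
  rw [kappaBI, prod_labelled_insert h, prod_loose_insert h, if_pos (by omega),
    if_neg (fun h => by omega), dashed_insert h (fun h => by omega), kappaBI,
    prod_loose_eq_one (fun h => by omega)]
  ring

theorem kappaBI_insert_of_even {k : Fin N} (h : ∀ l ∈ D, k < l) (hd : IsPairedOff M D.card)
    (ε : Fin N → Bool) :
    kappaBI q M N (insert k D) ε = downVec 0 (ε k) * kappaBI q M N D ε := by
  have h1 := hd.1
  rw [kappaBI, prod_labelled_insert h, prod_loose_insert h, if_neg (by omega), if_pos,
    dashed_insert h (fun _ => hd.2), kappaBI,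
    prod_loose_eq_one (fun h => Nat.not_even_iff_odd.2 h.2 hd.2)]
  · ring
  · rw [show D.card + 1 - M = D.card - M + 1 by omega]
    exact ⟨by omega, hd.2.add_one⟩

theorem kappaBI_insert_insert {k y : Fin N} (hy : ∀ l ∈ D, y < l) (hky : k < y)
    (hd : IsPairedOff M D.card) (ε : Fin N → Bool) :
    kappaBI q M N (insert k (insert y D)) ε = dashedVec q (ε k) (ε y) * kappaBI q M N D ε := by
  have h1 := hd.1
  have hk : ∀ l ∈ insert y D, k < l := by
    intro l hl
    rcases mem_insert.1 hl with rfl | hl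
    · exact hky
    · exact hky.trans (hy l hl)
  have hy' : y ∉ D := fun h => lt_irrefl _ (hy y h)
  rw [kappaBI, prod_labelled_insert hk, prod_labelled_insert hy, prod_loose_insert hk,
    card_insert_of_notMem hy', if_neg (by omega), if_neg (by omega), if_neg,
    dashed_insert_insert hy hky hd.1 hd.2, prod_insert, kappaBI,
    prod_loose_eq_one (fun h => Nat.not_even_iff_odd.2 h.2 hd.2)]
  · ring
  · exact fun h => hy' (mem_dashed.1 h).2.1
  · rintro ⟨-, h2⟩
    rw [show D.card + 1 + 1 - M = D.card - M + 1 + 1 by omega] at h2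
    exact Nat.not_odd_iff_even.2 hd.2.add_one.add_one h2

theorem isDownSystem_BI (hq : q ≠ 0) (hM : 1 ≤ M) :
    IsDownSystem q (kappaBI q M) (gammaBI q M)
      fun d => if M < d ∧ Odd (d - M) then q⁻¹ else 0 where
  nil ε := by
    have : dashed M (∅ : Finset (Fin 0)) = ∅ := by ext E; simp [mem_dashed]
    rw [kappaBI, this, prod_loose_eq_one (by simp)]
    simp
  shift N D x ε := by
    rw [kappaBI, kappaBI, ← shiftSet, dashed_shift, prod_shiftArcs, prod_filter, prod_filter,
      prod_filter, prod_filter, prod_shiftSet, prod_shiftSet]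
    simp only [numR_shift, Fin.cons_succ, card_shiftSet]
  step N D k ε h := by
    rcases lt_or_ge D.card M with hd | hd
    · rw [kappaBI_insert_of_lt h hd, if_neg (fun h => by omega), gammaBI, if_pos hd]
      have : q ^ D.card * (q ^ M)⁻¹ = (q ^ (M - D.card))⁻¹ := by
        rw [show M = D.card + (M - D.card) by omega, pow_add]
        have := pow_ne_zero D.card hq
        rw [show D.card + (M - D.card) - D.card = M - D.card by omega]
        field_simp
      rw [this]
      cases ε k <;> simp [downVec, upVec]
    · rw [gammaBI, if_neg (by omega)]
      rcases Nat.even_or_odd (D.card - M) with he | ho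
      · rw [kappaBI_insert_of_even h ⟨hd, he⟩,
          if_neg (fun h => Nat.not_even_iff_odd.2 h.2 he)]
        ring
      · obtain ⟨y, hy, hmin, hf⟩ := (firstOf_cases D).resolve_left
          (fun h => by rw [h.1, card_empty] at hd; omega)
        have hlt : ∀ l ∈ D.erase y, y < l := by
          intro l hl
          rw [mem_erase] at hl
          exact lt_of_le_of_ne (hmin l hl.2) hl.1.symm
        have hc := card_erase_add_one hy
        have hp : IsPairedOff M (D.erase y).card := by
          obtain ⟨m, hm⟩ := ho
          exact ⟨by omega, m, by omega⟩
        have e1 := kappaBI_insert_of_even (q := q) hlt hp ε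
        have e2 := kappaBI_insert_insert (q := q) hlt (h y hy) hp ε
        rw [insert_erase hy] at e1 e2
        rw [if_pos ⟨by obtain ⟨m, hm⟩ := ho; omega, ho⟩, hf, sum_singleton, e1, e2]
        cases ε k <;> cases ε y <;> simp [downVec, upVec, dashedVec]

end BIKets

section BISets

variable {K : Type*} [Field K] {N : ℕ} {q : K} {M : ℕ} {b : Fin N → Bool} {D : Finset (Fin N)}

theorem mem_lefts_dashed {k : Fin N} :
    k ∈ lefts (dashed M D) ↔ k ∈ D ∧ M < numR D k ∧ Even (numR D k - M) := by
  rw [mem_lefts]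
  constructor
  · rintro ⟨l, hl⟩
    simp only [mem_dashed] at hl
    obtain ⟨h1, h2, h3, h4, h5⟩ := hl
    refine ⟨h1, by omega, ?_⟩
    rw [h5, show numR D l + 1 - M = numR D l - M + 1 by omega]
    exact h4.add_one
  · rintro ⟨h1, h2, m, h3⟩
    obtain ⟨l, hl, hl'⟩ := exists_numR_eq (D := D) (n := numR D k - 1) (by omega) (by
      have := numR_le_card D k; omega)
    exact ⟨l, mem_dashed.2 ⟨h1, hl, by simp only; omega, ⟨m - 1, by simp only; omega⟩,
      by simp only; omega⟩⟩

theorem lefts_dashed :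
    lefts (dashed M D) = D.filter fun k => M < numR D k ∧ Even (numR D k - M) := by
  ext k
  rw [mem_lefts_dashed, mem_filter]

theorem fst_injOn_dashed : Set.InjOn Prod.fst (dashed M D : Set (Fin N × Fin N)) := by
  rintro ⟨i, j⟩ h ⟨i', j'⟩ h' e
  simp only at e
  subst e
  rw [mem_coe, mem_dashed] at h h'
  simp only at h h'
  rw [numR_inj h.2.1 h'.2.1 (by omega)]

theorem card_Icc_filter_even_sub (n : ℕ) :
    ((Icc 1 n).filter fun n => M < n ∧ Even (n - M)).card = (n - M) / 2 := by
  induction n with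
  | zero => simp
  | succ n ih =>
    rw [← insert_Icc_right_eq_Icc_add_one (by omega), filter_insert]
    split_ifs with h
    · rw [card_insert_of_notMem (by simp), ih]
      obtain ⟨h1, m, hm⟩ := h; omega
    · rw [ih]
      by_cases h1 : M < n + 1
      · have h2 : ¬ Even (n + 1 - M) := fun h2 => h ⟨h1, h2⟩
        rw [Nat.not_even_iff_odd] at h2
        obtain ⟨m, hm⟩ := h2; omega
      · omega

theorem card_dashed : (dashed M D).card = (D.card - M) / 2 := by
  rw [← card_image_of_injOn fst_injOn_dashed, ← lefts, lefts_dashed,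
    card_filter_numR D (fun n => M < n ∧ Even (n - M)), card_Icc_filter_even_sub]

theorem card_filter_numR_lt : (D.filter fun k => numR D k < M).card = min D.card (M - 1) := by
  rw [card_filter_numR D (fun n => n < M)]
  have : (Icc 1 D.card).filter (fun n => n < M) = Icc 1 (min D.card (M - 1)) := by
    ext n; simp only [mem_filter, mem_Icc]; omega
  rw [this, Nat.card_Icc]; omega

theorem card_filter_numR_le : (D.filter fun k => numR D k ≤ M).card = min D.card M := by
  rw [card_filter_numR D (fun n => n ≤ M)]
  have : (Icc 1 D.card).filter (fun n => n ≤ M) = Icc 1 (min D.card M) := by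
    ext n; simp only [mem_filter, mem_Icc]; omega
  rw [this, Nat.card_Icc]; omega

namespace BI

theorem T_eq : T M b = dashed M (downs b) := rfl

theorem labelled_one : labelled M b 1 = (downs b).filter fun k => numR (downs b) k = M := by
  refine filter_congr fun k hk => ?_
  rw [label, downNum]; omega

theorem labelled_self (hM : 1 ≤ M) :
    labelled M b M = (downs b).filter fun k => numR (downs b) k = 1 := by
  refine filter_congr fun k hk => ?_
  have := numR_pos hk
  rw [label, downNum]; omega

theorem U_eq : U M b = (downs b).filter fun k => numR (downs b) k < M := by
  refine filter_congr fun k hk => ?_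
  have := numR_pos hk
  rw [label, downNum]; omega

theorem U'_eq :
    U' M b = (downs b).filter fun k => 2 ≤ numR (downs b) k ∧ numR (downs b) k < M := by
  refine filter_congr fun k hk => ?_
  have := numR_pos hk
  rw [label, downNum]; omega

theorem V_eq : V M b = (downs b).filter fun k => numR (downs b) k ≤ M := by
  rw [V, U_eq, labelled_one, ← filter_or]
  exact filter_congr fun k _ => by omega

theorem unpaired_eq : unpaired M b =
    (downs b).filter fun k => IsLoose M (downs b).card (numR (downs b) k) := by
  refine filter_congr fun k hk => ?_
  rw [downNum, T_eq]
  have hle := numR_le_card (downs b) k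
  constructor
  · rintro ⟨h1, h2⟩
    have h3 : Odd (numR (downs b) k - M) := by
      rw [← Nat.not_even_iff_odd]
      intro h3
      obtain ⟨l, hl⟩ := mem_lefts.1 (mem_lefts_dashed.2 ⟨hk, h1, h3⟩)
      exact (h2 _ hl).1 rfl
    have h4 : numR (downs b) k = (downs b).card := by
      by_contra h4
      obtain ⟨l, hl, hl'⟩ := exists_numR_eq (D := downs b) (n := numR (downs b) k + 1) (by omega)
        (by omega)
      exact (h2 (l, k) (mem_dashed.2 ⟨hl, hk, h1, h3, hl'⟩)).2 rfl
    exact ⟨h4, by omega, by rwa [← h4]⟩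
  · rintro ⟨h1, h2, h3⟩
    refine ⟨by omega, fun E hE => ⟨?_, ?_⟩⟩
    · rintro rfl
      have := (mem_lefts_dashed.1 (mem_lefts.2 ⟨E.2, hE⟩)).2.2
      rw [h1] at this
      exact Nat.not_odd_iff_even.2 this h3
    · rintro rfl
      have h4 := (mem_dashed.1 hE).2.2.2.2
      have := numR_le_card (downs b) E.1
      omega

theorem N₁_eq : N₁ M b = if M < (downs b).card ∧ Odd ((downs b).card - M) then 1 else 0 := by
  rw [N₁, unpaired_eq]
  split_ifs with h
  · obtain ⟨l, hl, hl'⟩ := exists_numR_eq (D := downs b) (n := (downs b).card) (by omega) le_rfl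
    rw [card_eq_one]
    refine ⟨l, ?_⟩
    ext k
    rw [mem_filter, mem_singleton]
    constructor
    · rintro ⟨h1, h2, -⟩
      exact numR_inj h1 hl (by omega)
    · rintro rfl
      exact ⟨hl, hl', h⟩
  · rw [card_eq_zero, filter_eq_empty_iff]
    rintro k - ⟨-, h1⟩
    exact h h1

theorem N₁_add_card_T : N₁ M b + (T M b).card = tau M (downs b).card := by
  rw [N₁_eq, T_eq, card_dashed, tau]
  split_ifs with h
  · obtain ⟨h1, m, hm⟩ := h; omega
  · by_cases h1 : M < (downs b).card
    · have : ¬ Odd ((downs b).card - M) := fun h2 => h ⟨h1, h2⟩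
      rw [Nat.not_odd_iff_even] at this
      obtain ⟨m, hm⟩ := this; omega
    · omega

theorem ket_eq : ket q M b = genKet q (kappaBI q M N) b := by
  ext ε
  rw [ket, genKet, kappaBI, V_eq, unpaired_eq, T_eq]
  simp only [label, downNum]
  ring

theorem N₁₁_eq (hn : ∀ n : ℕ, 1 ≤ n → qint q n ≠ 0) :
    N₁₁ q M b = qfact q ((ups b).card + (arcs b).card + tau M (downs b).card +
      min (downs b).card (M - 1)) * upWeight q (arcs b) (ups b) := by
  have h := isMatching b
  have d1 : Disjoint (lefts (T M b)) (U M b) := by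
    rw [T_eq, lefts_dashed, U_eq, disjoint_filter]
    rintro k - h1 h2; omega
  have d2 : Disjoint (lefts (T M b) ∪ U M b) (unpaired M b) := by
    rw [T_eq, lefts_dashed, U_eq, unpaired_eq, disjoint_union_left, disjoint_filter,
      disjoint_filter]
    refine ⟨?_, ?_⟩
    · rintro k - ⟨h1, h2⟩ ⟨h3, h4, h5⟩
      rw [h3] at h2
      exact Nat.not_even_iff_odd.2 h5 h2
    · rintro k - h1 ⟨h3, h4, h5⟩; omega
  have hE : lefts (T M b) ∪ U M b ∪ unpaired M b ⊆ downs b := by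
    refine union_subset (union_subset ?_ ?_) ?_
    · rw [T_eq, lefts_dashed]; exact filter_subset _ _
    · exact filter_subset _ _
    · exact filter_subset _ _
  have hc : (lefts (T M b) ∪ U M b ∪ unpaired M b).card =
      tau M (downs b).card + min (downs b).card (M - 1) := by
    rw [card_union_of_disjoint d2, card_union_of_disjoint d1, ← N₁_add_card_T, N₁, U_eq,
      card_filter_numR_lt, lefts, card_image_of_injOn (T_eq (b := b) ▸ fst_injOn_dashed)]
    omega
  have e1 : lefts (arcs b) ∪ lefts (T M b) ∪ U M b ∪ unpaired M b =
      lefts (arcs b) ∪ (lefts (T M b) ∪ U M b ∪ unpaired M b) := by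
    simp only [union_assoc]
  have e2 : ups b ∪ unpaired M b ∪ lefts (arcs b) ∪ lefts (T M b) ∪ U M b =
      lefts (arcs b) ∪ ups b ∪ (lefts (T M b) ∪ U M b ∪ unpaired M b) := by
    ext k; simp only [mem_union]; tauto
  rw [N₁₁, e1, e2, h.prod_numL_eq hn hE, hc, add_assoc _ (tau M (downs b).card)]

/-- The number of a labelled arrow or of the left end of a dashed arc, where a dashed arc counts
as one object. -/
def level (M n : ℕ) : ℕ := min n M + (n - M) / 2

theorem numR_lefts_T (k : Fin N) :
    numR (lefts (T M b)) k = (numR (downs b) k - M) / 2 := by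
  rw [T_eq, lefts_dashed, numR_filter_numR (downs b) (fun n => M < n ∧ Even (n - M)),
    card_Icc_filter_even_sub]

theorem numR_V (k : Fin N) : numR (V M b) k = min (numR (downs b) k) M := by
  rw [V_eq, numR_filter_numR (downs b) (fun n => n ≤ M)]
  have : (Icc 1 (numR (downs b) k)).filter (fun n => n ≤ M) =
      Icc 1 (min (numR (downs b) k) M) := by
    ext n; simp only [mem_filter, mem_Icc]; omega
  rw [this, Nat.card_Icc]; omega

theorem lefts_T_union_labelled_one : lefts (T M b) ∪ labelled M b 1 =
    (downs b).filter fun k => IsPairedOff M (numR (downs b) k) := by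
  rw [T_eq, lefts_dashed, labelled_one, ← filter_or]
  refine filter_congr fun k _ => ?_
  constructor
  · rintro (⟨h1, h2⟩ | h1)
    · exact ⟨h1.le, h2⟩
    · exact ⟨h1.ge, by simp [h1]⟩
  · rintro ⟨h1, h2⟩
    rcases h1.lt_or_eq with h1 | h1
    · exact Or.inl ⟨h1, h2⟩
    · exact Or.inr h1.symm

theorem N₁₂_eq : N₁₂ q M b =
    (∏ i ∈ range ((ups b).card + (arcs b).card + tau M (downs b).card), sym (q ^ (M + i))) *
      ∏ k ∈ (downs b).filter (fun k => IsPairedOff M (numR (downs b) k)),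
        (sym (q ^ (rho (arcs b) k + level M (numR (downs b) k))))⁻¹ := by
  have h := isMatching b
  have hE : lefts (T M b) ∪ V M b ⊆ downs b := by
    refine union_subset ?_ ?_
    · rw [T_eq, lefts_dashed]; exact filter_subset _ _
    · rw [V_eq]; exact filter_subset _ _
  have hd : Disjoint (lefts (T M b)) (V M b) := by
    rw [T_eq, lefts_dashed, V_eq, disjoint_filter]
    rintro k - h1 h2; omega
  rw [N₁₂, lefts_T_union_labelled_one, div_eq_mul_inv, ← prod_inv_distrib, prod_Icc_one]
  congr 1
  · have : N₂ M b = (ups b).card + (arcs b).card + tau M (downs b).card := by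
      rw [N₂, ← N₁_add_card_T]; ring
    rw [this]
    refine prod_congr rfl fun i _ => ?_
    congr 2; omega
  · refine prod_congr rfl fun k _ => ?_
    rw [union_assoc, h.numR_lefts_union hE, numR, filter_union,
      card_union_of_disjoint (disjoint_filter_filter hd), ← numR, ← numR, numR_lefts_T, numR_V,
      level, add_comm (_ / 2)]

theorem downWeight_wBI : downWeight (wBI q M) (arcs b) (downs b) =
    (∏ k ∈ (downs b).filter (fun k => numR (downs b) k < M),
      (qint q (rho (arcs b) k + level M (numR (downs b) k)))⁻¹) *
    ∏ k ∈ (downs b).filter (fun k => IsPairedOff M (numR (downs b) k)),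
      (qint q (2 * (rho (arcs b) k + level M (numR (downs b) k))))⁻¹ := by
  rw [downWeight, prod_filter, prod_filter, ← prod_mul_distrib]
  refine prod_congr rfl fun k _ => ?_
  rw [wBI, level]
  by_cases h1 : numR (downs b) k < M
  · rw [if_pos h1, if_pos h1, if_neg (fun h => by have := h.1; omega), mul_one]
    congr 2; omega
  · rw [if_neg h1, if_neg h1, one_mul]
    by_cases h2 : Even (numR (downs b) k - M)
    · rw [if_pos h2, if_pos ⟨by omega, h2⟩]
      congr 2; omega
    · rw [if_neg h2, if_neg (fun h => h2 h.2)]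

end BI

end BISets

section BIDistances

variable {K : Type*} [Field K] {N : ℕ} {q : K} {M : ℕ} {b : Fin N → Bool}
  {S : Finset (Fin N × Fin N)} {U D : Finset (Fin N)}

theorem IsMatching.down_pos (h : IsMatching b S U D) {k : Fin N} (hk : k ∈ D) :
    (k : ℕ) + numR D k + 2 * rho S k = N := by
  have h1 := h.eq_count (t := k) (by omega) (h.isCut_down hk)
  rw [countLT_of_le U (fun l hl => h.up_lt_down l hl k hk)] at h1
  have h2 := h.length_eq
  have h3 := numR_add_countLT D k
  have h4 := rho_add_arcsLT S k
  omega

theorem IsMatching.rho_eq_card_lt (h : IsMatching b S U D) {k : Fin N} (hk : k ∈ D) :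
    (S.filter fun A => k < A.1).card = rho S k := by
  rw [rho]
  congr 1
  refine filter_congr ?_
  rintro ⟨i, j⟩ hA
  have := h.down_out k hk i j hA
  have := h.lt _ _ hA
  simp only; grind

theorem IsMatching.rho_sub (h : IsMatching b S U D) {k l : Fin N} (hk : k ∈ D) (hl : l ∈ D)
    (hkl : k ≤ l) : (S.filter fun A => k < A.1 ∧ A.2 < l).card = rho S k - rho S l := by
  have h1 : S.filter (fun A => k < A.1 ∧ A.2 < l) =
      (S.filter fun A => k < A.1) \ (S.filter fun A => l < A.1) := by
    ext ⟨i, j⟩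
    simp only [mem_filter, mem_sdiff]
    constructor
    · rintro ⟨h1, h2, h3⟩
      have := h.lt _ _ h1
      exact ⟨⟨h1, h2⟩, fun h4 => by grind⟩
    · rintro ⟨⟨h1, h2⟩, h3⟩
      refine ⟨h1, h2, ?_⟩
      exact (h.down_out l hl i j h1).resolve_left fun h4 => h3 ⟨h1, h4⟩
  rw [h1, card_sdiff_of_subset, h.rho_eq_card_lt hk, h.rho_eq_card_lt hl]
  intro A hA
  rw [mem_filter] at hA ⊢
  exact ⟨hA.1, lt_of_le_of_lt hkl hA.2⟩

namespace BI

theorem labelled_one_of {k : Fin N} (hk : k ∈ downs b) (hkM : numR (downs b) k = M) :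
    labelled M b 1 = {k} := by
  rw [labelled_one]
  ext l
  rw [mem_filter, mem_singleton]
  constructor
  · rintro ⟨h1, h2⟩; exact numR_inj h1 hk (by omega)
  · rintro rfl; exact ⟨hk, hkM⟩

theorem labelled_self_of (hM : 1 ≤ M) {k : Fin N} (hk : k ∈ downs b)
    (hk1 : numR (downs b) k = 1) : labelled M b M = {k} := by
  rw [labelled_self hM]
  ext l
  rw [mem_filter, mem_singleton]
  constructor
  · rintro ⟨h1, h2⟩; exact numR_inj h1 hk (by omega)
  · rintro rfl; exact ⟨hk, hk1⟩

theorem card_SR (hM : 1 ≤ M) {k : Fin N} (hk : k ∈ downs b) (hk1 : numR (downs b) k = 1) :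
    (SR M b).card = rho (arcs b) k := by
  rw [SR, labelled_self_of hM hk hk1, ← (isMatching b).rho_eq_card_lt hk]
  simp

theorem d₄_eq (hM : 1 ≤ M) {C : Fin N} (hC : C ∈ downs b) (hCM : numR (downs b) C ≤ M) :
    d₄ M b C = level M (numR (downs b) C) + (rho (arcs b) C - (SR M b).card) := by
  obtain ⟨R, hR, hR1⟩ := exists_numR_eq (D := downs b) (n := 1) le_rfl
    (card_pos.2 ⟨C, hC⟩)
  have h := isMatching b
  have h1 := h.down_pos hC
  have h2 := h.down_pos hR
  have h3 := numR_pos hC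
  have h4 : C ≤ R := (numR_le_numR hR).1 (by omega)
  have h5 := rho_anti (arcs b) h4
  rw [card_SR hM hR hR1, d₄, s, labelled_self_of hM hR hR1, sum_singleton, level, label, downNum,
    pos, pos]
  rw [Fin.le_def] at h4
  omega

theorem d₅_eq (hM : 1 ≤ M) {E : Fin N × Fin N} (hE : E ∈ T M b) :
    d₅ M b E = level M (numR (downs b) E.1) + (rho (arcs b) E.1 - (SR M b).card) := by
  obtain ⟨hC, hCM, m, hm⟩ := mem_lefts_dashed.1 (mem_lefts.2 ⟨E.2, hE⟩)
  obtain ⟨R, hR, hR1⟩ := exists_numR_eq (D := downs b) (n := 1) le_rfl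
    (card_pos.2 ⟨_, hC⟩)
  have h := isMatching b
  have h1 := h.down_pos hC
  have h2 := h.down_pos hR
  have h4 : E.1 ≤ R := (numR_le_numR hR).1 (by omega)
  have h5 := rho_anti (arcs b) h4
  rw [card_SR hM hR hR1, d₅, s, labelled_self_of hM hR hR1, sum_singleton, level,
    pos, pos]
  rw [Fin.le_def] at h4
  omega

theorem mem_outer_SR (hM : 1 ≤ M) {R : Fin N} (hR : R ∈ downs b) (hR1 : numR (downs b) R = 1)
    {A : Fin N × Fin N} : A ∈ outer M b (SR M b) ↔ A ∈ (arcs b).filter (fun A =>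
      (∀ B ∈ arcs b, ¬(B.1 < A.1 ∧ A.2 < B.2)) ∧ (R : ℕ) + 1 ≤ A.1 ∧ (A.2 : ℕ) < N) := by
  have h := isMatching b
  rw [outer, SR, labelled_self_of hM hR hR1, mem_filter, mem_filter, mem_filter]
  constructor
  · rintro ⟨⟨h1, k, h2, h3⟩, h4⟩
    rw [mem_singleton] at h2
    subst h2
    exact ⟨h1, fun B hB => h4 B (mem_union_left _ hB), h3, A.2.2⟩
  · rintro ⟨h1, h2, h3, -⟩
    refine ⟨⟨h1, R, mem_singleton_self R, h3⟩, fun B hB => ?_⟩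
    rcases mem_union.1 hB with hB | hB
    · exact h2 B hB
    · rintro ⟨-, h5⟩
      have h6 := (mem_dashed.1 hB).2.1
      have h7 : B.2 ≤ R := (numR_le_numR hR).1 (by rw [hR1]; exact numR_pos h6)
      have h8 := h.lt _ _ h1
      rw [Fin.le_def] at h7
      simp only [Fin.lt_def] at h5 h8
      omega

theorem outer_SR_pos (hM : 1 ≤ M) {C : Fin N} (hC : C ∈ downs b) {A : Fin N × Fin N}
    (hA : A ∈ outer M b (SR M b)) : arcsLT (arcs b) C ≤ arcsLT (arcs b) A.1 ∧
      (A.1 : ℕ) = C + numR (downs b) C + 2 * (arcsLT (arcs b) A.1 - arcsLT (arcs b) C) := by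
  obtain ⟨R, hR, hR1⟩ := exists_numR_eq (D := downs b) (n := 1) le_rfl
    (card_pos.2 ⟨C, hC⟩)
  rw [mem_outer_SR hM hR hR1, mem_filter] at hA
  obtain ⟨h1, h2, h3, -⟩ := hA
  have h := isMatching b
  have hD : ∀ k ∈ downs b, (k : ℕ) < A.1 := by
    intro k hk
    have : k ≤ R := (numR_le_numR hR).1 (by rw [hR1]; exact numR_pos hk)
    rw [Fin.le_def] at this; omega
  have h4 := h.eq_count (t := A.1) (by omega) (h.isCut_fst h1 h2)
  rw [countLT_of_le _ hD, countLT_of_le] at h4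
  · have h5 := h.down_pos hC
    have h6 := h.length_eq
    have h7 := rho_add_arcsLT (arcs b) C
    have h8 := arcsLT_mono (arcs b) (hD C hC).le
    omega
  · intro k hk
    have := h.up_lt_down k hk R hR
    rw [Fin.lt_def] at this; omega

theorem d₁_eq (hM : 1 ≤ M) {C : Fin N} (hC : C ∈ downs b) (hCM : numR (downs b) C ≤ M)
    {A : Fin N × Fin N} (hA : A ∈ outer M b (SR M b)) :
    d₁ M b A C =
      level M (numR (downs b) C) + (arcsLT (arcs b) A.1 - arcsLT (arcs b) C) := by
  obtain ⟨h1, h2⟩ := outer_SR_pos hM hC hA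
  have h3 := numR_pos hC
  rw [d₁, label, downNum, pos, pos, level]
  omega

theorem d₂_eq (hM : 1 ≤ M) {C : Fin N} (hC : C ∈ downs b) (hCM : numR (downs b) C = M)
    {A : Fin N × Fin N} (hA : A ∈ outer M b (SR M b)) :
    d₂ M b A = M + (arcsLT (arcs b) A.1 - arcsLT (arcs b) C) := by
  obtain ⟨h1, h2⟩ := outer_SR_pos hM hC hA
  rw [d₂, s, labelled_one_of hC hCM, sum_singleton, pos, pos]
  omega

theorem prod_outer_SR (hM : 1 ≤ M) (hn : ∀ n : ℕ, 1 ≤ n → qint q n ≠ 0) {C : Fin N}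
    (hC : C ∈ downs b) {c : ℕ} (hc : 1 ≤ c) :
    ∏ A ∈ outer M b (SR M b), qint q (c + (arcsLT (arcs b) A.1 - arcsLT (arcs b) C)) /
      qint q (c + (arcsLT (arcs b) A.1 - arcsLT (arcs b) C) + size A) =
    qint q (c + (rho (arcs b) C - (SR M b).card)) / qint q (rho (arcs b) C + c) := by
  obtain ⟨R, hR, hR1⟩ := exists_numR_eq (D := downs b) (n := 1) le_rfl
    (card_pos.2 ⟨C, hC⟩)
  have h := isMatching b
  have hCR : C ≤ R := (numR_le_numR hR).1 (by rw [hR1]; exact numR_pos hC)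
  have hDR : ∀ k ∈ downs b, (k : ℕ) < R + 1 := by
    intro k hk
    have : k ≤ R := (numR_le_numR hR).1 (by rw [hR1]; exact numR_pos hk)
    rw [Fin.le_def] at this; omega
  have key := h.prod_outer_telescope
    (fun t => qint q (c + (arcsLT (arcs b) t - arcsLT (arcs b) C)))
    (fun A => qint q (c + (arcsLT (arcs b) A.1 - arcsLT (arcs b) C)) /
      qint q (c + (arcsLT (arcs b) A.1 - arcsLT (arcs b) C) + size A)) le_rfl
    IsMatching.isCut_top _ (R + 1) rfl R.2 (h.isCut_down_succ hR)
    (fun k hk => Or.inl (hDR k hk)) ?_ ?_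
  · have e1 : arcsLT (arcs b) N = (arcs b).card := by
      rw [arcsLT, filter_true_of_mem fun A _ => A.1.2]
    have e2 := rho_add_arcsLT (arcs b) C
    have e3 := rho_add_arcsLT (arcs b) R
    have e4 : arcsLT (arcs b) (R + 1) = arcsLT (arcs b) R := by
      refine arcsLT_eq_of_notMem (by omega) fun i j hij => ?_
      have := h.down_out R hR i j hij
      have := h.lt _ _ hij
      simp only [Fin.lt_def] at *; omega
    have e5 := rho_anti (arcs b) hCR
    rw [e1, e4, show (arcs b).card - arcsLT (arcs b) C = rho (arcs b) C by omega,
      show arcsLT (arcs b) R - arcsLT (arcs b) C = rho (arcs b) C - (SR M b).card by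
        rw [card_SR hM hR hR1]; omega] at key
    rw [← key, add_comm (rho _ _), mul_div_cancel_right₀ _ (hn _ (by omega))]
    exact prod_congr (by ext A; exact mem_outer_SR hM hR hR1) fun _ _ => rfl
  · intro k hk h1
    have := h.up_lt_down k hk R hR
    rw [Fin.lt_def] at this; omega
  · intro i j hij ho hi _
    have := arcsLT_mono (arcs b) (s := C) (t := i) (by rw [Fin.le_def] at hCR; omega)
    simp only
    rw [h.arcsLT_snd hij ho,
      show c + (arcsLT (arcs b) i + size (i, j) - arcsLT (arcs b) C) =
        c + (arcsLT (arcs b) i - arcsLT (arcs b) C) + size (i, j) by omega,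
      div_mul_cancel₀ _ (hn _ (by omega))]

theorem N₇_eq (hM : 1 ≤ M) (hn : ∀ n : ℕ, 1 ≤ n → qint q n ≠ 0) :
    N₇ q M b = ∏ k ∈ (downs b).filter (fun k => numR (downs b) k < M),
      qint q (level M (numR (downs b) k) + (rho (arcs b) k - (SR M b).card)) /
        qint q (rho (arcs b) k + level M (numR (downs b) k)) := by
  rw [N₇, U_eq]
  refine prod_congr rfl fun k hk => ?_
  rw [mem_filter] at hk
  have := numR_pos hk.1
  rw [← prod_outer_SR hM hn hk.1 (by rw [level]; omega)]
  refine prod_congr rfl fun A hA => ?_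
  rw [d₁_eq hM hk.1 hk.2.le hA]

end BI

end BIDistances
namespace BI

section BIComponents

variable {K : Type*} [Field K] {N : ℕ} {q : K} {M : ℕ} {b : Fin N → Bool}

theorem mem_SW {A : Fin N × Fin N} : A ∈ SW M b ↔
    A ∈ arcs b ∧ (∃ k ∈ downs b, k < A.1) ∧ ∃ k ∈ labelled M b 1, A.2 < k := by
  have h := isMatching b
  rw [SW, mem_filter]
  refine and_congr_right fun hA => ?_
  rw [and_comm]
  refine and_congr_left fun hs => ?_
  obtain ⟨s, hs, hAs⟩ := hs
  rw [labelled_one, mem_filter] at hs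
  have hlt := h.lt _ _ hA
  constructor
  · intro h1
    split_ifs at h1
    · obtain ⟨k, hk, hk'⟩ := h1
      exact ⟨k, (mem_filter.1 hk).1, hk'⟩
    · obtain ⟨E, hE, hE'⟩ := h1
      exact ⟨E.1, (mem_dashed.1 hE).1, hE'⟩
  · rintro ⟨k, hk, hkA⟩
    obtain ⟨l, hl, hl'⟩ := exists_numR_eq (D := downs b) (n := (downs b).card)
      (card_pos.2 ⟨k, hk⟩) le_rfl
    have hlk : l ≤ k := (numR_le_numR hk).1 (by rw [hl']; exact numR_le_card _ _)
    have hks : M < numR (downs b) k := by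
      rw [← hs.2, numR_lt_numR hk]
      exact hkA.trans (hlt.trans hAs)
    have hd := numR_le_card (downs b) k
    have hN := N₁_eq (M := M) (b := b)
    by_cases hodd : Odd ((downs b).card - M)
    · rw [if_pos ⟨by omega, hodd⟩] at hN
      rw [if_pos hN]
      refine ⟨l, ?_, lt_of_le_of_lt hlk hkA⟩
      rw [unpaired_eq, mem_filter]
      exact ⟨hl, hl', by omega, hodd⟩
    · rw [if_neg (fun h => hodd h.2)] at hN
      rw [if_neg (by omega)]
      obtain ⟨j, hj⟩ := mem_lefts.1 (mem_lefts_dashed.2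
        ⟨hl, by omega, by rw [hl']; exact Nat.not_odd_iff_even.1 hodd⟩ : l ∈ lefts (dashed M _))
      exact ⟨(l, j), hj, lt_of_le_of_lt hlk hkA⟩

theorem snd_injOn_SW : Set.InjOn Prod.snd (SW M b : Set (Fin N × Fin N)) := by
  rintro ⟨i, j⟩ hA ⟨i', j'⟩ hB e
  simp only at e
  subst e
  rw [(isMatching b).snd_inj _ _ _ (mem_SW.1 hA).1 (mem_SW.1 hB).1]

/-- The right ends of the arcs in `S_W` and the left ends of the dashed arcs. -/
def marks (M : ℕ) (b : Fin N → Bool) : Finset (Fin N) := (SW M b).image Prod.snd ∪ lefts (T M b)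

theorem disjoint_marks : Disjoint ((SW M b).image Prod.snd) (lefts (T M b)) := by
  rw [disjoint_left]
  intro k h1 h2
  rw [mem_image] at h1
  obtain ⟨A, hA, rfl⟩ := h1
  have h := isMatching b
  have h3 := h.snd_true _ _ (mem_SW.1 hA).1
  rw [h.down _ (mem_lefts_dashed.1 h2).1] at h3
  exact absurd h3 (by simp)

theorem card_marks : (marks M b).card = N₃ M b := by
  rw [marks, card_union_of_disjoint disjoint_marks, card_image_of_injOn snd_injOn_SW, lefts,
    card_image_of_injOn (T_eq (b := b) ▸ fst_injOn_dashed), N₃]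

theorem numR_marks_snd {A : Fin N × Fin N} (hA : A ∈ SW M b) :
    numR (marks M b) A.2 = h M b A := by
  have hm := isMatching b
  have hA1 := (mem_SW.1 hA).1
  have hlt := hm.lt _ _ hA1
  rw [numR, marks, filter_union, card_union_of_disjoint (disjoint_filter_filter disjoint_marks), h,
    filter_image, card_image_of_injOn (snd_injOn_SW.mono (by
      intro x hx; exact (mem_filter.1 hx).1)), lefts, filter_image,
    card_image_of_injOn ((T_eq (b := b) ▸ fst_injOn_dashed : Set.InjOn Prod.fst
      (T M b : Set (Fin N × Fin N))).mono (by intro x hx; exact (mem_filter.1 hx).1))]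
  congr 2
  · refine filter_congr fun B hB => ?_
    have hB1 := (mem_SW.1 hB).1
    have h1 := hm.noncross _ _ _ _ hB1 hA1
    have h2 := hm.noncross _ _ _ _ hA1 hB1
    have h3 := hm.lt _ _ hB1
    have h4 := hm.fst_ne_snd hB1 hA1
    have h6 : B.1 = A.1 → B.2 = A.2 := fun e =>
      hm.fst_inj B.1 B.2 A.2 hB1 (by rw [e]; exact hA1)
    simp only [Fin.lt_def, Fin.le_def, Fin.ext_iff, ne_eq] at *
    omega
  · refine filter_congr fun E hE => ?_
    have h1 := hm.down_out _ (mem_dashed.1 hE).1 _ _ hA1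
    simp only [Fin.lt_def, Fin.le_def] at *
    omega

theorem numR_marks_fst {s E : Fin N} (hs : s ∈ downs b) (hsM : numR (downs b) s = M)
    (hE : E ∈ lefts (T M b)) :
    numR (marks M b) E = (numR (downs b) E - M) / 2 + (rho (arcs b) E - rho (arcs b) s) := by
  have hm := isMatching b
  obtain ⟨hE1, hE2, -⟩ := mem_lefts_dashed.1 hE
  have hEs : E < s := (numR_lt_numR hE1).1 (by omega)
  rw [numR, marks, filter_union, card_union_of_disjoint (disjoint_filter_filter disjoint_marks),
    add_comm]
  change numR (lefts (T M b)) E + _ = _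
  rw [numR_lefts_T, filter_image, card_image_of_injOn (snd_injOn_SW.mono (by
      intro x hx; exact (mem_filter.1 hx).1)), ← hm.rho_sub hE1 hs hEs.le]
  congr 2
  ext A
  rw [mem_filter, mem_filter, mem_SW, labelled_one_of hs hsM]
  simp only [mem_singleton, exists_eq_left]
  constructor
  · rintro ⟨⟨h1, h2, h3⟩, h4⟩
    have := hm.down_out _ hE1 _ _ h1
    exact ⟨h1, this.resolve_right (not_lt.2 h4), h3⟩
  · rintro ⟨h1, h2, h3⟩
    exact ⟨⟨h1, ⟨E, hE1, h2⟩, h3⟩, (h2.trans (hm.lt _ _ h1)).le⟩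

theorem prod_range_N₃ (g : ℕ → K) (hg : ∀ i, g i ≠ 0) :
    (∏ i ∈ range (N₃ M b + 1), g i) * ∏ A ∈ SW M b, (g (h M b A))⁻¹ =
      g 0 * ∏ k ∈ lefts (T M b), g (numR (marks M b) k) := by
  have h1 : ∏ A ∈ SW M b, (g (h M b A))⁻¹ =
      (∏ k ∈ (SW M b).image Prod.snd, g (numR (marks M b) k))⁻¹ := by
    rw [prod_image snd_injOn_SW, ← prod_inv_distrib]
    exact prod_congr rfl fun A hA => by rw [numR_marks_snd hA]
  have h2 : (∏ k ∈ (SW M b).image Prod.snd, g (numR (marks M b) k)) ≠ 0 :=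
    prod_ne_zero_iff.2 fun _ _ => hg _
  rw [h1, prod_range_succ', ← prod_Icc_one, ← card_marks, ← prod_numR]
  conv_lhs => rw [marks, prod_union disjoint_marks, ← marks]
  field_simp

theorem card_V_eq_iff : (V M b).card = M ↔ M ≤ (downs b).card := by
  rw [V_eq, card_filter_numR_le]; omega

theorem N₈_eq (hM : 1 ≤ M) (hn : ∀ n : ℕ, 1 ≤ n → qint q n ≠ 0) :
    N₈ q M b = ∏ k ∈ (downs b).filter (fun k => IsPairedOff M (numR (downs b) k)),
      qint q (level M (numR (downs b) k) + (rho (arcs b) k - (SR M b).card)) /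
        qint q (rho (arcs b) k + level M (numR (downs b) k)) := by
  rw [N₈]
  simp only [card_V_eq_iff]
  split_ifs with hd
  · obtain ⟨s, hs, hsM⟩ := exists_numR_eq hM hd
    have e1 : ∀ A ∈ outer M b (SR M b),
        ((∏ i ∈ range (N₃ M b + 1), qint q (d₂ M b A + i) / qint q (d₂ M b A + size A + i)) *
        ∏ A' ∈ SW M b, qint q (d₂ M b A + size A + h M b A') / qint q (d₂ M b A + h M b A')) =
        ∏ k ∈ (downs b).filter (fun k => IsPairedOff M (numR (downs b) k)),
          qint q (level M (numR (downs b) k) + (arcsLT (arcs b) A.1 - arcsLT (arcs b) k)) /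
          qint q (level M (numR (downs b) k) + (arcsLT (arcs b) A.1 - arcsLT (arcs b) k) +
            size A) := by
      intro A hA
      have hd2 := d₂_eq hM hs hsM hA
      have hp := prod_range_N₃ (M := M) (b := b)
        (fun i => qint q (d₂ M b A + i) / qint q (d₂ M b A + size A + i))
        (fun i => div_ne_zero (hn _ (by omega)) (hn _ (by omega)))
      simp only [inv_div] at hp
      have hu : (downs b).filter (fun k => IsPairedOff M (numR (downs b) k)) =
          insert s (lefts (T M b)) := by
        rw [← lefts_T_union_labelled_one, labelled_one_of hs hsM, union_comm, insert_eq]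
      have hsT : s ∉ lefts (T M b) := by
        rw [T_eq, mem_lefts_dashed]; rintro ⟨-, h1, -⟩; omega
      rw [hp, hu, prod_insert hsT]
      congr 1
      · rw [hsM, hd2, show level M M = M by rw [level]; omega]
        congr 2
      · refine prod_congr rfl fun k hk => ?_
        obtain ⟨hk1, hk2, -⟩ := mem_lefts_dashed.1 hk
        have hks : k < s := (numR_lt_numR hk1).1 (by omega)
        rw [numR_marks_fst hs hsM hk]
        have h1 := outer_SR_pos hM hs hA
        have h2 := outer_SR_pos hM hk1 hA
        have h3 := rho_anti (arcs b) hks.le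
        have h4 := rho_add_arcsLT (arcs b) k
        have h5 := rho_add_arcsLT (arcs b) s
        have h6 : d₂ M b A + ((numR (downs b) k - M) / 2 + (rho (arcs b) k - rho (arcs b) s)) =
            level M (numR (downs b) k) + (arcsLT (arcs b) A.1 - arcsLT (arcs b) k) := by
          rw [hd2, level]; omega
        rw [add_right_comm, h6]
    rw [prod_congr rfl e1, prod_comm]
    refine prod_congr rfl fun k hk => ?_
    rw [mem_filter] at hk
    have := hk.2.1
    rw [prod_outer_SR hM hn hk.1 (by rw [level]; omega)]
  · rw [filter_eq_empty_iff.2, prod_empty]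
    intro k _ h1
    have := h1.1
    have := numR_le_card (downs b) k
    omega

end BIComponents

end BI
namespace BI

section BIFormula

variable {K : Type*} [Field K] {N : ℕ} {q : K} {M : ℕ} {b : Fin N → Bool}

theorem exists_rightDowns {A : Fin N × Fin N} (hA : 1 ≤ rightDowns (downs b) A) :
    ∃ r ∈ downs b, numR (downs b) r = rightDowns (downs b) A ∧
      ∀ l ∈ downs b, A.2 < l ↔ r ≤ l := by
  have hne : ((downs b).filter fun k => A.2 < k).Nonempty := card_pos.1 hA
  have hr := mem_filter.1 (min'_mem _ hne)
  have key : ∀ l ∈ downs b, A.2 < l ↔ ((downs b).filter fun k => A.2 < k).min' hne ≤ l := by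
    intro l hl
    constructor
    · intro h; exact min'_le _ _ (mem_filter.2 ⟨hl, h⟩)
    · intro h; exact lt_of_lt_of_le hr.2 h
  refine ⟨_, hr.1, ?_, key⟩
  rw [numR, rightDowns]
  congr 1
  exact filter_congr fun l hl => (key l hl).symm

theorem outer_SW (hM : 1 ≤ M) : outer M b (SW M b) = staticArcs M (arcs b) (downs b) := by
  have h := isMatching b
  ext A
  rw [outer, staticArcs, mem_filter, mem_filter, mem_SW, labelled_one]
  constructor
  · rintro ⟨⟨h1, ⟨k, hk, hkA⟩, s, hs, hAs⟩, h2⟩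
    rw [mem_filter] at hs
    have hlt := h.lt _ _ h1
    obtain ⟨r, hr, hr1, hr2⟩ := exists_rightDowns (b := b) (A := A)
      (card_pos.2 ⟨s, mem_filter.2 ⟨hs.1, hAs⟩⟩)
    have hrs := (hr2 s hs.1).1 hAs
    have hrM : M ≤ numR (downs b) r := by rw [← hs.2]; exact (numR_le_numR hs.1).2 hrs
    have hAr : A.2 < r := (hr2 r hr).2 le_rfl
    refine ⟨h1, fun B hB => h2 B (mem_union_left _ hB), ⟨k, hk, hkA⟩, by omega, ?_⟩
    by_contra hodd
    rw [Nat.not_even_iff_odd, ← hr1] at hodd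
    have hkr : numR (downs b) r < numR (downs b) k :=
      (numR_lt_numR hk).2 (hkA.trans (hlt.trans hAr))
    obtain ⟨l, hl, hl'⟩ := exists_numR_eq (D := downs b) (n := numR (downs b) r + 1) (by omega)
      (by have := numR_le_card (downs b) k; omega)
    have hlr : l < r := (numR_lt_numR hl).1 (by omega)
    have hlA := (h.down_out l hl _ _ h1).resolve_right
      fun h3 => absurd ((hr2 l hl).1 h3) (not_le.2 hlr)
    refine h2 (l, r) (mem_union_right _ (mem_dashed.2 ⟨hl, hr, ?_, hodd, hl'⟩)) ⟨hlA, hAr⟩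
    obtain ⟨m, hm⟩ := hodd
    simp only; omega
  · rintro ⟨h1, h2, ⟨k, hk, hkA⟩, h3, h4⟩
    have hlt := h.lt _ _ h1
    obtain ⟨r, hr, hr1, hr2⟩ := exists_rightDowns (b := b) (A := A) (by omega)
    obtain ⟨s, hs, hsM⟩ := exists_numR_eq (D := downs b) hM
      (by have := numR_le_card (downs b) r; omega)
    have hrs : r ≤ s := (numR_le_numR hs).1 (by omega)
    refine ⟨⟨h1, ⟨k, hk, hkA⟩, s, mem_filter.2 ⟨hs, hsM⟩, (hr2 s hs).2 hrs⟩, fun B hB => ?_⟩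
    rcases mem_union.1 hB with hB | hB
    · exact h2 B hB
    · rintro ⟨h5, h6⟩
      obtain ⟨h7, h8, h9, h10, h11⟩ := mem_dashed.1 hB
      have h12 := (numR_le_numR h8).2 ((hr2 _ h8).1 h6)
      have h13 := (numR_lt_numR h7).2 (h5.trans (hlt.trans ((hr2 r hr).2 le_rfl)))
      rw [show numR (downs b) B.2 = rightDowns (downs b) A by omega] at h10
      exact Nat.not_even_iff_odd.2 h10 h4

theorem mem_outer_SL (hd : M ≤ (downs b).card) (hM : 1 ≤ M) {A : Fin N × Fin N} :
    A ∈ outer M b (SL M b) ↔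
      A ∈ outerLeft (arcs b) (downs b) ∧ ∀ k ∈ ups b, k < A.1 := by
  have h := isMatching b
  obtain ⟨s, hs, hsM⟩ := exists_numR_eq hM hd
  rw [outer, SL, mem_filter, mem_filter, outerLeft, mem_filter, labelled_one_of hs hsM]
  constructor
  · rintro ⟨⟨h1, -, h2, h3⟩, h4⟩
    exact ⟨⟨h1, fun B hB => h4 B (mem_union_left _ hB), h3⟩, h2⟩
  · rintro ⟨⟨h1, h4, h3⟩, h2⟩
    refine ⟨⟨h1, singleton_nonempty s, h2, h3⟩, fun B hB => ?_⟩
    rcases mem_union.1 hB with hB | hB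
    · exact h4 B hB
    · rintro ⟨h5, -⟩
      exact lt_asymm h5 ((h.lt _ _ h1).trans (h3 _ (mem_dashed.1 hB).1))

theorem N₁_eq_zero_iff (hd : M ≤ (downs b).card) :
    N₁ M b = 0 ↔ IsPairedOff M (downs b).card := by
  rw [N₁_eq, ite_eq_right_iff]
  constructor
  · intro h
    refine ⟨hd, ?_⟩
    by_contra h1
    rw [Nat.not_even_iff_odd] at h1
    refine absurd (h ⟨?_, h1⟩) one_ne_zero
    obtain ⟨m, hm⟩ := h1; omega
  · rintro ⟨-, h1⟩ ⟨-, h2⟩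
    exact absurd h1 (Nat.not_even_iff_odd.2 h2)

theorem N₁_le_one : N₁ M b ≤ 1 := by rw [N₁_eq]; split_ifs <;> omega

theorem N₉_eq (hM : 1 ≤ M) : N₉ q M b = zStatic q M (arcs b) (downs b) *
    if IsPairedOff M (downs b).card then zLast q M (arcs b) (ups b) (downs b) else 1 := by
  have h := isMatching b
  have h1 := N₁_le_one (M := M) (b := b)
  rw [N₉, outer_SW hM]
  split_ifs with h2 h3 h3
  · have := (N₁_eq_zero_iff h3.1).2 h3; omega
  · rw [mul_one]; rfl
  · rw [prod_union]
    · congr 1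
      refine prod_congr ?_ fun _ _ => rfl
      ext A
      rw [mem_outer_SL h3.1 hM, mem_filter]
    · rw [disjoint_left]
      intro A hA hA'
      rw [mem_outer_SL h3.1 hM, outerLeft, mem_filter] at hA'
      obtain ⟨h4, -, ⟨k, hk, hkA⟩, -⟩ := mem_filter.1 hA
      exact lt_asymm hkA ((h.lt _ _ h4).trans (hA'.1.2.2 k hk))
  · have h4 : (downs b).card < M := by
      by_contra! h4
      exact h3 ((N₁_eq_zero_iff h4).1 (by omega))
    have : outer M b (SL M b) = ∅ := by
      rw [outer, SL, labelled_one, filter_eq_empty_iff]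
      intro A hA
      obtain ⟨-, ⟨k, hk⟩, -⟩ := mem_filter.1 hA
      have := numR_le_card (downs b) k
      rw [mem_filter] at hk
      omega
    rw [this, union_empty, mul_one]; rfl

theorem N₄_eq (hM : 1 ≤ M) (hd : M ≤ (downs b).card) {l : Fin N} (hl : l ∈ downs b)
    (hl' : numR (downs b) l = (downs b).card) :
    N₄ M b = level M (numR (downs b) l) + (rho (arcs b) l - (SR M b).card) ∧
      (SW' M b).card + (SW M b).card + (SR M b).card = rho (arcs b) l := by
  have h := isMatching b
  obtain ⟨s, hs, hsM⟩ := exists_numR_eq hM hd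
  obtain ⟨R, hR, hR1⟩ := exists_numR_eq (D := downs b) (n := 1) le_rfl (by omega)
  have hls : l ≤ s := (numR_le_numR hs).1 (by omega)
  have hsR : s ≤ R := (numR_le_numR hR).1 (by omega)
  have e1 : (SW M b).card = rho (arcs b) l - rho (arcs b) s := by
    rw [← h.rho_sub hl hs hls]
    congr 1
    ext A
    rw [mem_SW, mem_filter, labelled_one_of hs hsM]
    simp only [mem_singleton, exists_eq_left]
    refine and_congr_right fun _ => and_congr_left fun _ => ⟨?_, fun h1 => ⟨l, hl, h1⟩⟩
    rintro ⟨k, hk, hkA⟩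
    refine lt_of_le_of_lt ((numR_le_numR hk).1 ?_) hkA
    rw [hl']; exact numR_le_card _ _
  have e2 : (SW' M b).card = rho (arcs b) s - rho (arcs b) R := by
    rw [← h.rho_sub hs hR hsR, SW', labelled_one_of hs hsM, labelled_self_of hM hR hR1]
    simp
  have h1 := rho_anti (arcs b) hls
  have h2 := rho_anti (arcs b) hsR
  rw [N₄, e1, e2, card_SR hM hR hR1, T_eq, card_dashed, level, hl']
  omega

theorem N₅_eq (hM : 1 ≤ M) (hd : M ≤ (downs b).card) :
    N₅ M b = N + M - arcsBeforeUp (arcs b) (ups b) := by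
  have h := isMatching b
  obtain ⟨s, hs, hsM⟩ := exists_numR_eq hM hd
  obtain ⟨l, hl, hl'⟩ := exists_numR_eq (D := downs b) (n := (downs b).card) (by omega) le_rfl
  have hfirst : ∀ k ∈ downs b, l ≤ k := fun k hk =>
    (numR_le_numR hk).1 (by rw [hl']; exact numR_le_card _ _)
  have e1 : (SL M b).card + arcsBeforeUp (arcs b) (ups b) + rho (arcs b) l = (arcs b).card := by
    rw [rho, ← card_filter_add_card_filter_not (s := arcs b) (fun A => l ≤ A.1),
      ← card_filter_add_card_filter_not (s := (arcs b).filter fun A => ¬ l ≤ A.1)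
        (fun A => ∃ k ∈ ups b, A.1 < k), filter_filter, filter_filter]
    have e2 : (arcs b).filter (fun A => ¬ l ≤ A.1 ∧ ∃ k ∈ ups b, A.1 < k) =
        (arcs b).filter fun A => ∃ k ∈ ups b, A.1 < k := by
      refine filter_congr fun A _ => and_iff_right_of_imp ?_
      rintro ⟨k, hk, hkA⟩
      exact not_le.2 (hkA.trans (h.up_lt_down k hk l hl))
    have e3 : (arcs b).filter (fun A => ¬ l ≤ A.1 ∧ ¬ ∃ k ∈ ups b, A.1 < k) = SL M b := by
      rw [SL, labelled_one_of hs hsM]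
      refine filter_congr fun A hA => ?_
      have hlt := h.lt _ _ hA
      simp only [singleton_nonempty, true_and, not_exists, not_and, not_lt]
      rw [and_comm]
      refine and_congr ⟨fun h1 k hk => ?_, fun h1 k hk => (h1 k hk).le⟩ ⟨fun h1 k hk => ?_,
        fun h1 => not_le.2 (hlt.trans (h1 l hl))⟩
      · refine lt_of_le_of_ne (h1 k hk) ?_
        rintro rfl
        exact h.fst_notMem_up hA hk
      · refine lt_of_lt_of_le ((h.down_out l hl _ _ hA).resolve_left ?_) (hfirst k hk)
        exact fun h2 => h1 h2.le
    rw [e2, e3, arcsBeforeUp]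
    omega
  have e2 := (N₄_eq hM hd hl hl').2
  have e3 := h.length_eq
  rw [N₅]
  omega

/-- The inverse of the quantum integer of `d₄` or `d₅`. -/
def levelInv (q : K) (M : ℕ) (b : Fin N → Bool) (k : Fin N) : K :=
  (qint q (level M (numR (downs b) k) + (rho (arcs b) k - (SR M b).card)))⁻¹

theorem levelInv_of_one (hq : q ≠ 0) (hM : 1 ≤ M) {k : Fin N} (hk : k ∈ downs b)
    (hk1 : numR (downs b) k = 1) : levelInv q M b k = 1 := by
  rw [levelInv, card_SR hM hk hk1, hk1, Nat.sub_self, level, show min 1 M + (1 - M) / 2 + 0 = 1 by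
    omega, qint_one hq, inv_one]

theorem prod_U' (hq : q ≠ 0) (hM : 1 ≤ M) : ∏ C ∈ U' M b, (qint q (d₄ M b C))⁻¹ =
    ∏ k ∈ (downs b).filter (fun k => numR (downs b) k < M), levelInv q M b k := by
  have key : ∏ k ∈ (downs b).filter (fun k => 2 ≤ numR (downs b) k ∧ numR (downs b) k < M),
      levelInv q M b k =
      ∏ k ∈ (downs b).filter (fun k => numR (downs b) k < M), levelInv q M b k := by
    refine prod_subset (fun k hk => ?_) fun k hk hk' => ?_
    · rw [mem_filter] at hk ⊢
      exact ⟨hk.1, hk.2.2⟩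
    · rw [mem_filter] at hk hk'
      have := numR_pos hk.1
      exact levelInv_of_one hq hM hk.1 (by
        by_contra h1
        exact hk' ⟨hk.1, by omega, hk.2⟩)
  rw [U'_eq, ← key]
  refine prod_congr rfl fun k hk => ?_
  rw [mem_filter] at hk
  rw [d₄_eq hM hk.1 hk.2.2.le, levelInv]

theorem prod_V' (hq : q ≠ 0) (hM : 1 ≤ M) : ∏ C ∈ V' M b, (qint q (d₄ M b C))⁻¹ =
    (∏ k ∈ (downs b).filter (fun k => numR (downs b) k < M), levelInv q M b k) *
      ∏ k ∈ labelled M b 1, levelInv q M b k := by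
  rw [V', prod_union, prod_U' hq hM]
  · congr 1
    rw [labelled_one]
    refine prod_congr rfl fun k hk => ?_
    rw [mem_filter] at hk
    rw [d₄_eq hM hk.1 hk.2.le, levelInv]
  · rw [U'_eq, labelled_one, disjoint_filter]
    rintro k - h1 h2; omega

theorem prod_d₅ (hM : 1 ≤ M) {X : Finset (Fin N × Fin N)} (hX : X ⊆ T M b) :
    ∏ E ∈ X, (qint q (d₅ M b E))⁻¹ = ∏ k ∈ lefts X, levelInv q M b k := by
  rw [lefts, prod_image]
  · exact prod_congr rfl fun E hE => by rw [d₅_eq hM (hX hE), levelInv]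
  · exact fst_injOn_dashed.mono hX

theorem prod_lefts_T_union : ∏ k ∈ (downs b).filter (fun k => IsPairedOff M (numR (downs b) k)),
      levelInv q M b k =
    (∏ k ∈ lefts (T M b), levelInv q M b k) * ∏ k ∈ labelled M b 1, levelInv q M b k := by
  rw [← lefts_T_union_labelled_one, prod_union]
  rw [T_eq, lefts_dashed, labelled_one, disjoint_filter]
  rintro k - h1 h2; omega

theorem N₆_mul_N₁₀ (hq : q ≠ 0) (hM : 1 ≤ M) : N₆ q M b * N₁₀ q M b =
    (∏ k ∈ (downs b).filter (fun k => numR (downs b) k < M), levelInv q M b k) *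
    (∏ k ∈ (downs b).filter (fun k => IsPairedOff M (numR (downs b) k)), levelInv q M b k) *
    if IsPairedOff M (downs b).card then qint q (N + M - arcsBeforeUp (arcs b) (ups b)) else 1 := by
  have h1 := N₁_le_one (M := M) (b := b)
  rw [prod_lefts_T_union, N₆, N₁₀, prod_U' hq hM, prod_V' hq hM, prod_d₅ hM subset_rfl,
    prod_d₅ hM (show T' M b ⊆ T M b from filter_subset _ _)]
  have hV := card_V_eq_iff (M := M) (b := b)
  rcases Nat.lt_or_ge (downs b).card M with hd | hd
  · have h2 : ¬ IsPairedOff M (downs b).card := fun h => by have := h.1; omega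
    have h3 : N₁ M b = 0 := by rw [N₁_eq, if_neg (fun h => by omega)]
    have h4 : T M b = ∅ := by rw [← card_eq_zero, T_eq, card_dashed]; omega
    have h5 : labelled M b 1 = ∅ := by
      rw [labelled_one, filter_eq_empty_iff]
      intro k _ hk
      have := numR_le_card (downs b) k
      omega
    rw [if_neg h2, if_neg (fun h => by omega), if_neg (by omega), if_pos h4, h4, h5]
    simp [lefts]
  by_cases h2 : IsPairedOff M (downs b).card
  swap
  · have h3 : N₁ M b = 1 := by
      have := mt (N₁_eq_zero_iff hd).1 h2; omega
    rw [if_neg h2, if_neg (fun h => by omega), if_pos h3]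
    ring
  have h3 := (N₁_eq_zero_iff hd).2 h2
  obtain ⟨l, hl, hl'⟩ := exists_numR_eq (D := downs b) (n := (downs b).card) (by omega) le_rfl
  have hlv : qint q (N₅ M b) / qint q (N₄ M b) =
      qint q (N + M - arcsBeforeUp (arcs b) (ups b)) * levelInv q M b l := by
    rw [(N₄_eq hM hd hl hl').1, N₅_eq hM hd, div_eq_mul_inv, levelInv]
  rw [if_pos h2, if_pos ⟨hV.2 hd, h3⟩, if_neg (by omega), hlv]
  split_ifs with h4
  · have h5 : (downs b).card = M := by
      have h6 := card_dashed (M := M) (D := downs b)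
      rw [← T_eq, h4, card_empty] at h6
      obtain ⟨h7, m, hm⟩ := h2
      omega
    rw [labelled_one_of hl (by omega), prod_singleton, h4]
    simp only [lefts, image_empty, prod_empty]
    ring
  · have h5 : lefts (T' M b) = (lefts (T M b)).erase l := by
      obtain ⟨E, hE⟩ := nonempty_iff_ne_empty.2 h4
      obtain ⟨h6, h7, h8⟩ := mem_lefts_dashed.1 (mem_lefts.2 ⟨E.2, hE⟩)
      have h9 : l ∈ lefts (T M b) := mem_lefts_dashed.2
        ⟨hl, by have := numR_le_card (downs b) E.1; omega, by rw [hl']; exact h2.2⟩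
      ext k
      rw [mem_erase, mem_lefts, mem_lefts]
      constructor
      · rintro ⟨j, hj⟩
        obtain ⟨h10, E', hE', h11⟩ := mem_filter.1 hj
        refine ⟨?_, j, h10⟩
        rintro rfl
        have h12 := (numR_lt_numR (mem_dashed.1 hE').1).2 h11
        have := numR_le_card (downs b) E'.1
        simp only at h12
        omega
      · rintro ⟨h10, j, hj⟩
        obtain ⟨i, hi⟩ := mem_lefts.1 h9
        refine ⟨j, mem_filter.2 ⟨hj, (l, i), hi, lt_of_le_of_ne ?_ (Ne.symm h10)⟩⟩
        exact (numR_le_numR (mem_dashed.1 hj).1).1 (by rw [hl']; exact numR_le_card _ _)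
    have h6 : l ∈ lefts (T M b) := by
      obtain ⟨E, hE⟩ := nonempty_iff_ne_empty.2 h4
      obtain ⟨h6, h7, h8⟩ := mem_lefts_dashed.1 (mem_lefts.2 ⟨E.2, hE⟩)
      exact mem_lefts_dashed.2
        ⟨hl, by have := numR_le_card (downs b) E.1; omega, by rw [hl']; exact h2.2⟩
    rw [h5, ← mul_prod_erase _ _ h6]
    ring

theorem psi_eq (hq : q ≠ 0) (hn : ∀ n : ℕ, 1 ≤ n → qint q n ≠ 0) (hM : 1 ≤ M) :
    psi q M b = cleanBI q M (arcs b) (ups b) (downs b) := by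
  have hlight : (∏ k ∈ (downs b).filter (fun k => numR (downs b) k < M),
      qint q (level M (numR (downs b) k) + (rho (arcs b) k - (SR M b).card)) /
        qint q (rho (arcs b) k + level M (numR (downs b) k))) *
      ∏ k ∈ (downs b).filter (fun k => numR (downs b) k < M), levelInv q M b k =
      ∏ k ∈ (downs b).filter (fun k => numR (downs b) k < M),
        (qint q (rho (arcs b) k + level M (numR (downs b) k)))⁻¹ := by
    rw [← prod_mul_distrib]
    refine prod_congr rfl fun k hk => ?_
    rw [mem_filter] at hk
    have h1 := numR_pos hk.1
    have h2 := hn (level M (numR (downs b) k) + (rho (arcs b) k - (SR M b).card))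
      (by rw [level]; omega)
    rw [levelInv]
    field_simp
  have hheavy : (∏ k ∈ (downs b).filter (fun k => IsPairedOff M (numR (downs b) k)),
      qint q (level M (numR (downs b) k) + (rho (arcs b) k - (SR M b).card)) /
        qint q (rho (arcs b) k + level M (numR (downs b) k))) *
      (∏ k ∈ (downs b).filter (fun k => IsPairedOff M (numR (downs b) k)), levelInv q M b k) *
      (∏ k ∈ (downs b).filter (fun k => IsPairedOff M (numR (downs b) k)),
        (sym (q ^ (rho (arcs b) k + level M (numR (downs b) k))))⁻¹) =
      ∏ k ∈ (downs b).filter (fun k => IsPairedOff M (numR (downs b) k)),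
        (qint q (2 * (rho (arcs b) k + level M (numR (downs b) k))))⁻¹ := by
    rw [← prod_mul_distrib, ← prod_mul_distrib]
    refine prod_congr rfl fun k hk => ?_
    rw [mem_filter] at hk
    have h1 := numR_pos hk.1
    have h2 := hn (level M (numR (downs b) k) + (rho (arcs b) k - (SR M b).card))
      (by rw [level]; omega)
    rw [levelInv, qint_two_mul hq, mul_inv]
    field_simp
  have h610 := N₆_mul_N₁₀ (b := b) hq hM
  have e : psi q M b = arcWeight q (arcs b) * (N₆ q M b * N₁₀ q M b) * N₇ q M b * N₈ q M b *
      N₉ q M b * N₁₁ q M b * N₁₂ q M b := by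
    rw [psi, arcWeight]; ring
  rw [e, h610, N₇_eq hM hn, N₈_eq hM hn, N₉_eq hM, N₁₁_eq hn, N₁₂_eq, cleanBI, downWeight_wBI,
    ← hlight, ← hheavy, thetaBI, zMoving]
  split_ifs <;> ring

end BIFormula

end BI

theorem PsiBI_eq_PsiStd {K : Type*} [Field K] {N : ℕ} {q : K} (hq : q ≠ 0)
    (hn : ∀ n : ℕ, 1 ≤ n → qint q n ≠ 0) {M : ℕ} (hM : 1 ≤ M) :
    PsiBI N q M = PsiStd N q (q ^ M) := by
  rw [PsiBI, sum_congr rfl (fun b _ => by rw [BI.ket_eq])]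
  refine sum_genKet_eq_PsiStd (isDownSystem_BI hq hM) (fun _ b => BI.psi q M b) ?_ ?_ ?_ N
  · intro b
    rw [BI.psi_eq hq hn hM, ← cleanBI_nil (q := q) hM]
    congr 1
  · intro N b
    have h := isMatching b
    rw [BI.psi_eq hq hn hM, BI.psi_eq hq hn hM]
    rcases (ups b).eq_empty_or_nonempty with hU | hU
    · rw [hU] at h ⊢
      have h' := h.cons_false_of_empty
      rw [h'.arcs_eq, h'.ups_eq, h'.downs_eq, h.cleanBI_cons_false_of_empty hq hn hM]
    · have hk := (ups b).min'_mem hU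
      have hmin : ∀ l ∈ ups b, (ups b).min' hU ≤ l := fun l hl => min'_le _ l hl
      generalize (ups b).min' hU = k at hk hmin
      have h' := h.cons_false_of_first hk hmin
      rw [h'.arcs_eq, h'.ups_eq, h'.downs_eq, h.cleanBI_cons_false_of_first hn hk hmin]
  · intro N f
    have h := isMatching f
    have hs := h.shift'
    simp only [BI.psi_eq hq hn hM]
    rw [hs.arcs_eq, hs.ups_eq, hs.downs_eq]
    have e1 : ∑ A ∈ outerLeft (arcs f) (downs f),
        q⁻¹ ^ (((ups f).filter fun m => m < A.1).card + 1) *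
          cleanBI q M (arcs (Function.update f A.1 true)) (ups (Function.update f A.1 true))
            (downs (Function.update f A.1 true)) =
        ∑ A ∈ outerLeft (arcs f) (downs f),
          q⁻¹ ^ (((ups f).filter fun m => m < A.1).card + 1) *
          cleanBI q M ((arcs f).erase A) (insert A.1 (insert A.2 (ups f))) (downs f) := by
      refine sum_congr rfl ?_
      rintro ⟨i, j⟩ hA
      rw [outerLeft, mem_filter] at hA
      have h' := h.split hA.1 (fun i' j' h' => hA.2.1 _ h') hA.2.2
      rw [h'.arcs_eq, h'.ups_eq, h'.downs_eq]
    have e2 : ∑ k ∈ firstOf (downs f), q⁻¹ ^ ((ups f).card + 1) *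
          cleanBI q M (arcs (Function.update f k true)) (ups (Function.update f k true))
            (downs (Function.update f k true)) =
        ∑ k ∈ firstOf (downs f), q⁻¹ ^ ((ups f).card + 1) *
          cleanBI q M (arcs f) (insert k (ups f)) ((downs f).erase k) := by
      refine sum_congr rfl fun k hk => ?_
      rw [mem_firstOf] at hk
      have h' := h.promote hk.1 hk.2
      rw [h'.arcs_eq, h'.ups_eq, h'.downs_eq]
    have e3 : ∀ c : K, ∑ k ∈ lastOf (ups f), q⁻¹ ^ ((ups f).card - 1) * c *
          cleanBI q M (arcs (Function.update f k false)) (ups (Function.update f k false))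
            (downs (Function.update f k false)) =
        ∑ k ∈ lastOf (ups f), q⁻¹ ^ ((ups f).card - 1) * c *
          cleanBI q M (arcs f) ((ups f).erase k) (insert k (downs f)) := by
      intro c
      refine sum_congr rfl fun k hk => ?_
      rw [mem_lastOf] at hk
      have h' := h.demote hk.1 hk.2
      rw [h'.arcs_eq, h'.ups_eq, h'.downs_eq]
    rw [e1, e2, e3]
    rcases Nat.lt_or_ge (downs f).card M with hd | hd
    · rw [h.cleanBI_cons_true_of_lt hq hn hd, if_neg (fun h => by
        obtain ⟨h1, m, hm⟩ := h; omega)]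
      simp
    · rw [gammaBI, if_neg (by omega)]
      rcases Nat.even_or_odd ((downs f).card - M) with he | ho
      · rw [h.cleanBI_cons_true_of_even hq hn hM ⟨hd, he⟩, if_pos]
        · ring
        · refine ⟨by omega, ?_⟩
          rw [show (downs f).card + 1 - M = (downs f).card - M + 1 by omega]
          exact he.add_one
      · rw [h.cleanBI_cons_true_of_odd hq hn hM hd ho, if_neg]
        · simp
        · rintro ⟨-, h1⟩
          rw [show (downs f).card + 1 - M = (downs f).card - M + 1 by omega] at h1
          exact Nat.not_odd_iff_even.2 ho.add_one h1

end TwoBoundaryTL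

theorem mainTheorem7 {K : Type*} [Field K] (N : ℕ) (hN : 0 < N) (q : K) (hq : q ≠ 0) :
    -- types BI, BII and BIII
    ((∀ n : ℕ, 1 ≤ n → TwoBoundaryTL.qint q n ≠ 0) →
      (∀ M : ℕ, 1 ≤ M →
        (∀ i : Fin N, (TwoBoundaryTL.e q (q ^ M) i).mulVec (TwoBoundaryTL.PsiBI N q M) = 0) ∧
        (∀ Q₀ : K, q ^ (N - 1) * q ^ M * Q₀ = 1 →
          (TwoBoundaryTL.e₀ hN Q₀).mulVec (TwoBoundaryTL.PsiBI N q M) = 0)) ∧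
      (∀ Q : K, Q ≠ 0 →
        (∀ i : Fin N, (TwoBoundaryTL.e q Q i).mulVec (TwoBoundaryTL.PsiBII N q Q) = 0) ∧
        (∀ Q₀ : K, q ^ (N - 1) * Q * Q₀ = 1 →
          (TwoBoundaryTL.e₀ hN Q₀).mulVec (TwoBoundaryTL.PsiBII N q Q) = 0)) ∧
      (∀ Q : K, Q ≠ 0 →
        (∀ i : Fin N, (TwoBoundaryTL.e q Q i).mulVec (TwoBoundaryTL.PsiBIII N q Q) = 0) ∧
        (∀ Q₀ : K, q ^ (N - 1) * Q * Q₀ = 1 →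
          (TwoBoundaryTL.e₀ hN Q₀).mulVec (TwoBoundaryTL.PsiBIII N q Q) = 0))) ∧
    -- the standard basis
    (∀ Q : K, Q ≠ 0 →
      (∀ i : Fin N, (TwoBoundaryTL.e q Q i).mulVec (TwoBoundaryTL.PsiStd N q Q) = 0) ∧
      (∀ Q₀ : K, q ^ (N - 1) * Q * Q₀ = 1 →
        (TwoBoundaryTL.e₀ hN Q₀).mulVec (TwoBoundaryTL.PsiStd N q Q) = 0)) := by
  refine ⟨fun hn => ⟨fun M hM => ?_, fun Q hQ => ?_, fun Q hQ => ?_⟩, fun Q hQ => ?_⟩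
  · rw [TwoBoundaryTL.PsiBI_eq_PsiStd hq hn hM]
    exact ⟨TwoBoundaryTL.e_mulVec_PsiStd hq (pow_ne_zero M hq),
      fun Q₀ => TwoBoundaryTL.e₀_mulVec_PsiStd hN⟩
  · rw [TwoBoundaryTL.PsiBII_eq_PsiStd hq hQ hn]
    exact ⟨TwoBoundaryTL.e_mulVec_PsiStd hq hQ, fun Q₀ => TwoBoundaryTL.e₀_mulVec_PsiStd hN⟩
  · rw [TwoBoundaryTL.PsiBIII_eq_PsiStd hq hQ hn]
    exact ⟨TwoBoundaryTL.e_mulVec_PsiStd hq hQ, fun Q₀ => TwoBoundaryTL.e₀_mulVec_PsiStd hN⟩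
  · exact ⟨TwoBoundaryTL.e_mulVec_PsiStd hq hQ, fun Q₀ => TwoBoundaryTL.e₀_mulVec_PsiStd hN⟩
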